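/- Let $G$ be a finite group, $\mathcal{O}$ an indexing system for $G$, $\underline{A}$ an $\mathcal{O}$-Tambara functor and $\underline{B}$ an $\underline{A}$-algebra, i.e. an $\mathcal{O}$-Tambara functor with a map $\underline{A}\to\underline{B}$ of $\mathcal{O}$-Tambara functors. Write $R_f$, $T_f$, $N_f$ for restriction, transfer and norm along a map $f\colon X\to Y$ of finite $G$-sets; $N_f$ is defined when $f$ is admissible, i.e. when the orbit $G_{f(x)}/G_x$ belongs to $\mathcal{O}(G/G_{f(x)})$ for all $x\in X$. Let $\mu\colon \underline{B}\boxtimes_{\underline{A}}\underline{B}\to\underline{B}$ be the multiplication $T_p(b\otimes b')\mapsto T_p(bb')$ of the fibred box product, where $p\colon U\to X$ and $b,b'\in\underline{B}(U)$, and let $\underline{I}=\ker\mu$. Let $\underline{I}^{>1}$ be the smallest ideal of the $\mathcal{O}$-Tambara functor $\underline{B}\boxtimes_{\underline{A}}\underline{B}$ containing all $N_f(i)$ with $i\in\underline{I}(X)$ and $f\colon X\to Y$ admissible and 2-surjective (every fibre of $f$ has at least two elements). Put $\Omega_{\underline{A}|\underline{B}}=\underline{I}/\underline{I}^{>1}$,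 a $\underline{B}$-module through $b\mapsto b\otimes 1$, and let $\delta\colon\underline{B}\to\Omega_{\underline{A}|\underline{B}}$ be $\delta(b)=\overline{1\otimes b-b\otimes 1}$. For a $\underline{B}$-module $\underline{W}$ let $\operatorname{Der}_{\underline{A}}(\underline{B},\underline{W})$ be the abelian group of $\mathcal{O}$-genuine $\underline{A}$-derivations: the maps of Mackey functors $d\colon\underline{B}\to\underline{W}$ such that $\underline{A}\to\underline{B}\xrightarrow{d}\underline{W}$ is zero and $$d(N_f(s))=T_f\bigl(N_{\pi_2}R_{\pi_1}(s)\cdot d(s)\bigr)$$ for every admissible $f\colon X\to Y$ and $s\in\underline{B}(X)$, where $\pi_1,\pi_2\colon X\times_Y X-\Delta(X)\to X$ are the projections. Then for every $\underline{B}$-module $\underline{W}$ and every $h\in\operatorname{Hom}_{\underline{B}}(\Omega_{\underline{A}|\underline{B}},\underline{W})$ the composite $h\circ\delta$ is an $\mathcal{O}$-genuine $\underline{A}$-derivation, and the map $$\operatorname{Hom}_{\underline{B}}(\Omega_{\underline{A}|\underline{B}},\underline{W})\to\operatorname{Der}_{\underline{A}}(\underline{B},\underline{W}),\qquad h\mapsto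 h\circ\delta,$$ is an isomorphism of abelian groups. -/

import Mathlib

set_option linter.unusedSectionVars false
set_option linter.unusedVariables false

universe u v w t

/-! ### Finite `G`-sets -/

/-- A finite `G`-set. -/
structure FinGSet (G : Type u) [Group G] where
  carrier : Type u
  [action : MulAction G carrier]
  [finite : Finite carrier]

namespace FinGSet

variable {G : Type u} [Group G]

instance : CoeSort (FinGSet G) (Type u) := ⟨FinGSet.carrier⟩

attribute [instance] FinGSet.action FinGSet.finite

/-- The empty `G`-set. -/
def empty (G : Type u) [Group G] : FinGSet G :=
  letI : MulAction G PEmpty.{u + 1} :=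
    { smul := fun _ x => x, one_smul := fun _ => rfl, mul_smul := fun _ _ _ => rfl }
  ⟨PEmpty⟩

instance : IsEmpty (empty G) := inferInstanceAs (IsEmpty PEmpty)

/-- The unique map out of the empty `G`-set. -/
def ofEmpty (X : FinGSet G) : empty G →[G] X where
  toFun x := isEmptyElim x
  map_smul' _ x := isEmptyElim x

/-- Disjoint union. -/
def sum (X Y : FinGSet G) : FinGSet G := ⟨X ⊕ Y⟩

/-- First inclusion into a disjoint union. -/
def inl (X Y : FinGSet G) : X →[G] X.sum Y := ⟨Sum.inl, fun _ _ => rfl⟩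

/-- Second inclusion into a disjoint union. -/
def inr (X Y : FinGSet G) : Y →[G] X.sum Y := ⟨Sum.inr, fun _ _ => rfl⟩

/-- The map out of a disjoint union. -/
def desc {X Y Z : FinGSet G} (f : X →[G] Z) (g : Y →[G] Z) : X.sum Y →[G] Z where
  toFun := Sum.elim f g
  map_smul' m x := by
    rcases x with x | x
    · exact map_smul f m x
    · exact map_smul g m x

/-- The invariant subset of a finite `G`-set cut out by an invariant predicate. -/
def sub (X : FinGSet G) (q : X → Prop) (hq : ∀ (m : G) x, q x → q (m • x)) : FinGSet G :=
  letI : MulAction G {x : X // q x} :=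
    { smul := fun m x => ⟨m • x.1, hq m x.1 x.2⟩
      one_smul := fun x => Subtype.ext (one_smul G x.1)
      mul_smul := fun m n x => Subtype.ext (mul_smul m n x.1) }
  ⟨{x : X // q x}⟩

/-- Cartesian product. -/
def prod (X Y : FinGSet G) : FinGSet G := ⟨X × Y⟩

/-- The fibre product `{(x, y) | f x = g y}`. -/
def pb {X Y Z : FinGSet G} (f : X →[G] Z) (g : Y →[G] Z) : FinGSet G :=
  sub (prod X Y) (fun z => f z.1 = g z.2) fun m z h => by
    change f (m • z.1) = g (m • z.2)
    rw [map_smul, map_smul, h]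

/-- First projection of the fibre product. -/
def pbFst {X Y Z : FinGSet G} (f : X →[G] Z) (g : Y →[G] Z) : pb f g →[G] X :=
  ⟨fun z => z.1.1, fun _ _ => rfl⟩

/-- Second projection of the fibre product. -/
def pbSnd {X Y Z : FinGSet G} (f : X →[G] Z) (g : Y →[G] Z) : pb f g →[G] Y :=
  ⟨fun z => z.1.2, fun _ _ => rfl⟩

/-- The map into the fibre product. -/
def pbLift {W X Y Z : FinGSet G} (f : X →[G] Z) (g : Y →[G] Z) (a : W →[G] X) (b : W →[G] Y)
    (h : ∀ w, f (a w) = g (b w)) : W →[G] pb f g :=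
  ⟨fun w => ⟨(a w, b w), h w⟩, fun m w => Subtype.ext (Prod.ext (map_smul a m w) (map_smul b m w))⟩

/-- The complement `X ×_Y X - Δ(X)` of the diagonal in the fibre square of `f : X → Y`. -/
def offDiag {X Y : FinGSet G} (f : X →[G] Y) : FinGSet G :=
  sub (pb f f) (fun z => z.1.1 ≠ z.1.2) fun m _ h e => h (MulAction.injective m e)

/-- First projection `X ×_Y X - Δ(X) → X`. -/
def offFst {X Y : FinGSet G} (f : X →[G] Y) : offDiag f →[G] X :=
  ⟨fun z => z.1.1.1, fun _ _ => rfl⟩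

/-- Second projection `X ×_Y X - Δ(X) → X`. -/
def offSnd {X Y : FinGSet G} (f : X →[G] Y) : offDiag f →[G] X :=
  ⟨fun z => z.1.1.2, fun _ _ => rfl⟩

/-- The commutative square `f ∘ p = g ∘ q` is a pullback square. -/
def IsPb {P X Y Z : FinGSet G} (p : P →[G] X) (q : P →[G] Y) (f : X →[G] Z) (g : Y →[G] Z) :
    Prop :=
  (∀ z, f (p z) = g (q z)) ∧ ∀ x y, f x = g y → ∃! z, p z = x ∧ q z = y

/-- `X ← A ← E → D → Y` is an exponential diagram for `h : A → X` and `g : X → Y`: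
`D` is the set `∏_g A` of pairs `(y, s)` of a point `y` of `Y` and a section `s` of `h` over the
fibre `g⁻¹(y)`, with `h' (y, s) = y`; `E` is the fibre product `X ×_Y D` with projections `h ∘ f'`
and `g'`; and `f'` is the evaluation `(x, y, s) ↦ s x`. -/
structure IsExp {A X Y D E : FinGSet G} (h : A →[G] X) (g : X →[G] Y)
    (f' : E →[G] A) (g' : E →[G] D) (h' : D →[G] Y) : Prop where
  isPb : IsPb (h.comp f') g' g h'
  sections : ∀ (y : Y) (s : {x // g x = y} → A), (∀ x, h (s x) = x) →
    ∃! d : D, h' d = y ∧ ∀ e, g' e = d → ∀ x, h (f' e) = x.1 → f' e = s x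

/-- Every fibre of `f` has at least two elements. -/
def TwoSurj {X Y : FinGSet G} (f : X →[G] Y) : Prop := ∀ y, 2 ≤ (f ⁻¹' {y}).ncard

end FinGSet

/-! ### Indexing systems -/

/-- An indexing system: a functorial choice, for every subgroup `H` of `G`, of a class of finite
`H`-sets (the admissible ones), containing the trivial sets and closed under disjoint unions,
finite limits and self-induction. -/
structure IndexingSystem (G : Type u) [Group G] [Finite G] where
  mem : ∀ (H : Subgroup G) (T : Type u) [MulAction H T] [Finite T], Prop
  /-- Functoriality on the orbit category (along `kK ↦ kgH`) and invariance under isomorphism. -/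
  map_mem : ∀ {H K : Subgroup G} (g : G) (hg : ∀ k ∈ K, g⁻¹ * k * g ∈ H)
    {T T' : Type u} [MulAction H T] [Finite T] [MulAction K T'] [Finite T'] (e : T ≃ T'),
    (∀ (k : K) (t : T), e ((⟨g⁻¹ * k * g, hg k k.2⟩ : H) • t) = k • e t) → mem H T → mem K T'
  trivial_mem : ∀ {H : Subgroup G} {T : Type u} [MulAction H T] [Finite T],
    (∀ (h : H) (t : T), h • t = t) → mem H T
  sum_mem : ∀ {H : Subgroup G} {T T' : Type u} [MulAction H T] [Finite T] [MulAction H T']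
    [Finite T'], mem H T → mem H T' → mem H (T ⊕ T')
  prod_mem : ∀ {H : Subgroup G} {T T' : Type u} [MulAction H T] [Finite T] [MulAction H T']
    [Finite T'], mem H T → mem H T' → mem H (T × T')
  /-- Closure under equalizers; `i : Z → T` is the equalizer of `a` and `b`. -/
  equalizer_mem : ∀ {H : Subgroup G} {Z T T' : Type u} [MulAction H Z] [Finite Z] [MulAction H T]
    [Finite T] [MulAction H T'] [Finite T'] (a b : T →[H] T') (i : Z →[H] T),
    Function.Injective i → (∀ t, a t = b t ↔ t ∈ Set.range i) → mem H T → mem H T' → mem H Z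
  /-- Self-induction; the hypotheses on `i : T → Z` say that `(h, t) ↦ h • i t` induces an
  isomorphism from the induced `H`-set `H ×_K T` to `Z`. -/
  induction_mem : ∀ {H K : Subgroup G} (hK : K ≤ H) {T Z : Type u} [MulAction K T] [Finite T]
    [MulAction H Z] [Finite Z] (i : T → Z), Function.Injective i →
    (∀ (k : K) (t : T), i (k • t) = Subgroup.inclusion hK k • i t) →
    (∀ z, ∃ (h : H) (t : T), h • i t = z) →
    (∀ (h : H) (t t' : T), h • i t = i t' → (h : G) ∈ K) →
    mem H (H ⧸ K.subgroupOf H) → mem K T → mem H Z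

namespace IndexingSystem

open FinGSet MulAction

variable {G : Type u} [Group G] [Finite G] (O : IndexingSystem G)

/-- The maps `f : X → Y` of finite `G`-sets along which there are norms: the orbit
`G_{f x} / G_x` is admissible for all `x`. -/
def Adm {X Y : FinGSet G} (f : X →[G] Y) : Prop :=
  ∀ x : X, O.mem (stabilizer G (f x)) (stabilizer G (f x) ⧸ (stabilizer G x).subgroupOf
    (stabilizer G (f x)))

variable {O}

theorem stab_le {X Y : FinGSet G} (f : X →[G] Y) (x : X) : stabilizer G x ≤ stabilizer G (f x) := by
  intro g hg
  rw [mem_stabilizer_iff] at hg ⊢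
  rw [← map_smul, hg]

theorem adm_of_injective {X Y : FinGSet G} {f : X →[G] Y} (hf : Function.Injective f) :
    O.Adm f := by
  intro x
  have hs : (stabilizer G x).subgroupOf (stabilizer G (f x)) = ⊤ := by
    rw [Subgroup.subgroupOf_eq_top]
    intro g hg
    rw [mem_stabilizer_iff] at hg ⊢
    exact hf (by rw [map_smul, hg])
  have : Subsingleton (stabilizer G (f x) ⧸ (stabilizer G x).subgroupOf (stabilizer G (f x))) := by
    rw [hs]; exact QuotientGroup.subsingleton_quotient_top
  exact O.trivial_mem fun h t => Subsingleton.elim _ _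

theorem adm_comp {X Y Z : FinGSet G} {f : X →[G] Y} {g : Y →[G] Z} (hf : O.Adm f)
    (hg : O.Adm g) : O.Adm (g.comp f) := by
  intro x
  have hle := stab_le g (f x)
  refine O.induction_mem (K := stabilizer G (f x)) (H := stabilizer G (g (f x))) hle
    (T := stabilizer G (f x) ⧸ (stabilizer G x).subgroupOf (stabilizer G (f x)))
    (Subgroup.quotientSubgroupOfEmbeddingOfLE (stabilizer G x) hle)
    (Subgroup.quotientSubgroupOfEmbeddingOfLE (stabilizer G x) hle).injective ?_ ?_ ?_
    (hg (f x)) (hf x)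
  · rintro k ⟨t⟩
    rfl
  · rintro ⟨z⟩
    refine ⟨z, QuotientGroup.mk 1, ?_⟩
    change (QuotientGroup.mk (z * 1) : _ ⧸ (stabilizer G x).subgroupOf (stabilizer G (g (f x)))) =
      QuotientGroup.mk z
    rw [mul_one]
  · rintro h ⟨t⟩ ⟨t'⟩ e
    have e' : ((h * Subgroup.inclusion hle t : stabilizer G (g (f x))) :
      _ ⧸ (stabilizer G x).subgroupOf (stabilizer G (g (f x)))) =
        (Subgroup.inclusion hle t' : stabilizer G (g (f x))) := e
    rw [QuotientGroup.eq, Subgroup.mem_subgroupOf] at e'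
    have h1 := stab_le f x e'
    simp only [Subgroup.coe_mul, Subgroup.coe_inv, Subgroup.coe_inclusion] at h1
    have h2 := (stabilizer G (f x)).mul_mem t.2
      ((stabilizer G (f x)).mul_mem h1 ((stabilizer G (f x)).inv_mem t'.2))
    have h3 : (t : G) * (((h : G) * t)⁻¹ * t' * (t' : G)⁻¹) = (h : G)⁻¹ := by group
    rw [h3] at h2
    simpa using (stabilizer G (f x)).inv_mem h2

theorem adm_pb {P X Y Z : FinGSet G} {p : P →[G] X} {q : P →[G] Y} {f : X →[G] Z} {g : Y →[G] Z}
    (h : IsPb p q f g) (hf : O.Adm f) : O.Adm q := by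
  intro z
  have hz : stabilizer G (q z) ≤ stabilizer G (f (p z)) := by
    rw [h.1 z]; exact stab_le g (q z)
  have hst : ∀ m ∈ stabilizer G (q z), m ∈ stabilizer G (p z) → m ∈ stabilizer G z := by
    intro m hm hm'
    rw [mem_stabilizer_iff] at *
    refine (h.2 (p z) (q z) (h.1 z)).unique ⟨?_, ?_⟩ ⟨rfl, rfl⟩
    · rw [map_smul, hm']
    · rw [map_smul, hm]
  let act : MulAction (stabilizer G (q z)) (stabilizer G (f (p z)) ⧸
      (stabilizer G (p z)).subgroupOf (stabilizer G (f (p z)))) :=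
    MulAction.compHom _ (Subgroup.inclusion hz)
  have h1 : O.mem (stabilizer G (q z)) (stabilizer G (f (p z)) ⧸
      (stabilizer G (p z)).subgroupOf (stabilizer G (f (p z)))) := by
    refine O.map_mem 1 (fun k hk => by simpa using hz hk) (Equiv.refl _) ?_ (hf (p z))
    rintro k t
    have : (⟨1⁻¹ * k * 1, by simpa using hz k.2⟩ : stabilizer G (f (p z))) =
      Subgroup.inclusion hz k := by ext; simp
    rw [this]
    rfl
  let i : (stabilizer G (q z) ⧸ (stabilizer G z).subgroupOf (stabilizer G (q z))) →[stabilizer G (q z)]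
      (stabilizer G (f (p z)) ⧸ (stabilizer G (p z)).subgroupOf (stabilizer G (f (p z)))) :=
    { toFun := Quotient.map' (Subgroup.inclusion hz) (by
        intro a b hab
        rw [QuotientGroup.leftRel_apply, Subgroup.mem_subgroupOf] at hab ⊢
        exact stab_le p z hab)
      map_smul' := by rintro m ⟨t⟩; rfl }
  have hi : Function.Injective i := by
    rintro ⟨a⟩ ⟨b⟩ hab
    have hab' : ((Subgroup.inclusion hz a : stabilizer G (f (p z))) :
      _ ⧸ (stabilizer G (p z)).subgroupOf (stabilizer G (f (p z)))) =
        (Subgroup.inclusion hz b : stabilizer G (f (p z))) := hab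
    rw [QuotientGroup.eq, Subgroup.mem_subgroupOf] at hab'
    refine QuotientGroup.eq.2 ?_
    rw [Subgroup.mem_subgroupOf]
    exact hst _ (a⁻¹ * b).2 hab'
  let tr : MulAction (stabilizer G (q z)) (ULift.{u} Prop) :=
    { smul := fun _ x => x, one_smul := fun _ => rfl, mul_smul := fun _ _ _ => rfl }
  let a : (stabilizer G (f (p z)) ⧸ (stabilizer G (p z)).subgroupOf (stabilizer G (f (p z))))
      →[stabilizer G (q z)] ULift.{u} Prop :=
    { toFun := fun t => ⟨t ∈ Set.range i⟩
      map_smul' := by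
        intro m t
        refine congrArg ULift.up (propext ⟨?_, ?_⟩)
        · rintro ⟨s, hs⟩
          exact ⟨m⁻¹ • s, by rw [map_smul, hs, inv_smul_smul]⟩
        · rintro ⟨s, rfl⟩
          exact ⟨m • s, map_smul i m s⟩ }
  let b : (stabilizer G (f (p z)) ⧸ (stabilizer G (p z)).subgroupOf (stabilizer G (f (p z))))
      →[stabilizer G (q z)] ULift.{u} Prop :=
    { toFun := fun t => ⟨True⟩
      map_smul' := fun _ _ => rfl }
  refine O.equalizer_mem a b i hi ?_ h1 (O.trivial_mem fun _ _ => rfl)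
  intro t
  change ULift.up (t ∈ Set.range i) = ULift.up True ↔ _
  rw [ULift.up_inj, eq_iff_iff, iff_true]

theorem isPb_pb {X Y Z : FinGSet G} (f : X →[G] Z) (g : Y →[G] Z) :
    IsPb (pbFst f g) (pbSnd f g) f g :=
  ⟨fun z => z.2, fun x y h => ⟨⟨(x, y), h⟩, ⟨rfl, rfl⟩, fun _ hz =>
    Subtype.ext (Prod.ext hz.1 hz.2)⟩⟩

theorem adm_offSnd {X Y : FinGSet G} {f : X →[G] Y} (hf : O.Adm f) : O.Adm (offSnd f) := by
  have h1 : O.Adm (pbSnd f f) := adm_pb (isPb_pb f f) hf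
  let i : offDiag f →[G] pb f f := ⟨fun z => z.1, fun _ _ => rfl⟩
  have h2 : O.Adm i := adm_of_injective Subtype.val_injective
  exact adm_comp h2 h1

end IndexingSystem

/-! ### Mackey functors and incomplete Tambara functors -/

open FinGSet

/-- A Mackey functor for the finite group `G`. -/
structure MackeyFunctor (G : Type u) [Group G] where
  obj : FinGSet G → Type v
  [addCommGroup : ∀ X, AddCommGroup (obj X)]
  res : ∀ {X Y : FinGSet G}, (X →[G] Y) → obj Y →+ obj X
  tr : ∀ {X Y : FinGSet G}, (X →[G] Y) → obj X →+ obj Y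
  res_id : ∀ {X : FinGSet G} (a : obj X), res (MulActionHom.id G) a = a
  res_comp : ∀ {X Y Z : FinGSet G} (g : Y →[G] Z) (f : X →[G] Y) (a : obj Z),
    res (g.comp f) a = res f (res g a)
  tr_id : ∀ {X : FinGSet G} (a : obj X), tr (MulActionHom.id G) a = a
  tr_comp : ∀ {X Y Z : FinGSet G} (g : Y →[G] Z) (f : X →[G] Y) (a : obj X),
    tr (g.comp f) a = tr g (tr f a)
  /-- The double coset formula. -/
  res_tr : ∀ {P X Y Z : FinGSet G} {p : P →[G] X} {q : P →[G] Y} {f : X →[G] Z} {g : Y →[G] Z},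
    IsPb p q f g → ∀ a, res g (tr f a) = tr q (res p a)
  /-- Disjoint unions go to products. -/
  obj_sum : ∀ X Y : FinGSet G,
    Function.Bijective fun a : obj (X.sum Y) => (res (inl X Y) a, res (inr X Y) a)
  obj_empty : Subsingleton (obj (empty G))

attribute [instance] MackeyFunctor.addCommGroup

/-- An `O`-Tambara functor: a commutative Green functor with norms along the admissible maps,
satisfying the double coset formula and Tambara reciprocity. -/
structure OTambara {G : Type u} [Group G] [Finite G] (O : IndexingSystem G) where
  obj : FinGSet G → Type v
  [commRing : ∀ X, CommRing (obj X)]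
  res : ∀ {X Y : FinGSet G}, (X →[G] Y) → obj Y →+* obj X
  tr : ∀ {X Y : FinGSet G}, (X →[G] Y) → obj X →+ obj Y
  nm : ∀ {X Y : FinGSet G} (f : X →[G] Y), O.Adm f → obj X →* obj Y
  res_id : ∀ {X : FinGSet G} (a : obj X), res (MulActionHom.id G) a = a
  res_comp : ∀ {X Y Z : FinGSet G} (g : Y →[G] Z) (f : X →[G] Y) (a : obj Z),
    res (g.comp f) a = res f (res g a)
  tr_id : ∀ {X : FinGSet G} (a : obj X), tr (MulActionHom.id G) a = a
  tr_comp : ∀ {X Y Z : FinGSet G} (g : Y →[G] Z) (f : X →[G] Y) (a : obj X),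
    tr (g.comp f) a = tr g (tr f a)
  nm_id : ∀ {X : FinGSet G} (h : O.Adm (MulActionHom.id G : X →[G] X)) (a : obj X),
    nm (MulActionHom.id G) h a = a
  nm_comp : ∀ {X Y Z : FinGSet G} (g : Y →[G] Z) (f : X →[G] Y) (hg : O.Adm g) (hf : O.Adm f)
    (h : O.Adm (g.comp f)) (a : obj X), nm (g.comp f) h a = nm g hg (nm f hf a)
  /-- The double coset formula for transfers. -/
  res_tr : ∀ {P X Y Z : FinGSet G} {p : P →[G] X} {q : P →[G] Y} {f : X →[G] Z} {g : Y →[G] Z},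
    IsPb p q f g → ∀ a, res g (tr f a) = tr q (res p a)
  /-- The double coset formula for norms. -/
  res_nm : ∀ {P X Y Z : FinGSet G} {p : P →[G] X} {q : P →[G] Y} {f : X →[G] Z} {g : Y →[G] Z},
    IsPb p q f g → ∀ (hf : O.Adm f) (hq : O.Adm q) (a), res g (nm f hf a) = nm q hq (res p a)
  /-- Tambara reciprocity. -/
  nm_tr : ∀ {A X Y D E : FinGSet G} {h : A →[G] X} {g : X →[G] Y} {f' : E →[G] A}
    {g' : E →[G] D} {h' : D →[G] Y}, IsExp h g f' g' h' → ∀ (hg : O.Adm g) (hg' : O.Adm g') (a),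
    nm g hg (tr h a) = tr h' (nm g' hg' (res f' a))
  /-- Frobenius reciprocity. -/
  mul_tr : ∀ {X Y : FinGSet G} (f : X →[G] Y) (a : obj Y) (b : obj X),
    a * tr f b = tr f (res f a * b)
  /-- Disjoint unions go to products. -/
  obj_sum : ∀ X Y : FinGSet G,
    Function.Bijective fun a : obj (X.sum Y) => (res (inl X Y) a, res (inr X Y) a)
  obj_empty : Subsingleton (obj (empty G))

attribute [instance] OTambara.commRing

/-- A map of `O`-Tambara functors; a map `A → B` makes `B` an `A`-algebra. -/
structure OTambaraHom {G : Type u} [Group G] [Finite G] {O : IndexingSystem G}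
    (A : OTambara.{u, v} O) (B : OTambara.{u, w} O) where
  app : ∀ X : FinGSet G, A.obj X →+* B.obj X
  app_res : ∀ {X Y : FinGSet G} (f : X →[G] Y) (a : A.obj Y),
    app X (A.res f a) = B.res f (app Y a)
  app_tr : ∀ {X Y : FinGSet G} (f : X →[G] Y) (a : A.obj X),
    app Y (A.tr f a) = B.tr f (app X a)
  app_nm : ∀ {X Y : FinGSet G} (f : X →[G] Y) (hf : O.Adm f) (a : A.obj X),
    app Y (A.nm f hf a) = B.nm f hf (app X a)

namespace OTambara

open IndexingSystem

variable {G : Type u} [Group G] [Finite G] {O : IndexingSystem G}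

/-- The underlying Mackey functor. -/
def toMackey (S : OTambara.{u, v} O) : MackeyFunctor.{u, v} G where
  obj := S.obj
  res f := (S.res f).toAddMonoidHom
  tr f := S.tr f
  res_id := S.res_id
  res_comp := S.res_comp
  tr_id := S.tr_id
  tr_comp := S.tr_comp
  res_tr := S.res_tr
  obj_sum := S.obj_sum
  obj_empty := S.obj_empty

variable (S : OTambara.{u, v} O)

theorem tr_mul {X Y : FinGSet G} (f : X →[G] Y) (a : S.obj Y) (b : S.obj X) :
    S.tr f b * a = S.tr f (b * S.res f a) := by
  rw [mul_comm, S.mul_tr, mul_comm]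

theorem tr_res {X Y : FinGSet G} (e : X →[G] Y) (he : Function.Bijective e) (a : S.obj Y) :
    S.tr e (S.res e a) = a := by
  have h : IsPb e e (MulActionHom.id G) (MulActionHom.id G) :=
    ⟨fun _ => rfl, fun x y hxy => by
      obtain ⟨z, hz⟩ := he.2 x
      refine ⟨z, ⟨hz, hz.trans hxy⟩, fun z' hz' => he.1 (hz'.1.trans hz.symm)⟩⟩
  have := S.res_tr h a
  rw [S.res_id, S.tr_id] at this
  exact this.symm

theorem sum_ext {X Y : FinGSet G} {a b : S.obj (X.sum Y)}
    (h1 : S.res (inl X Y) a = S.res (inl X Y) b) (h2 : S.res (inr X Y) a = S.res (inr X Y) b) :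
    a = b := (S.obj_sum X Y).1 (Prod.ext h1 h2)

/-- The element of `S (X ⊔ Y)` with given components. -/
noncomputable def pair {X Y : FinGSet G} (a : S.obj X) (b : S.obj Y) : S.obj (X.sum Y) :=
  ((S.obj_sum X Y).2 (a, b)).choose

@[simp] theorem res_inl_pair {X Y : FinGSet G} (a : S.obj X) (b : S.obj Y) :
    S.res (inl X Y) (S.pair a b) = a :=
  congrArg Prod.fst ((S.obj_sum X Y).2 (a, b)).choose_spec

@[simp] theorem res_inr_pair {X Y : FinGSet G} (a : S.obj X) (b : S.obj Y) :
    S.res (inr X Y) (S.pair a b) = b :=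
  congrArg Prod.snd ((S.obj_sum X Y).2 (a, b)).choose_spec

theorem isPb_inl_inl (X Y : FinGSet G) :
    IsPb (MulActionHom.id G) (MulActionHom.id G) (inl X Y) (inl X Y) :=
  ⟨fun _ => rfl, fun x _ h => ⟨x, ⟨rfl, Sum.inl_injective h⟩, fun _ h => h.1⟩⟩

theorem isPb_inr_inr (X Y : FinGSet G) :
    IsPb (MulActionHom.id G) (MulActionHom.id G) (inr X Y) (inr X Y) :=
  ⟨fun _ => rfl, fun x _ h => ⟨x, ⟨rfl, Sum.inr_injective h⟩, fun _ h => h.1⟩⟩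

theorem isPb_inl_inr (X Y : FinGSet G) : IsPb (ofEmpty X) (ofEmpty Y) (inl X Y) (inr X Y) :=
  ⟨fun z => isEmptyElim z, fun _ _ h => (Sum.inl_ne_inr h).elim⟩

theorem isPb_inr_inl (X Y : FinGSet G) : IsPb (ofEmpty Y) (ofEmpty X) (inr X Y) (inl X Y) :=
  ⟨fun z => isEmptyElim z, fun _ _ h => (Sum.inr_ne_inl h).elim⟩

theorem tr_ofEmpty (X : FinGSet G) (a : S.obj (empty G)) : S.tr (ofEmpty X) a = 0 := by
  have := S.obj_empty
  rw [Subsingleton.elim a 0, map_zero]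

theorem tr_pair {X Y Z : FinGSet G} (f : X.sum Y →[G] Z) (a : S.obj X) (b : S.obj Y) :
    S.tr f (S.pair a b) = S.tr (f.comp (inl X Y)) a + S.tr (f.comp (inr X Y)) b := by
  have : S.pair a b = S.tr (inl X Y) a + S.tr (inr X Y) b := by
    apply S.sum_ext
    · rw [res_inl_pair, map_add, S.res_tr (isPb_inl_inl X Y), S.res_tr (isPb_inr_inl X Y),
        tr_ofEmpty, S.tr_id, S.res_id, add_zero]
    · rw [res_inr_pair, map_add, S.res_tr (isPb_inr_inr X Y), S.res_tr (isPb_inl_inr X Y),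
        tr_ofEmpty, S.tr_id, S.res_id, zero_add]
  rw [this, map_add, S.tr_comp, S.tr_comp]

/-- Norms are compatible with isomorphisms of maps. -/
theorem nm_res_of_iso {X Y X' Y' : FinGSet G} {f : X →[G] Y} {f' : X' →[G] Y'} (hf : O.Adm f)
    (hf' : O.Adm f') (a : X' →[G] X) (b : Y' →[G] Y) (ha : Function.Bijective a)
    (hb : Function.Bijective b) (h : ∀ x, f (a x) = b (f' x)) (s : S.obj X) :
    S.nm f' hf' (S.res a s) = S.res b (S.nm f hf s) := by
  symm
  refine S.res_nm ⟨h, fun x y hxy => ?_⟩ hf hf' s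
  obtain ⟨z, rfl⟩ := ha.2 x
  exact ⟨z, ⟨rfl, hb.1 ((h z).symm.trans hxy)⟩, fun z' hz' => ha.1 hz'.1⟩

end OTambara

/-! ### Exponential diagrams -/

namespace FinGSet

variable {G : Type u} [Group G]

open scoped Pointwise in
/-- The set `∏_g A` of sections of `h` over fibres of `g`; a section is recorded by its image. -/
def piObj {A X Y : FinGSet G} (h : A →[G] X) (g : X →[G] Y) : FinGSet G :=
  sub (prod Y ⟨Set A⟩)
    (fun z : Y × Set A => (∀ a ∈ z.2, g (h a) = z.1) ∧ ∀ x, g x = z.1 → ∃! a, a ∈ z.2 ∧ h a = x)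
    fun m z hz => by
      constructor
      · intro a (ha : a ∈ m • z.2)
        rw [Set.mem_smul_set_iff_inv_smul_mem] at ha
        have := hz.1 _ ha
        rw [map_smul, map_smul, inv_smul_eq_iff] at this
        exact this
      · intro x (hx : g x = m • z.1)
        obtain ⟨a, ⟨ha, hax⟩, hu⟩ := hz.2 (m⁻¹ • x) (by rw [map_smul, hx, inv_smul_smul])
        refine ⟨m • a, ⟨Set.smul_mem_smul_set ha, ?_⟩, ?_⟩
        · rw [map_smul, hax, smul_inv_smul]
        · rintro b ⟨hb, rfl⟩
          change b ∈ m • z.2 at hb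
          rw [Set.mem_smul_set_iff_inv_smul_mem] at hb
          rw [← hu (m⁻¹ • b) ⟨hb, by rw [map_smul]⟩, smul_inv_smul]

open scoped Pointwise in
/-- The fibre product `X ×_Y ∏_g A`, recorded as pairs of a section and a point of its image. -/
def piEv {A X Y : FinGSet G} (h : A →[G] X) (g : X →[G] Y) : FinGSet G :=
  sub (prod A (piObj h g)) (fun z => z.1 ∈ z.2.1.2)
    fun m z (hz : z.1 ∈ z.2.1.2) => (Set.smul_mem_smul_set hz : m • z.1 ∈ m • z.2.1.2)

/-- The projection `∏_g A → Y`. -/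
def piProj {A X Y : FinGSet G} (h : A →[G] X) (g : X →[G] Y) : piObj h g →[G] Y :=
  ⟨fun z => z.1.1, fun _ _ => rfl⟩

/-- The evaluation `X ×_Y ∏_g A → A`. -/
def piEvFst {A X Y : FinGSet G} (h : A →[G] X) (g : X →[G] Y) : piEv h g →[G] A :=
  ⟨fun z => z.1.1, fun _ _ => rfl⟩

/-- The projection `X ×_Y ∏_g A → ∏_g A`. -/
def piEvSnd {A X Y : FinGSet G} (h : A →[G] X) (g : X →[G] Y) : piEv h g →[G] piObj h g :=
  ⟨fun z => z.1.2, fun _ _ => rfl⟩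

theorem IsPb.ext {P X Y Z : FinGSet G} {p : P →[G] X} {q : P →[G] Y} {f : X →[G] Z}
    {g : Y →[G] Z} (h : IsPb p q f g) {z z' : P} (h1 : p z = p z') (h2 : q z = q z') : z = z' :=
  (h.2 (p z') (q z') (h.1 z')).unique ⟨h1, h2⟩ ⟨rfl, rfl⟩

theorem IsPb.mk' {P X Y Z : FinGSet G} {p : P →[G] X} {q : P →[G] Y} {f : X →[G] Z}
    {g : Y →[G] Z} (h0 : ∀ z, f (p z) = g (q z))
    (h1 : ∀ x y, f x = g y → ∃ z, p z = x ∧ q z = y)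
    (h2 : ∀ z z', p z = p z' → q z = q z' → z = z') : IsPb p q f g :=
  ⟨h0, fun x y h => by
    obtain ⟨z, rfl, rfl⟩ := h1 x y h
    exact ⟨z, ⟨rfl, rfl⟩, fun z' hz' => h2 _ _ hz'.1 hz'.2⟩⟩

section

variable {A X Y D E : FinGSet G} {h : A →[G] X} {g : X →[G] Y} {f' : E →[G] A}
  {g' : E →[G] D} {h' : D →[G] Y}

theorem IsExp.comm (H : IsExp h g f' g' h') (e : E) : g (h (f' e)) = h' (g' e) := H.isPb.1 e

theorem IsExp.fib (H : IsExp h g f' g' h') (x : X) (d : D) (hd : g x = h' d) :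
    ∃ e, h (f' e) = x ∧ g' e = d := (H.isPb.2 x d hd).exists

theorem IsExp.ext_e (H : IsExp h g f' g' h') {e e' : E} (h1 : h (f' e) = h (f' e'))
    (h2 : g' e = g' e') : e = e' := H.isPb.ext h1 h2

theorem IsExp.ext (H : IsExp h g f' g' h') {d d' : D} (hd : h' d = h' d')
    (hs : ∀ e e', g' e = d → g' e' = d' → h (f' e) = h (f' e') → f' e = f' e') : d = d' := by
  have hf : ∀ x : {x // g x = h' d'}, ∃ e, h (f' e) = x.1 ∧ g' e = d' := fun x =>
    H.fib x.1 d' x.2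
  choose e he1 he2 using hf
  refine (H.sections (h' d') (fun x => f' (e x)) he1).unique ⟨hd, ?_⟩ ⟨rfl, ?_⟩
  · intro e' he' x hx
    exact hs _ _ he' (he2 x) (hx.trans (he1 x).symm)
  · intro e' he' x hx
    rw [H.ext_e (hx.trans (he1 x).symm) (he'.trans (he2 x).symm)]

theorem IsExp.exists_sec (H : IsExp h g f' g' h') (y : Y) (s : {x // g x = y} → A)
    (hs : ∀ x, h (s x) = x) :
    ∃ d, h' d = y ∧ ∀ e, g' e = d → ∀ x, h (f' e) = x.1 → f' e = s x :=
  (H.sections y s hs).exists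

theorem IsExp.mk' (hc : ∀ e, g (h (f' e)) = h' (g' e))
    (hfib : ∀ x d, g x = h' d → ∃ e, h (f' e) = x ∧ g' e = d)
    (hext : ∀ e e', h (f' e) = h (f' e') → g' e = g' e' → e = e')
    (hsec : ∀ (y : Y) (s : {x // g x = y} → A), (∀ x, h (s x) = x) →
      ∃ d, h' d = y ∧ ∀ e, g' e = d → ∀ x, h (f' e) = x.1 → f' e = s x)
    (hd : ∀ d d', h' d = h' d' →
      (∀ e e', g' e = d → g' e' = d' → h (f' e) = h (f' e') → f' e = f' e') → d = d') :
    IsExp h g f' g' h' where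
  isPb := IsPb.mk' hc hfib hext
  sections y s hs := by
    obtain ⟨d, hd1, hd2⟩ := hsec y s hs
    refine ⟨d, ⟨hd1, hd2⟩, fun d' hd' => hd _ _ (hd'.1.trans hd1.symm) ?_⟩
    intro e e' he he' hee
    have hx : g (h (f' e')) = y := by rw [hc, he', hd1]
    rw [hd'.2 e he ⟨_, hx⟩ hee]
    exact (hd2 e' he' ⟨_, hx⟩ rfl).symm

/-- The explicit exponential diagram. -/
theorem isExp_pi (h : A →[G] X) (g : X →[G] Y) :
    IsExp h g (piEvFst h g) (piEvSnd h g) (piProj h g) := by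
  refine IsExp.mk' ?_ ?_ ?_ ?_ ?_
  · intro e
    exact e.1.2.2.1 _ e.2
  · intro x d hd
    obtain ⟨a, ⟨ha, rfl⟩, _⟩ := d.2.2 x hd
    exact ⟨⟨(a, d), ha⟩, rfl, rfl⟩
  · rintro ⟨⟨a, d⟩, ha⟩ ⟨⟨a', d'⟩, ha'⟩ h1 (h2 : d = d')
    subst h2
    have : a = a' := (d.2.2 (h a') (d.2.1 _ ha')).unique ⟨ha, h1⟩ ⟨ha', rfl⟩
    subst this
    rfl
  · intro y s hs
    refine ⟨⟨(y, Set.range s), ?_, ?_⟩, rfl, ?_⟩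
    · rintro _ ⟨x, rfl⟩
      change g (h (s x)) = y
      rw [hs]; exact x.2
    · intro x hx
      refine ⟨s ⟨x, hx⟩, ⟨⟨_, rfl⟩, hs _⟩, ?_⟩
      rintro _ ⟨⟨x', rfl⟩, hx'⟩
      rw [hs] at hx'
      congr 1
      exact Subtype.ext hx'
    · rintro ⟨⟨a, d⟩, ha⟩ (rfl : d = _) x (hx : h a = x.1)
      obtain ⟨x', hx'⟩ := ha
      replace hx' : s x' = a := hx'
      change a = s x
      rw [← hx', hs] at hx
      rw [← hx', Subtype.ext hx]
  · rintro ⟨⟨y, S⟩, h1, h2⟩ ⟨⟨y', S'⟩, h1', h2'⟩ (hy : y = y') hS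
    subst hy
    have key : S = S' := by
      ext a
      constructor
      · intro ha
        obtain ⟨a', ⟨ha', haa⟩, _⟩ := h2' (h a) (h1 a ha)
        have := hS ⟨(a, ⟨⟨y, S⟩, h1, h2⟩), ha⟩ ⟨(a', ⟨⟨y, S'⟩, h1', h2'⟩), ha'⟩ rfl rfl haa.symm
        change a = a' at this
        exact this ▸ ha'
      · intro ha
        obtain ⟨a', ⟨ha', haa⟩, _⟩ := h2 (h a) (h1' a ha)
        have := hS ⟨(a', ⟨⟨y, S⟩, h1, h2⟩), ha'⟩ ⟨(a, ⟨⟨y, S'⟩, h1', h2'⟩), ha⟩ rfl rfl haa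
        change a' = a at this
        exact this ▸ ha'
    subst key
    rfl

/-- An exponential diagram is isomorphic to the explicit one. -/
theorem IsExp.exists_iso (H : IsExp h g f' g' h') :
    ∃ (φ : D →[G] piObj h g) (ψ : E →[G] piEv h g), Function.Bijective φ ∧ Function.Bijective ψ ∧
      (∀ e, piEvFst h g (ψ e) = f' e) ∧ (∀ e, piEvSnd h g (ψ e) = φ (g' e)) ∧
      ∀ d, piProj h g (φ d) = h' d := by
  let φ : D →[G] piObj h g :=
    { toFun := fun d => ⟨(h' d, f' '' (g' ⁻¹' {d})), by
        constructor
        · rintro _ ⟨e, he, rfl⟩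
          exact (H.comm e).trans (congrArg h' he)
        · intro x hx
          obtain ⟨e, he, hed⟩ := H.fib x d hx
          refine ⟨f' e, ⟨⟨e, hed, rfl⟩, he⟩, ?_⟩
          rintro _ ⟨⟨e', he', rfl⟩, hx'⟩
          rw [H.ext_e (hx'.trans he.symm) (he'.trans hed.symm)]⟩
      map_smul' := fun m d => Subtype.ext (Prod.ext (map_smul h' m d) (by
        ext a
        change _ ↔ a ∈ (fun b => m • b) '' _
        constructor
        · rintro ⟨e, he, rfl⟩
          refine ⟨f' (m⁻¹ • e), ⟨m⁻¹ • e, ?_, rfl⟩, ?_⟩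
          · change g' e = m • d at he
            change g' (m⁻¹ • e) = d
            rw [map_smul, he, inv_smul_smul]
          · change m • f' (m⁻¹ • e) = _
            rw [map_smul, smul_inv_smul]
        · rintro ⟨_, ⟨e, he, rfl⟩, rfl⟩
          refine ⟨m • e, ?_, map_smul f' m e⟩
          change g' (m • e) = m • d
          rw [map_smul, show g' e = d from he])) }
  let ψ : E →[G] piEv h g :=
    { toFun := fun e => ⟨(f' e, φ (g' e)), ⟨e, rfl, rfl⟩⟩
      map_smul' := fun m e => Subtype.ext (Prod.ext (map_smul f' m e)
        ((congrArg φ (map_smul g' m e)).trans (map_smul φ m (g' e)))) }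
  have hφ : Function.Bijective φ := by
    constructor
    · intro d d' hdd
      have h1 : h' d = h' d' := congrArg (piProj h g) hdd
      have h2 : f' '' (g' ⁻¹' {d}) = f' '' (g' ⁻¹' {d'}) :=
        congrArg (fun z : piObj h g => z.1.2) hdd
      refine H.ext h1 fun e e' he he' hee => ?_
      have : f' e ∈ f' '' (g' ⁻¹' {d'}) := h2 ▸ ⟨e, he, rfl⟩
      obtain ⟨e'', he'', h3⟩ := this
      rw [← h3]
      rw [H.ext_e ((congrArg h h3).trans hee) (he''.trans he'.symm)]
    · intro z
      have hz := z.2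
      have : ∀ x : {x // g x = z.1.1}, ∃ a, a ∈ z.1.2 ∧ h a = x.1 := fun x =>
        (z.2.2 x.1 x.2).exists
      choose s hs1 hs2 using this
      obtain ⟨d, hd, hd2⟩ := H.exists_sec z.1.1 s hs2
      refine ⟨d, Subtype.ext (Prod.ext hd ?_)⟩
      change f' '' (g' ⁻¹' {d}) = z.1.2
      ext a
      constructor
      · rintro ⟨e, he, rfl⟩
        have hx : g (h (f' e)) = z.1.1 := (H.comm e).trans ((congrArg h' he).trans hd)
        rw [hd2 e he ⟨_, hx⟩ rfl]
        exact hs1 _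
      · intro ha
        have hx : g (h a) = z.1.1 := z.2.1 a ha
        obtain ⟨e, he, hed⟩ := H.fib (h a) d (hx.trans hd.symm)
        refine ⟨e, hed, ?_⟩
        rw [hd2 e hed ⟨_, hx⟩ he]
        exact (z.2.2 (h a) hx).unique ⟨hs1 _, hs2 _⟩ ⟨ha, rfl⟩
  refine ⟨φ, ψ, hφ, ⟨?_, ?_⟩, fun _ => rfl, fun _ => rfl, fun _ => rfl⟩
  · intro e e' hee
    have h1 : f' e = f' e' := congrArg (piEvFst h g) hee
    have h2 : φ (g' e) = φ (g' e') := congrArg (piEvSnd h g) hee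
    exact H.ext_e (congrArg h h1) (hφ.1 h2)
  · rintro ⟨⟨a, d⟩, ha⟩
    obtain ⟨d, rfl⟩ := hφ.2 d
    obtain ⟨e, he, hea⟩ := ha
    exact ⟨e, Subtype.ext (Prod.ext hea (congrArg φ he))⟩

/-- The exponential diagram of an identity norm. -/
theorem isExp_id (h : A →[G] X) :
    IsExp h (MulActionHom.id G) (MulActionHom.id G) (MulActionHom.id G) h := by
  refine IsExp.mk' (fun _ => rfl) (fun x d hd => ⟨d, hd.symm, rfl⟩) (fun _ _ _ h => h) ?_ ?_
  · intro y s hs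
    refine ⟨s ⟨y, rfl⟩, hs _, ?_⟩
    rintro e (rfl : e = _) x hx
    exact congrArg s (Subtype.ext (show y = x.1 from x.2.symm))
  · intro d d' hd hs
    exact hs d d' rfl rfl hd

/-- The exponential diagram of an identity transfer. -/
theorem isExp_tr_id (g : X →[G] Y) :
    IsExp (MulActionHom.id G) g (MulActionHom.id G) g (MulActionHom.id G) := by
  refine IsExp.mk' (fun _ => rfl) (fun x d hd => ⟨x, rfl, hd⟩) (fun _ _ h _ => h) ?_ ?_
  · intro y s hs
    refine ⟨y, rfl, fun e he x hx => ?_⟩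
    rw [show s x = x.1 from hs x]
    exact hx
  · intro d d' hd hs
    exact hd

/-- Pasting of exponential diagrams along a composite of transfers. -/
theorem IsExp.paste_tr (H : IsExp h g f' g' h') {A' E' D2 E2 : FinGSet G} {r : A' →[G] A}
    {a : E' →[G] A'} {b : E' →[G] E} (hp : IsPb a b r f') {f2 : E2 →[G] E'} {g2 : E2 →[G] D2}
    {h2 : D2 →[G] D} (H2 : IsExp b g' f2 g2 h2) :
    IsExp (h.comp r) g (a.comp f2) g2 (h'.comp h2) := by
  have hrab : ∀ e, r (a e) = f' (b e) := hp.1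
  refine IsExp.mk' ?_ ?_ ?_ ?_ ?_
  · intro e
    change g (h (r (a (f2 e)))) = h' (h2 (g2 e))
    rw [hrab, H.comm, H2.comm]
  · intro x d hd
    obtain ⟨e, rfl, he⟩ := H.fib x (h2 d) hd
    obtain ⟨e2, rfl, rfl⟩ := H2.fib e d he
    exact ⟨e2, congrArg h (hrab _), rfl⟩
  · intro e e' (h1 : h (r (a (f2 e))) = h (r (a (f2 e')))) h2'
    rw [hrab, hrab] at h1
    refine H2.ext_e (H.ext_e h1 ?_) h2'
    rw [H2.comm, H2.comm, h2']
  · intro y s (hs : ∀ x, h (r (s x)) = x)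
    obtain ⟨d, hd, hds⟩ := H.exists_sec y (fun x => r (s x)) hs
    have hfx : ∀ e : {e // g' e = d}, g (h (f' e.1)) = y := fun e => by
      rw [H.comm, e.2, hd]
    have : ∀ e : {e // g' e = d}, ∃ z, a z = s ⟨_, hfx e⟩ ∧ b z = e.1 := fun e =>
      (hp.2 _ _ (hds e.1 e.2 ⟨_, hfx e⟩ rfl).symm).exists
    choose t ht1 ht2 using this
    obtain ⟨d2, hd2, hds2⟩ := H2.exists_sec d t ht2
    refine ⟨d2, (congrArg h' hd2).trans hd, ?_⟩
    rintro e rfl x (hx : h (r (a (f2 e))) = x.1)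
    change a (f2 e) = s x
    have he : g' (b (f2 e)) = d := by rw [H2.comm, hd2]
    rw [hds2 e rfl ⟨_, he⟩ rfl, ht1]
    congr 1
    apply Subtype.ext
    change h (f' (b (f2 e))) = x.1
    rw [← hrab, hx]
  · intro d d' (hd : h' (h2 d) = h' (h2 d')) hs
    have hs' : ∀ e e', g2 e = d → g2 e' = d' → h (r (a (f2 e))) = h (r (a (f2 e'))) →
      a (f2 e) = a (f2 e') := hs
    have h1 : h2 d = h2 d' := by
      refine H.ext hd fun e e' he he' hee => ?_
      obtain ⟨z, rfl, rfl⟩ := H2.fib e d he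
      obtain ⟨z', rfl, rfl⟩ := H2.fib e' d' he'
      rw [← hrab, ← hrab] at hee ⊢
      rw [hs' z z' rfl rfl hee]
    refine H2.ext h1 fun e e' he he' hee => ?_
    refine hp.ext (hs' e e' he he' ?_) hee
    rw [hrab, hrab, hee]

/-- Pasting of exponential diagrams along a composite of norms. -/
theorem IsExp.paste_nm (H : IsExp h g f' g' h') {Z D2 E2 E3 : FinGSet G} {k : Y →[G] Z}
    {f2 : E2 →[G] D} {g2 : E2 →[G] D2} {h2 : D2 →[G] Z} (H2 : IsExp h' k f2 g2 h2)
    {c : E3 →[G] E} {t : E3 →[G] E2} (hp : IsPb c t g' f2) :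
    IsExp h (k.comp g) (f'.comp c) (g2.comp t) h2 := by
  have hct : ∀ e, g' (c e) = f2 (t e) := hp.1
  refine IsExp.mk' ?_ ?_ ?_ ?_ ?_
  · intro e
    change k (g (h (f' (c e)))) = h2 (g2 (t e))
    rw [H.comm, hct, H2.comm]
  · intro x d hd
    obtain ⟨e2, he2, rfl⟩ := H2.fib (g x) d hd
    obtain ⟨e, rfl, he⟩ := H.fib x (f2 e2) he2.symm
    obtain ⟨e3, rfl, rfl⟩ := (hp.2 _ _ he).exists
    exact ⟨e3, rfl, rfl⟩
  · intro e e' (h1 : h (f' (c e)) = h (f' (c e'))) (h2' : g2 (t e) = g2 (t e'))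
    have h3 : t e = t e' := by
      refine H2.ext_e ?_ h2'
      rw [← hct, ← hct, ← H.comm, ← H.comm, h1]
    exact hp.ext (H.ext_e h1 (by rw [hct, hct, h3])) h3
  · intro z s hs
    have : ∀ y : {y // k y = z}, ∃ d, h' d = y.1 ∧ ∀ e, g' e = d →
        ∀ (x : {x // g x = y.1}), h (f' e) = x.1 →
          f' e = s ⟨x.1, (congrArg k x.2).trans y.2⟩ := fun y =>
      H.exists_sec y.1 (fun x => s ⟨x.1, (congrArg k x.2).trans y.2⟩) fun x => hs _
    choose t2 ht1 ht2 using this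
    obtain ⟨d2, hd2, hds2⟩ := H2.exists_sec z t2 ht1
    refine ⟨d2, hd2, ?_⟩
    rintro e rfl x (hx : h (f' (c e)) = x.1)
    change f' (c e) = s x
    have hy : k (h' (f2 (t e))) = z := (H2.comm _).trans hd2
    have h4 := hds2 (t e) rfl ⟨_, hy⟩ rfl
    refine ht2 ⟨_, hy⟩ (c e) ((hct e).trans h4) ⟨x.1, ?_⟩ hx
    rw [← hx, H.comm, hct]
  · intro d d' hd hs
    have hs' : ∀ e e', g2 (t e) = d → g2 (t e') = d' → h (f' (c e)) = h (f' (c e')) →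
      f' (c e) = f' (c e') := hs
    refine H2.ext hd fun e e' he he' hee => H.ext hee fun a a' ha ha' haa => ?_
    obtain ⟨z, rfl, rfl⟩ := (hp.2 a e ha).exists
    obtain ⟨z', rfl, rfl⟩ := (hp.2 a' e' ha').exists
    exact hs' z z' he he' haa

/-- Base change of an exponential diagram. -/
theorem IsExp.base_change (H : IsExp h g f' g' h') {Y' X' A' D' E' : FinGSet G} {k : Y' →[G] Y}
    {kX : X' →[G] X} {g2 : X' →[G] Y'} (hX : IsPb kX g2 g k)
    {kA : A' →[G] A} {h2 : A' →[G] X'} (hA : IsPb kA h2 h kX)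
    {kD : D' →[G] D} {h2' : D' →[G] Y'} (hD : IsPb kD h2' h' k)
    {kE : E' →[G] E} {g2' : E' →[G] D'} (hE : IsPb kE g2' g' kD)
    {f2' : E' →[G] A'} (h3 : ∀ e, kA (f2' e) = f' (kE e))
    (h4 : ∀ e, g2 (h2 (f2' e)) = h2' (g2' e)) : IsExp h2 g2 f2' g2' h2' := by
  have hk : ∀ e, h (f' (kE e)) = kX (h2 (f2' e)) := fun e => by rw [← h3, hA.1]
  refine IsExp.mk' h4 ?_ ?_ ?_ ?_
  · intro x d hd
    obtain ⟨e, he, he'⟩ := H.fib (kX x) (kD d) (by rw [hX.1, hd, hD.1])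
    obtain ⟨e', rfl, rfl⟩ := (hE.2 _ _ he').exists
    refine ⟨e', hX.ext ?_ ?_, rfl⟩
    · rw [← hk, he]
    · rw [h4, hd]
  · intro e e' h1 h2'
    refine hE.ext (H.ext_e ?_ ?_) h2'
    · rw [hk, hk, h1]
    · rw [hE.1, hE.1, h2']
  · intro y s hs
    have hx : ∀ x : {x // g x = k y}, ∃ z, kX z = x.1 ∧ g2 z = y := fun x =>
      (hX.2 _ _ x.2).exists
    choose z hz1 hz2 using hx
    obtain ⟨d, hd, hds⟩ := H.exists_sec (k y) (fun x => kA (s ⟨z x, hz2 x⟩)) fun x => by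
      rw [hA.1, hs, hz1]
    obtain ⟨d', rfl, rfl⟩ := (hD.2 _ _ hd).exists
    refine ⟨d', rfl, ?_⟩
    rintro e rfl x hx
    refine hA.ext ?_ (hx.trans (hs x).symm)
    have hgx : g (kX x.1) = k (h2' (g2' e)) := by rw [hX.1, x.2]
    rw [h3, hds (kE e) (hE.1 e) ⟨kX x.1, hgx⟩ (by rw [hk, hx])]
    congr 2
    apply Subtype.ext
    exact hX.ext (hz1 _) ((hz2 _).trans x.2.symm)
  · intro d d' hd hs
    refine hD.ext (H.ext ?_ ?_) hd
    · rw [hD.1, hD.1, hd]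
    · intro e e' he he' hee
      obtain ⟨e, rfl, rfl⟩ := (hE.2 _ _ he).exists
      obtain ⟨e', rfl, rfl⟩ := (hE.2 _ _ he').exists
      rw [hk, hk] at hee
      rw [← h3, ← h3, hs e e' rfl rfl (hX.ext hee (by rw [h4, h4, hd]))]

end

/-- The exponential diagram of a fibre product. -/
theorem IsExp.mul {A₁ A₂ X Y D₁ E₁ D₂ E₂ A D E : FinGSet G} {g : X →[G] Y}
    {h₁ : A₁ →[G] X} {f₁ : E₁ →[G] A₁} {g₁ : E₁ →[G] D₁} {k₁ : D₁ →[G] Y}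
    {h₂ : A₂ →[G] X} {f₂ : E₂ →[G] A₂} {g₂ : E₂ →[G] D₂} {k₂ : D₂ →[G] Y}
    (H₁ : IsExp h₁ g f₁ g₁ k₁) (H₂ : IsExp h₂ g f₂ g₂ k₂)
    {a₁ : A →[G] A₁} {a₂ : A →[G] A₂} (hA : IsPb a₁ a₂ h₁ h₂)
    {d₁ : D →[G] D₁} {d₂ : D →[G] D₂} (hD : IsPb d₁ d₂ k₁ k₂)
    {e₁ : E →[G] E₁} {e₂ : E →[G] E₂} (hE : IsPb e₁ e₂ (h₁.comp f₁) (h₂.comp f₂))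
    {f : E →[G] A} {g' : E →[G] D} (hf₁ : ∀ e, a₁ (f e) = f₁ (e₁ e))
    (hf₂ : ∀ e, a₂ (f e) = f₂ (e₂ e)) (hg₁ : ∀ e, d₁ (g' e) = g₁ (e₁ e))
    (hg₂ : ∀ e, d₂ (g' e) = g₂ (e₂ e)) :
    IsExp (h₁.comp a₁) g f g' (k₁.comp d₁) ∧ IsPb e₁ g' g₁ d₁ ∧ IsPb e₂ g' g₂ d₂ := by
  have hE' : ∀ e, h₁ (f₁ (e₁ e)) = h₂ (f₂ (e₂ e)) := hE.1
  have fib : ∀ x d, g x = k₁ (d₁ d) → ∃ e, h₁ (f₁ (e₁ e)) = x ∧ g' e = d := by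
    intro x d hd
    obtain ⟨z₁, h1, h1'⟩ := H₁.fib x (d₁ d) hd
    obtain ⟨z₂, h2, h2'⟩ := H₂.fib x (d₂ d) (hd.trans (hD.1 d))
    obtain ⟨e, rfl, rfl⟩ := (hE.2 z₁ z₂ (h1.trans h2.symm)).exists
    exact ⟨e, h1, hD.ext ((hg₁ e).trans h1') ((hg₂ e).trans h2')⟩
  have ext : ∀ e e', h₁ (f₁ (e₁ e)) = h₁ (f₁ (e₁ e')) → g' e = g' e' → e = e' := by
    intro e e' h1 h2
    refine hE.ext (H₁.ext_e h1 ?_) (H₂.ext_e ?_ ?_)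
    · rw [← hg₁, ← hg₁, h2]
    · rw [← hE', ← hE', h1]
    · rw [← hg₂, ← hg₂, h2]
  refine ⟨IsExp.mk' ?_ ?_ ?_ ?_ ?_, IsPb.mk' (fun e => (hg₁ e).symm) ?_ ?_,
    IsPb.mk' (fun e => (hg₂ e).symm) ?_ ?_⟩
  · intro e
    change g (h₁ (a₁ (f e))) = k₁ (d₁ (g' e))
    rw [hf₁, hg₁, H₁.comm]
  · intro x d hd
    obtain ⟨e, he, he'⟩ := fib x d hd
    exact ⟨e, (congrArg h₁ (hf₁ e)).trans he, he'⟩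
  · intro e e' (h1 : h₁ (a₁ (f e)) = h₁ (a₁ (f e'))) h2
    rw [hf₁, hf₁] at h1
    exact ext e e' h1 h2
  · intro y s (hs : ∀ x, h₁ (a₁ (s x)) = x)
    obtain ⟨z₁, h1, h1'⟩ := H₁.exists_sec y (fun x => a₁ (s x)) hs
    obtain ⟨z₂, h2, h2'⟩ := H₂.exists_sec y (fun x => a₂ (s x)) fun x => by rw [← hA.1, hs]
    obtain ⟨d, rfl, rfl⟩ := (hD.2 z₁ z₂ (h1.trans h2.symm)).exists
    refine ⟨d, h1, ?_⟩
    rintro e rfl x (hx : h₁ (a₁ (f e)) = x.1)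
    rw [hf₁] at hx
    refine hA.ext ?_ ?_
    · rw [hf₁]; exact h1' (e₁ e) (hg₁ e).symm x hx
    · rw [hf₂]; exact h2' (e₂ e) (hg₂ e).symm x ((hE' e).symm.trans hx)
  · intro d d' hd hs
    have hs' : ∀ e e', g' e = d → g' e' = d' → h₁ (a₁ (f e)) = h₁ (a₁ (f e')) → f e = f e' := hs
    have hd' : k₁ (d₁ d) = k₁ (d₁ d') := hd
    refine hD.ext (H₁.ext hd' fun z z' hz hz' hzz => ?_)
      (H₂.ext (by rw [← hD.1, ← hD.1, hd']) fun z z' hz hz' hzz => ?_)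
    · have hx : g (h₁ (f₁ z)) = k₁ (d₁ d) := by rw [H₁.comm, hz]
      obtain ⟨e, he, he'⟩ := fib _ _ hx
      obtain ⟨e', he1, he1'⟩ := fib _ _ ((congrArg g hzz).symm.trans (hx.trans hd'))
      have q1 : e₁ e = z := H₁.ext_e he (by rw [← hg₁, he', hz])
      have q2 : e₁ e' = z' := H₁.ext_e he1 (by rw [← hg₁, he1', hz'])
      have := hs' e e' he' he1' (by rw [hf₁, hf₁, q1, q2, hzz])
      rw [← q1, ← q2, ← hf₁, ← hf₁, this]
    · have hx : g (h₂ (f₂ z)) = k₁ (d₁ d) := by rw [H₂.comm, hz, hD.1]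
      obtain ⟨e, he, he'⟩ := fib _ _ hx
      obtain ⟨e', he1, he1'⟩ := fib _ _ ((congrArg g hzz).symm.trans (hx.trans hd'))
      have q1 : e₂ e = z := H₂.ext_e ((hE' e).symm.trans he) (by rw [← hg₂, he', hz])
      have q2 : e₂ e' = z' := H₂.ext_e ((hE' e').symm.trans he1) (by rw [← hg₂, he1', hz'])
      have := hs' e e' he' he1' (by rw [hf₁, hf₁, he, he1, hzz])
      rw [← q1, ← q2, ← hf₂, ← hf₂, this]
  · intro z d hz
    obtain ⟨e, he, he'⟩ := fib (h₁ (f₁ z)) d (by rw [H₁.comm, hz])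
    exact ⟨e, H₁.ext_e he (by rw [← hg₁, he', hz]), he'⟩
  · intro e e' h1 h2
    exact ext e e' (by rw [h1]) h2
  · intro z d hz
    obtain ⟨e, he, he'⟩ := fib (h₂ (f₂ z)) d (by rw [H₂.comm, hz, hD.1])
    exact ⟨e, H₂.ext_e ((hE' e).symm.trans he) (by rw [← hg₂, he', hz]), he'⟩
  · intro e e' h1 h2
    exact ext e e' (by rw [hE', hE', h1]) h2

end FinGSet

/-! ### The fibred box product -/

namespace OTambara

open IndexingSystem

variable {G : Type u} [Group G] [Finite G] {O : IndexingSystem G}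

section

variable (S : OTambara.{u, v} O)

theorem res_res {X Y Z : FinGSet G} {f : X →[G] Y} {g : Y →[G] Z} {k : X →[G] Z}
    (h : ∀ x, g (f x) = k x) (a : S.obj Z) : S.res f (S.res g a) = S.res k a := by
  rw [← S.res_comp, show g.comp f = k from MulActionHom.ext h]

theorem res_sq {X Y Y' Z : FinGSet G} {f : X →[G] Y} {g : Y →[G] Z} {f' : X →[G] Y'}
    {g' : Y' →[G] Z} (h : ∀ x, g (f x) = g' (f' x)) (a : S.obj Z) :
    S.res f (S.res g a) = S.res f' (S.res g' a) := by
  rw [← S.res_comp, ← S.res_comp, show g.comp f = g'.comp f' from MulActionHom.ext h]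

theorem tr_tr {X Y Z : FinGSet G} {f : X →[G] Y} {g : Y →[G] Z} {k : X →[G] Z}
    (h : ∀ x, g (f x) = k x) (a : S.obj X) : S.tr g (S.tr f a) = S.tr k a := by
  rw [← S.tr_comp, show g.comp f = k from MulActionHom.ext h]

theorem pair_eq {X Y : FinGSet G} (a : S.obj X) (b : S.obj Y) :
    S.pair a b = S.tr (inl X Y) a + S.tr (inr X Y) b := by
  conv_lhs => rw [← S.tr_id (S.pair a b)]
  rw [tr_pair]
  rfl

/-- The disjoint union of two maps. -/
def sumMap {X X' Y Y' : FinGSet G} (f : X →[G] X') (g : Y →[G] Y') :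
    X.sum Y →[G] X'.sum Y' := desc ((inl X' Y').comp f) ((inr X' Y').comp g)

theorem tr_sumMap {X X' Y Y' : FinGSet G} (f : X →[G] X') (g : Y →[G] Y') (a : S.obj X)
    (b : S.obj Y) : S.tr (sumMap f g) (S.pair a b) = S.pair (S.tr f a) (S.tr g b) := by
  rw [tr_pair, pair_eq S (S.tr f a), ← S.tr_comp, ← S.tr_comp]
  rfl

theorem res_desc {X Y Z : FinGSet G} (f : X →[G] Z) (g : Y →[G] Z) (a : S.obj Z) :
    S.res (desc f g) a = S.pair (S.res f a) (S.res g a) := by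
  apply S.sum_ext
  · rw [res_inl_pair]; exact S.res_res (fun _ => rfl) a
  · rw [res_inr_pair]; exact S.res_res (fun _ => rfl) a

theorem res_sumMap {X X' Y Y' : FinGSet G} (f : X →[G] X') (g : Y →[G] Y') (a : S.obj X')
    (b : S.obj Y') : S.res (sumMap f g) (S.pair a b) = S.pair (S.res f a) (S.res g b) := by
  rw [sumMap, res_desc, S.res_comp, S.res_comp, res_inl_pair, res_inr_pair]

theorem pair_mul {X Y : FinGSet G} (a a' : S.obj X) (b b' : S.obj Y) :
    S.pair (a * a') (b * b') = S.pair a b * S.pair a' b' := by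
  apply S.sum_ext <;> simp

theorem pair_res {X Y : FinGSet G} (a : S.obj (X.sum Y)) :
    S.pair (S.res (inl X Y) a) (S.res (inr X Y) a) = a := by
  apply S.sum_ext <;> simp

end

/-- Representatives `(U, p, b, c)` of the elements `T_p(b ⊗ c)` of the box product at `X`. -/
structure BoxPre (B : OTambara.{u, v} O) (C : OTambara.{u, w} O) (X : FinGSet G) where
  U : FinGSet G
  p : U →[G] X
  fst : B.obj U
  snd : C.obj U

variable {A : OTambara.{u, t} O} {B : OTambara.{u, v} O} {C : OTambara.{u, w} O}
  (ι : OTambaraHom A B) (κ : OTambaraHom A C)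

/-- The relations between the elements `T_p(b ⊗ c)`: Frobenius reciprocity on both sides, and
balancing over the base `A`. -/
inductive BoxRel (X : FinGSet G) : BoxPre B C X → BoxPre B C X → Prop
  | left {U' U : FinGSet G} (r : U' →[G] U) (q : U →[G] X) (b : B.obj U') (c : C.obj U) :
      BoxRel X ⟨U', q.comp r, b, C.res r c⟩ ⟨U, q, B.tr r b, c⟩
  | right {U' U : FinGSet G} (r : U' →[G] U) (q : U →[G] X) (b : B.obj U) (c : C.obj U') :
      BoxRel X ⟨U', q.comp r, B.res r b, c⟩ ⟨U, q, b, C.tr r c⟩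
  | bal {U : FinGSet G} (q : U →[G] X) (a : A.obj U) (b : B.obj U) (c : C.obj U) :
      BoxRel X ⟨U, q, ι.app U a * b, c⟩ ⟨U, q, b, κ.app U a * c⟩

/-- The value at `X` of the fibred box product of `B` and `C` over `A`. -/
def BoxObj (X : FinGSet G) : Type (max (u + 1) v w) := Quot (BoxRel ι κ X)

namespace BoxObj

variable {X Y U U' V V' : FinGSet G}

/-- The element `T_p(b ⊗ c)`. -/
def mk (p : U →[G] X) (b : B.obj U) (c : C.obj U) : BoxObj ι κ X := Quot.mk _ ⟨U, p, b, c⟩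

variable {ι κ}

theorem ind {P : BoxObj ι κ X → Prop}
    (h : ∀ (U : FinGSet G) (p : U →[G] X) (b : B.obj U) (c : C.obj U), P (mk ι κ p b c)) (x) :
    P x := Quot.ind (fun a => h a.U a.p a.fst a.snd) x

theorem mk_left {p : U' →[G] X} {q : U →[G] X} (r : U' →[G] U) (hp : ∀ u, p u = q (r u))
    {b : B.obj U'} {b' : B.obj U} {c : C.obj U'} {c' : C.obj U} (hb : b' = B.tr r b)
    (hc : c = C.res r c') : mk ι κ p b c = mk ι κ q b' c' := by
  subst hb hc
  obtain rfl : p = q.comp r := MulActionHom.ext hp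
  exact Quot.sound (BoxRel.left r q b c')

theorem mk_right {p : U' →[G] X} {q : U →[G] X} (r : U' →[G] U) (hp : ∀ u, p u = q (r u))
    {b : B.obj U'} {b' : B.obj U} {c : C.obj U'} {c' : C.obj U} (hb : b = B.res r b')
    (hc : c' = C.tr r c) : mk ι κ p b c = mk ι κ q b' c' := by
  subst hb hc
  obtain rfl : p = q.comp r := MulActionHom.ext hp
  exact Quot.sound (BoxRel.right r q b' c)

theorem mk_bal (q : U →[G] X) (a : A.obj U) (b : B.obj U) (c : C.obj U) :
    mk ι κ q (ι.app U a * b) c = mk ι κ q b (κ.app U a * c) :=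
  Quot.sound (BoxRel.bal q a b c)

theorem mk_iso {p : U' →[G] X} {q : U →[G] X} (e : U' →[G] U) (he : Function.Bijective e)
    (hp : ∀ u, p u = q (e u)) {b : B.obj U'} {b' : B.obj U} {c : C.obj U'} {c' : C.obj U}
    (hb : b = B.res e b') (hc : c = C.res e c') : mk ι κ p b c = mk ι κ q b' c' :=
  mk_left e hp (by rw [hb, B.tr_res e he]) hc

/-- Well-definedness of functions on the box product. -/
theorem rel_cases {α : Sort*} {F : BoxPre B C X → α}
    (hl : ∀ {U' U : FinGSet G} (r : U' →[G] U) (q : U →[G] X) (b : B.obj U') (c : C.obj U),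
      F ⟨U', q.comp r, b, C.res r c⟩ = F ⟨U, q, B.tr r b, c⟩)
    (hr : ∀ {U' U : FinGSet G} (r : U' →[G] U) (q : U →[G] X) (b : B.obj U) (c : C.obj U'),
      F ⟨U', q.comp r, B.res r b, c⟩ = F ⟨U, q, b, C.tr r c⟩)
    (hb : ∀ {U : FinGSet G} (q : U →[G] X) (a : A.obj U) (b : B.obj U) (c : C.obj U),
      F ⟨U, q, ι.app U a * b, c⟩ = F ⟨U, q, b, κ.app U a * c⟩)
    (x y : BoxPre B C X) (h : BoxRel ι κ X x y) : F x = F y := by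
  cases h with
  | left r q b c => exact hl r q b c
  | right r q b c => exact hr r q b c
  | bal q a b c => exact hb q a b c

variable (ι κ)

/-- Addition on representatives. -/
noncomputable def addPre (x y : BoxPre B C X) : BoxObj ι κ X :=
  mk ι κ (desc x.p y.p) (B.pair x.fst y.fst) (C.pair x.snd y.snd)

theorem addPre_comm (x y : BoxPre B C X) : addPre ι κ x y = addPre ι κ y x := by
  refine mk_iso (desc (inr y.U x.U) (inl y.U x.U))
    (Function.bijective_iff_has_inverse.2 ⟨desc (inr x.U y.U) (inl x.U y.U), ?_, ?_⟩) ?_ ?_ ?_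
  · rintro (a | a) <;> rfl
  · rintro (a | a) <;> rfl
  · rintro (a | a) <;> rfl
  · rw [res_desc, res_inl_pair, res_inr_pair]
  · rw [res_desc, res_inl_pair, res_inr_pair]

theorem app_pair_one (a : A.obj U) :
    ι.app (U.sum V) (A.pair a 1) = B.pair (ι.app U a) 1 := by
  apply B.sum_ext
  · rw [← ι.app_res, res_inl_pair, res_inl_pair]
  · rw [← ι.app_res, res_inr_pair, res_inr_pair, map_one]

theorem addPre_rel (y : BoxPre B C X) (x x' : BoxPre B C X) (h : BoxRel ι κ X x x') :
    addPre ι κ x y = addPre ι κ x' y := by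
  refine rel_cases (F := fun x => addPre ι κ x y) ?_ ?_ ?_ x x' h
  · intro U' U r q b c
    refine mk_left (sumMap r (MulActionHom.id G)) ?_ ?_ ?_
    · rintro (a | a) <;> rfl
    · rw [tr_sumMap, B.tr_id]
    · rw [res_sumMap, C.res_id]
  · intro U' U r q b c
    refine mk_right (sumMap r (MulActionHom.id G)) ?_ ?_ ?_
    · rintro (a | a) <;> rfl
    · rw [res_sumMap, B.res_id]
    · rw [tr_sumMap, C.tr_id]
  · intro U q a b c
    have := mk_bal (ι := ι) (κ := κ) (desc q y.p) (A.pair a 1) (B.pair b y.fst) (C.pair c y.snd)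
    rw [app_pair_one, app_pair_one, ← pair_mul, ← pair_mul, one_mul, one_mul] at this
    exact this

/-- Multiplication on representatives. -/
def mulPre (x y : BoxPre B C X) : BoxObj ι κ X :=
  mk ι κ (x.p.comp (pbFst x.p y.p)) (B.res (pbFst x.p y.p) x.fst * B.res (pbSnd x.p y.p) y.fst)
    (C.res (pbFst x.p y.p) x.snd * C.res (pbSnd x.p y.p) y.snd)

theorem bijective_of_isPb {P P' X Y Z : FinGSet G} {p : P →[G] X} {q : P →[G] Y} {f : X →[G] Z}
    {g : Y →[G] Z} {p' : P' →[G] X} {q' : P' →[G] Y} (h : IsPb p q f g) (h' : IsPb p' q' f g)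
    (e : P' →[G] P) (h1 : ∀ z, p (e z) = p' z) (h2 : ∀ z, q (e z) = q' z) :
    Function.Bijective e := by
  constructor
  · intro z z' hz
    exact h'.ext (by rw [← h1, ← h1, hz]) (by rw [← h2, ← h2, hz])
  · intro z
    obtain ⟨z', h3, h4⟩ := (h'.2 _ _ (h.1 z)).exists
    exact ⟨z', h.ext ((h1 z').trans h3) ((h2 z').trans h4)⟩

theorem mulPre_eq (x y : BoxPre B C X) {P : FinGSet G} {a : P →[G] x.U} {b : P →[G] y.U}
    (h : IsPb a b x.p y.p) {p : P →[G] X} (hp : ∀ z, p z = x.p (a z)) :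
    mulPre ι κ x y = mk ι κ p (B.res a x.fst * B.res b y.fst) (C.res a x.snd * C.res b y.snd) := by
  symm
  refine mk_iso (pbLift x.p y.p a b h.1)
    (bijective_of_isPb (isPb_pb x.p y.p) h _ (fun _ => rfl) fun _ => rfl) hp ?_ ?_
  · rw [map_mul]
    congr 1 <;> exact (B.res_res (fun _ => rfl) _).symm
  · rw [map_mul]
    congr 1 <;> exact (C.res_res (fun _ => rfl) _).symm

theorem isPb_symm {P X Y Z : FinGSet G} {p : P →[G] X} {q : P →[G] Y} {f : X →[G] Z}
    {g : Y →[G] Z} (h : IsPb p q f g) : IsPb q p g f :=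
  IsPb.mk' (fun z => (h.1 z).symm)
    (fun x y hxy => by
      obtain ⟨z, h1, h2⟩ := (h.2 y x hxy.symm).exists
      exact ⟨z, h2, h1⟩)
    fun _ _ h1 h2 => h.ext h2 h1

theorem mulPre_comm (x y : BoxPre B C X) : mulPre ι κ x y = mulPre ι κ y x := by
  rw [mulPre_eq ι κ y x (isPb_symm (isPb_pb x.p y.p)) (p := x.p.comp (pbFst x.p y.p))
    fun z => z.2]
  rw [mul_comm (B.res _ y.fst), mul_comm (C.res _ y.snd)]
  rfl

theorem mulPre_rel (y : BoxPre B C X) (x x' : BoxPre B C X) (h : BoxRel ι κ X x x') :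
    mulPre ι κ x y = mulPre ι κ x' y := by
  refine rel_cases (F := fun x => mulPre ι κ x y) ?_ ?_ ?_ x x' h
  · intro U' U r q b c
    let R : pb (q.comp r) y.p →[G] pb q y.p :=
      pbLift q y.p (r.comp (pbFst (q.comp r) y.p)) (pbSnd (q.comp r) y.p) fun z => z.2
    have hR : IsPb (pbFst (q.comp r) y.p) R r (pbFst q y.p) :=
      IsPb.mk' (fun _ => rfl)
        (fun u z hz => ⟨⟨(u, z.1.2), (congrArg q hz).trans z.2⟩, rfl,
          Subtype.ext (Prod.ext hz rfl)⟩)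
        fun z z' h1 h2 => Subtype.ext (Prod.ext h1 (congrArg (fun w : pb q y.p => w.1.2) h2))
    refine mk_left R (fun _ => rfl) ?_ ?_
    · change B.res _ (B.tr r b) * _ = B.tr R (_ * _)
      rw [B.res_tr hR, B.tr_mul]
      congr 2
      exact B.res_res (fun _ => rfl) _
    · change C.res _ (C.res r c) * _ = C.res R (_ * _)
      rw [map_mul]
      congr 1
      · refine C.res_sq ?_ _
        exact fun _ => rfl
      · exact (C.res_res (fun _ => rfl) _).symm
  · intro U' U r q b c
    let R : pb (q.comp r) y.p →[G] pb q y.p :=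
      pbLift q y.p (r.comp (pbFst (q.comp r) y.p)) (pbSnd (q.comp r) y.p) fun z => z.2
    have hR : IsPb (pbFst (q.comp r) y.p) R r (pbFst q y.p) :=
      IsPb.mk' (fun _ => rfl)
        (fun u z hz => ⟨⟨(u, z.1.2), (congrArg q hz).trans z.2⟩, rfl,
          Subtype.ext (Prod.ext hz rfl)⟩)
        fun z z' h1 h2 => Subtype.ext (Prod.ext h1 (congrArg (fun w : pb q y.p => w.1.2) h2))
    refine mk_right R (fun _ => rfl) ?_ ?_
    · change B.res _ (B.res r b) * _ = B.res R (_ * _)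
      rw [map_mul]
      congr 1
      · refine B.res_sq ?_ _
        exact fun _ => rfl
      · exact (B.res_res (fun _ => rfl) _).symm
    · change C.res _ (C.tr r c) * _ = C.tr R (_ * _)
      rw [C.res_tr hR, C.tr_mul]
      congr 2
      exact C.res_res (fun _ => rfl) _
  · intro U q a b c
    have := mk_bal (ι := ι) (κ := κ) (q.comp (pbFst q y.p)) (A.res (pbFst q y.p) a)
      (B.res (pbFst q y.p) b * B.res (pbSnd q y.p) y.fst)
      (C.res (pbFst q y.p) c * C.res (pbSnd q y.p) y.snd)
    rw [ι.app_res, κ.app_res, ← mul_assoc, ← mul_assoc, ← map_mul, ← map_mul] at this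
    exact this

noncomputable instance : Add (BoxObj ι κ X) :=
  ⟨Quot.lift₂ (addPre ι κ)
    (fun x y y' h => by
      rw [addPre_comm ι κ x, addPre_comm ι κ x]
      exact addPre_rel ι κ x y y' h)
    fun x x' y h => addPre_rel ι κ y x x' h⟩

instance : Mul (BoxObj ι κ X) :=
  ⟨Quot.lift₂ (mulPre ι κ)
    (fun x y y' h => by
      rw [mulPre_comm ι κ x, mulPre_comm ι κ x]
      exact mulPre_rel ι κ x y y' h)
    fun x x' y h => mulPre_rel ι κ y x x' h⟩

instance : Zero (BoxObj ι κ X) := ⟨mk ι κ (ofEmpty X) 0 0⟩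

instance : One (BoxObj ι κ X) := ⟨mk ι κ (MulActionHom.id G) 1 1⟩

instance : Neg (BoxObj ι κ X) :=
  ⟨Quot.lift (fun x => mk ι κ x.p (-x.fst) x.snd) (rel_cases
    (fun r q b c => mk_left r (fun _ => rfl) (map_neg _ _).symm rfl)
    (fun r q b c => mk_right r (fun _ => rfl) (map_neg _ _).symm rfl)
    fun q a b c => by
      change mk ι κ q (-(ι.app _ a * b)) c = mk ι κ q (-b) (κ.app _ a * c)
      rw [← mul_neg, mk_bal])⟩

variable {ι κ}

theorem mk_add (p : U →[G] X) (b : B.obj U) (c : C.obj U) (q : V →[G] X) (b' : B.obj V)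
    (c' : C.obj V) : mk ι κ p b c + mk ι κ q b' c' =
      mk ι κ (desc p q) (B.pair b b') (C.pair c c') := rfl

theorem mk_mul {p : U →[G] X} {b : B.obj U} {c : C.obj U} {q : V →[G] X} {b' : B.obj V}
    {c' : C.obj V} {P : FinGSet G} {α : P →[G] U} {β : P →[G] V} (h : IsPb α β p q)
    {r : P →[G] X} (hr : ∀ z, r z = p (α z)) : mk ι κ p b c * mk ι κ q b' c' =
      mk ι κ r (B.res α b * B.res β b') (C.res α c * C.res β c') :=
  mulPre_eq ι κ ⟨U, p, b, c⟩ ⟨V, q, b', c'⟩ h hr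

theorem neg_mk (p : U →[G] X) (b : B.obj U) (c : C.obj U) : -mk ι κ p b c = mk ι κ p (-b) c := rfl

theorem zero_def : (0 : BoxObj ι κ X) = mk ι κ (ofEmpty X) 0 0 := rfl

theorem one_def : (1 : BoxObj ι κ X) = mk ι κ (MulActionHom.id G) 1 1 := rfl

theorem mk_zero (p : U →[G] X) (c : C.obj U) : mk ι κ p 0 c = 0 := by
  symm
  refine mk_left (ofEmpty U) (fun u => isEmptyElim u) (map_zero _).symm ?_
  have := C.obj_empty
  exact Subsingleton.elim _ _

theorem mk_sum (f : U.sum V →[G] X) (b : B.obj (U.sum V)) (c : C.obj (U.sum V)) :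
    mk ι κ f b c = mk ι κ (f.comp (inl U V)) (B.res (inl U V) b) (C.res (inl U V) c) +
      mk ι κ (f.comp (inr U V)) (B.res (inr U V) b) (C.res (inr U V) c) := by
  rw [mk_add, pair_res, pair_res]
  congr 1
  ext (x | x) <;> rfl

theorem add_assoc' (x y z : BoxObj ι κ X) : x + y + z = x + (y + z) := by
  induction x using ind with | _ U p b c
  induction y using ind with | _ V q b' c'
  induction z using ind with | _ W r b'' c''
  simp only [mk_add]
  refine mk_iso (desc (desc (inl U (V.sum W)) ((inr U (V.sum W)).comp (inl V W)))
    ((inr U (V.sum W)).comp (inr V W))) (Function.bijective_iff_has_inverse.2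
      ⟨desc ((inl (U.sum V) W).comp (inl U V)) (desc ((inl (U.sum V) W).comp (inr U V))
        (inr (U.sum V) W)), ?_, ?_⟩) ?_ ?_ ?_
  · rintro ((a | a) | a) <;> rfl
  · rintro (a | a | a) <;> rfl
  · rintro ((a | a) | a) <;> rfl
  · simp only [res_desc, res_comp, res_inl_pair, res_inr_pair]
  · simp only [res_desc, res_comp, res_inl_pair, res_inr_pair]

theorem zero_add' (x : BoxObj ι κ X) : 0 + x = x := by
  induction x using ind with | _ U p b c
  rw [zero_def, mk_add]
  symm
  refine mk_iso (inr _ _) ⟨Sum.inr_injective, ?_⟩ (fun _ => rfl) ?_ ?_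
  · rintro (a | a)
    · exact isEmptyElim (α := empty G) a
    · exact ⟨a, rfl⟩
  · rw [res_inr_pair]
  · rw [res_inr_pair]

theorem neg_add_cancel' (x : BoxObj ι κ X) : -x + x = 0 := by
  induction x using ind with | _ U p b c
  rw [neg_mk, mk_add, ← mk_zero p c]
  refine mk_left (desc (MulActionHom.id G) (MulActionHom.id G)) ?_ ?_ ?_
  · rintro (a | a) <;> rfl
  · rw [tr_pair]
    change 0 = B.tr (MulActionHom.id G) (-b) + B.tr (MulActionHom.id G) b
    rw [B.tr_id, B.tr_id, neg_add_cancel]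
  · rw [res_desc, C.res_id]

theorem mul_comm' (x y : BoxObj ι κ X) : x * y = y * x := by
  induction x using ind with | _ U p b c
  induction y using ind with | _ V q b' c'
  exact mulPre_comm ι κ ⟨U, p, b, c⟩ ⟨V, q, b', c'⟩

theorem mul_assoc' (x y z : BoxObj ι κ X) : x * y * z = x * (y * z) := by
  induction x using ind with | _ U p b c
  induction y using ind with | _ V q b' c'
  induction z using ind with | _ W r b'' c''
  have h1 := isPb_pb p q
  rw [mk_mul h1 (r := p.comp (pbFst p q)) fun _ => rfl]
  have h2 := isPb_pb (p.comp (pbFst p q)) r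
  rw [mk_mul h2 (r := (p.comp (pbFst p q)).comp (pbFst _ r)) fun _ => rfl]
  have h3 := isPb_pb q r
  rw [mk_mul h3 (r := q.comp (pbFst q r)) fun _ => rfl]
  have h4 : IsPb ((pbFst p q).comp (pbFst (p.comp (pbFst p q)) r))
      (pbLift q r ((pbSnd p q).comp (pbFst (p.comp (pbFst p q)) r))
        (pbSnd (p.comp (pbFst p q)) r) fun z => z.1.1.2.symm.trans z.2)
      p (q.comp (pbFst q r)) :=
    IsPb.mk' (fun z => z.1.1.2)
      (fun u w huw => ⟨⟨(⟨(u, w.1.1), huw⟩, w.1.2), huw.trans w.2⟩, rfl, rfl⟩)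
      (fun z z' hz hz' => Subtype.ext (Prod.ext (Subtype.ext (Prod.ext hz
        (congrArg (fun a : pb q r => a.1.1) hz'))) (congrArg (fun a : pb q r => a.1.2) hz')))
  rw [mk_mul h4 (r := (p.comp (pbFst p q)).comp (pbFst _ r)) fun _ => rfl]
  congr 1
  · simp only [map_mul, ← res_comp, mul_assoc]; rfl
  · simp only [map_mul, ← res_comp, mul_assoc]; rfl

theorem isPb_id_left (p : U →[G] X) : IsPb p (MulActionHom.id G) (MulActionHom.id G) p :=
  IsPb.mk' (fun _ => rfl) (fun _ u h => ⟨u, h.symm, rfl⟩) fun _ _ _ h => h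

theorem one_mul' (x : BoxObj ι κ X) : 1 * x = x := by
  induction x using ind with | _ U p b c
  rw [one_def, mk_mul (isPb_id_left p) (r := p) fun _ => rfl]
  simp only [map_one, one_mul, res_id]

theorem left_distrib' (x y z : BoxObj ι κ X) : x * (y + z) = x * y + x * z := by
  induction x using ind with | _ U p b c
  induction y using ind with | _ V q b' c'
  induction z using ind with | _ W r b'' c''
  have h1 : IsPb (desc (pbFst p q) (pbFst p r)) (sumMap (pbSnd p q) (pbSnd p r)) p (desc q r) := by
    refine IsPb.mk' ?_ ?_ ?_
    · rintro (z | z)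
      · exact z.2
      · exact z.2
    · rintro u (w | w) h
      · exact ⟨Sum.inl ⟨(u, w), h⟩, rfl, rfl⟩
      · exact ⟨Sum.inr ⟨(u, w), h⟩, rfl, rfl⟩
    · rintro (z | z) (z' | z') hz hz'
      · exact congrArg Sum.inl (Subtype.ext (Prod.ext hz (Sum.inl_injective hz')))
      · exact (Sum.inl_ne_inr hz').elim
      · exact (Sum.inr_ne_inl hz').elim
      · exact congrArg Sum.inr (Subtype.ext (Prod.ext hz (Sum.inr_injective hz')))
  rw [mk_add, mk_mul (isPb_pb p q) (r := p.comp (pbFst p q)) fun _ => rfl,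
    mk_mul (isPb_pb p r) (r := p.comp (pbFst p r)) fun _ => rfl, mk_add,
    mk_mul h1 (r := desc (p.comp (pbFst p q)) (p.comp (pbFst p r)))]
  · simp only [res_desc, res_sumMap, pair_mul]
  · rintro (z | z) <;> rfl

noncomputable instance : CommRing (BoxObj ι κ X) :=
  CommRing.ofMinimalAxioms add_assoc' zero_add' neg_add_cancel' mul_assoc' mul_comm' one_mul'
    left_distrib'

theorem resPre_eq {f : Y →[G] X} {p : U →[G] X} {b : B.obj U} {c : C.obj U} {P P' : FinGSet G}
    {α : P →[G] Y} {β : P →[G] U} (h : IsPb α β f p) {α' : P' →[G] Y} {β' : P' →[G] U}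
    (h' : IsPb α' β' f p) :
    mk ι κ α (B.res β b) (C.res β c) = mk ι κ α' (B.res β' b) (C.res β' c) := by
  have hex : ∀ z : P, ∃ z', α' z' = α z ∧ β' z' = β z := fun z => (h'.2 _ _ (h.1 z)).exists
  choose e he1 he2 using hex
  let e' : P →[G] P' := ⟨e, fun m z => h'.ext
    (by rw [he1, map_smul, map_smul, he1]; rfl) (by rw [he2, map_smul, map_smul, he2]; rfl)⟩
  exact mk_iso e' (bijective_of_isPb h' h e' he1 he2) (fun z => (he1 z).symm)
    (B.res_res he2 b).symm (C.res_res he2 c).symm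

theorem isPb_lift (f : Y →[G] X) (q : U →[G] X) (r : V →[G] U) :
    IsPb (pbSnd f (q.comp r)) (pbLift f q (pbFst f (q.comp r)) (r.comp (pbSnd f (q.comp r)))
      fun z => z.2) r (pbSnd f q) :=
  IsPb.mk' (fun _ => rfl)
    (fun u z hz => ⟨⟨(z.1.1, u), z.2.trans (congrArg q hz.symm)⟩, rfl,
      Subtype.ext (Prod.ext rfl hz)⟩)
    fun z z' h1 h2 => Subtype.ext (Prod.ext (congrArg (fun w : pb f q => w.1.1) h2) h1)

variable (ι κ)

/-- The restriction `R_f`. -/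
def resFun (f : Y →[G] X) : BoxObj ι κ X → BoxObj ι κ Y :=
  Quot.lift (fun x => mk ι κ (pbFst f x.p) (B.res (pbSnd f x.p) x.fst) (C.res (pbSnd f x.p) x.snd))
    (rel_cases
      (fun r q b c => mk_left (pbLift f q (pbFst f (q.comp r)) (r.comp (pbSnd f (q.comp r)))
          fun z => z.2) (fun _ => rfl) (B.res_tr (isPb_lift f q r) b)
          (by refine C.res_sq ?_ _; exact fun _ => rfl))
      (fun r q b c => mk_right (pbLift f q (pbFst f (q.comp r)) (r.comp (pbSnd f (q.comp r)))
          fun z => z.2) (fun _ => rfl) (by refine B.res_sq ?_ _; exact fun _ => rfl)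
          (C.res_tr (isPb_lift f q r) c))
      fun q a b c => by
        dsimp only
        rw [map_mul, map_mul, ← ι.app_res, ← κ.app_res, mk_bal])

/-- The transfer `T_f`. -/
def trFun (f : X →[G] Y) : BoxObj ι κ X → BoxObj ι κ Y :=
  Quot.lift (fun x => mk ι κ (f.comp x.p) x.fst x.snd)
    (rel_cases
      (fun r q b c => mk_left r (fun _ => rfl) rfl rfl)
      (fun r q b c => mk_right r (fun _ => rfl) rfl rfl)
      fun q a b c => mk_bal _ _ _ _)

/-- The norm on representatives: `N_f(T_p(b ⊗ c)) = T_{h'}(N_{g'} R_{f'} b ⊗ N_{g'} R_{f'} c)`,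
where `h', g', f'` come from the exponential diagram of `p` and `f`. -/
def nmPre (f : X →[G] Y) (hf : O.Adm f) (x : BoxPre B C X) : BoxObj ι κ Y :=
  mk ι κ (piProj x.p f)
    (B.nm (piEvSnd x.p f) (adm_pb (isExp_pi x.p f).isPb hf) (B.res (piEvFst x.p f) x.fst))
    (C.nm (piEvSnd x.p f) (adm_pb (isExp_pi x.p f).isPb hf) (C.res (piEvFst x.p f) x.snd))

theorem nmPre_eq {f : X →[G] Y} (hf : O.Adm f) {p : U →[G] X} (b : B.obj U) (c : C.obj U)
    {D E : FinGSet G} {f' : E →[G] U} {g' : E →[G] D} {h' : D →[G] Y} (H : IsExp p f f' g' h')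
    (hg' : O.Adm g') : nmPre ι κ f hf ⟨U, p, b, c⟩ =
      mk ι κ h' (B.nm g' hg' (B.res f' b)) (C.nm g' hg' (C.res f' c)) := by
  obtain ⟨φ, ψ, hφ, hψ, h1, h2, h3⟩ := H.exists_iso
  symm
  refine mk_iso φ hφ (fun d => (h3 d).symm) ?_ ?_
  · rw [← B.nm_res_of_iso _ hg' ψ φ hψ hφ h2]
    congr 1
    exact (B.res_res h1 b).symm
  · rw [← C.nm_res_of_iso _ hg' ψ φ hψ hφ h2]
    congr 1
    exact (C.res_res h1 c).symm

theorem nm_tr_paste (S : OTambara.{u, v} O) {D E D2 E2 E' V' V : FinGSet G} {g' : E →[G] D}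
    (hg' : O.Adm g') {f' : E →[G] V} {r : V' →[G] V} {a : E' →[G] V'} {b : E' →[G] E}
    (hp : IsPb a b r f') {f2 : E2 →[G] E'} {g2 : E2 →[G] D2} {h2 : D2 →[G] D}
    (H2 : IsExp b g' f2 g2 h2) (hg2 : O.Adm g2) (s : S.obj V') :
    S.nm g' hg' (S.res f' (S.tr r s)) = S.tr h2 (S.nm g2 hg2 (S.res (a.comp f2) s)) := by
  rw [S.res_tr hp, S.nm_tr H2 hg' hg2, S.res_comp]

theorem nm_res_paste (S : OTambara.{u, v} O) {D E D2 E2 E' V' V : FinGSet G} {g' : E →[G] D}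
    (hg' : O.Adm g') {f' : E →[G] V} {r : V' →[G] V} {a : E' →[G] V'} {b : E' →[G] E}
    (hp : IsPb a b r f') {f2 : E2 →[G] E'} {g2 : E2 →[G] D2} {h2 : D2 →[G] D}
    (H2 : IsExp b g' f2 g2 h2) (hg2 : O.Adm g2) (s : S.obj V) :
    S.nm g2 hg2 (S.res (a.comp f2) (S.res r s)) = S.res h2 (S.nm g' hg' (S.res f' s)) := by
  rw [S.res_nm H2.isPb hg' hg2]
  congr 1
  exact S.res_sq (fun e => hp.1 (f2 e)) s

/-- The norm `N_f`. -/
def nmFun (f : X →[G] Y) (hf : O.Adm f) : BoxObj ι κ X → BoxObj ι κ Y :=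
  Quot.lift (nmPre ι κ f hf)
    (rel_cases
      (fun r q b c => by
        have H := isExp_pi q f
        have hp := isPb_pb r (piEvFst q f)
        have H2 := isExp_pi (pbSnd r (piEvFst q f)) (piEvSnd q f)
        have hg' := adm_pb H.isPb hf
        have hg2 := adm_pb H2.isPb hg'
        rw [nmPre_eq ι κ hf b (C.res r c) (H.paste_tr hp H2) hg2]
        exact mk_left (piProj _ _) (fun _ => rfl) (nm_tr_paste B hg' hp H2 hg2 b)
          (nm_res_paste C hg' hp H2 hg2 c))
      (fun r q b c => by
        have H := isExp_pi q f
        have hp := isPb_pb r (piEvFst q f)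
        have H2 := isExp_pi (pbSnd r (piEvFst q f)) (piEvSnd q f)
        have hg' := adm_pb H.isPb hf
        have hg2 := adm_pb H2.isPb hg'
        rw [nmPre_eq ι κ hf (B.res r b) c (H.paste_tr hp H2) hg2]
        exact mk_right (piProj _ _) (fun _ => rfl) (nm_res_paste B hg' hp H2 hg2 b)
          (nm_tr_paste C hg' hp H2 hg2 c))
      fun q a b c => by
        dsimp only [nmPre]
        simp only [map_mul]
        rw [← ι.app_res, ← κ.app_res, ← ι.app_nm, ← κ.app_nm, mk_bal])

variable {ι κ}

theorem res_mk {f : Y →[G] X} {p : U →[G] X} {b : B.obj U} {c : C.obj U} {P : FinGSet G}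
    {α : P →[G] Y} {β : P →[G] U} (h : IsPb α β f p) :
    resFun ι κ f (mk ι κ p b c) = mk ι κ α (B.res β b) (C.res β c) :=
  resPre_eq (isPb_pb f p) h

theorem tr_mk (f : X →[G] Y) (p : U →[G] X) (b : B.obj U) (c : C.obj U) :
    trFun ι κ f (mk ι κ p b c) = mk ι κ (f.comp p) b c := rfl

theorem nm_mk {f : X →[G] Y} (hf : O.Adm f) {p : U →[G] X} (b : B.obj U) (c : C.obj U)
    {D E : FinGSet G} {f' : E →[G] U} {g' : E →[G] D} {h' : D →[G] Y} (H : IsExp p f f' g' h')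
    (hg' : O.Adm g') : nmFun ι κ f hf (mk ι κ p b c) =
      mk ι κ h' (B.nm g' hg' (B.res f' b)) (C.nm g' hg' (C.res f' c)) :=
  nmPre_eq ι κ hf b c H hg'

variable (ι κ)

/-- Restriction as a ring homomorphism. -/
noncomputable def res (f : Y →[G] X) : BoxObj ι κ X →+* BoxObj ι κ Y :=
  RingHom.mk'
    { toFun := resFun ι κ f
      map_one' := by
        rw [one_def, res_mk (isPb_symm (isPb_id_left f)), map_one, map_one]; rfl
      map_mul' := fun x y => by
        induction x using ind with | _ U p b c
        induction y using ind with | _ V q b' c'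
        have h1 := isPb_pb f p
        have h2 := isPb_pb f q
        rw [mk_mul (isPb_pb p q) (r := p.comp (pbFst p q)) fun _ => rfl, res_mk h1, res_mk h2,
          mk_mul (isPb_pb (pbFst f p) (pbFst f q)) (r := (pbFst f p).comp (pbFst _ _))
            fun _ => rfl]
        have h3 : IsPb ((pbFst f p).comp (pbFst (pbFst f p) (pbFst f q)))
            (pbLift p q ((pbSnd f p).comp (pbFst (pbFst f p) (pbFst f q)))
              ((pbSnd f q).comp (pbSnd (pbFst f p) (pbFst f q))) fun z =>
              z.1.1.2.symm.trans ((congrArg f z.2).trans z.1.2.2)) f (p.comp (pbFst p q)) :=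
          IsPb.mk' (fun z => z.1.1.2)
            (fun y w h => ⟨⟨(⟨(y, w.1.1), h⟩, ⟨(y, w.1.2), h.trans w.2⟩), rfl⟩, rfl, rfl⟩)
            (fun z z' hz hz' => Subtype.ext (Prod.ext
              (Subtype.ext (Prod.ext hz (congrArg (fun a : pb p q => a.1.1) hz')))
              (Subtype.ext (Prod.ext (z.2.symm.trans (hz.trans z'.2))
                (congrArg (fun a : pb p q => a.1.2) hz')))))
        rw [res_mk h3]
        congr 1
        · simp only [map_mul, ← res_comp]; rfl
        · simp only [map_mul, ← res_comp]; rfl }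
    fun x y => by
      induction x using ind with | _ U p b c
      induction y using ind with | _ V q b' c'
      change resFun ι κ f (mk ι κ p b c + mk ι κ q b' c') =
        resFun ι κ f (mk ι κ p b c) + resFun ι κ f (mk ι κ q b' c')
      have h1 : IsPb (desc (pbFst f p) (pbFst f q)) (sumMap (pbSnd f p) (pbSnd f q)) f
          (desc p q) := by
        refine IsPb.mk' ?_ ?_ ?_
        · rintro (z | z)
          · exact z.2
          · exact z.2
        · rintro u (w | w) h
          · exact ⟨Sum.inl ⟨(u, w), h⟩, rfl, rfl⟩
          · exact ⟨Sum.inr ⟨(u, w), h⟩, rfl, rfl⟩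
        · rintro (z | z) (z' | z') hz hz'
          · exact congrArg Sum.inl (Subtype.ext (Prod.ext hz (Sum.inl_injective hz')))
          · exact (Sum.inl_ne_inr hz').elim
          · exact (Sum.inr_ne_inl hz').elim
          · exact congrArg Sum.inr (Subtype.ext (Prod.ext hz (Sum.inr_injective hz')))
      rw [mk_add, res_mk (isPb_pb f p), res_mk (isPb_pb f q), mk_add, res_mk h1, res_sumMap,
        res_sumMap]

/-- Transfer as an additive homomorphism. -/
noncomputable def tr (f : X →[G] Y) : BoxObj ι κ X →+ BoxObj ι κ Y :=
  AddMonoidHom.mk' (trFun ι κ f) fun x y => by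
    induction x using ind with | _ U p b c
    induction y using ind with | _ V q b' c'
    rw [mk_add, tr_mk, tr_mk, tr_mk, mk_add]
    congr 1
    ext (x | x) <;> rfl

/-- Norm as a multiplicative homomorphism. -/
noncomputable def nm (f : X →[G] Y) (hf : O.Adm f) : BoxObj ι κ X →* BoxObj ι κ Y where
  toFun := nmFun ι κ f hf
  map_one' := by
    rw [one_def, nm_mk hf 1 1 (isExp_tr_id f) hf]
    simp only [map_one]
    rfl
  map_mul' x y := by
    induction x using ind with | _ U p b c
    induction y using ind with | _ V q b' c'
    have H1 := isExp_pi p f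
    have H2 := isExp_pi q f
    have hg1 := adm_pb H1.isPb hf
    have hg2 := adm_pb H2.isPb hf
    have hA := isPb_pb p q
    have hD := isPb_pb (piProj p f) (piProj q f)
    have hE := isPb_pb (p.comp (piEvFst p f)) (q.comp (piEvFst q f))
    let F := pbLift p q
      ((piEvFst p f).comp (pbFst (p.comp (piEvFst p f)) (q.comp (piEvFst q f))))
      ((piEvFst q f).comp (pbSnd (p.comp (piEvFst p f)) (q.comp (piEvFst q f)))) hE.1
    let G' := pbLift (piProj p f) (piProj q f)
      ((piEvSnd p f).comp (pbFst (p.comp (piEvFst p f)) (q.comp (piEvFst q f))))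
      ((piEvSnd q f).comp (pbSnd (p.comp (piEvFst p f)) (q.comp (piEvFst q f)))) fun z =>
        (H1.comm _).symm.trans ((congrArg f z.2).trans (H2.comm _))
    obtain ⟨H, hP1, hP2⟩ := H1.mul H2 hA hD hE (f := F) (g' := G') (fun _ => rfl) (fun _ => rfl)
      (fun _ => rfl) fun _ => rfl
    have hG : O.Adm G' := adm_pb H.isPb hf
    rw [mk_mul hA (r := p.comp (pbFst p q)) fun _ => rfl, nm_mk hf b c H1 hg1,
      nm_mk hf b' c' H2 hg2, nm_mk hf _ _ H hG,
      mk_mul hD (r := (piProj p f).comp (pbFst _ _)) fun _ => rfl,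
      B.res_nm hP1 hg1 hG, B.res_nm hP2 hg2 hG, C.res_nm hP1 hg1 hG, C.res_nm hP2 hg2 hG]
    simp only [map_mul, ← res_comp]
    rfl

end BoxObj
end OTambara

namespace OTambara

open IndexingSystem

variable {G : Type u} [Group G] [Finite G] {O : IndexingSystem G}

variable {A : OTambara.{u, t} O} {B : OTambara.{u, v} O} {C : OTambara.{u, w} O}

namespace BoxObj

variable {ι : OTambaraHom A B} {κ : OTambaraHom A C} {X Y Z U V : FinGSet G}

theorem res_apply {f : Y →[G] X} {p : U →[G] X} {b : B.obj U} {c : C.obj U} {P : FinGSet G}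
    {α : P →[G] Y} {β : P →[G] U} (h : IsPb α β f p) :
    res ι κ f (mk ι κ p b c) = mk ι κ α (B.res β b) (C.res β c) := res_mk h

theorem tr_apply (f : X →[G] Y) (p : U →[G] X) (b : B.obj U) (c : C.obj U) :
    tr ι κ f (mk ι κ p b c) = mk ι κ (f.comp p) b c := rfl

theorem nm_apply {f : X →[G] Y} (hf : O.Adm f) {p : U →[G] X} (b : B.obj U) (c : C.obj U)
    {D E : FinGSet G} {f' : E →[G] U} {g' : E →[G] D} {h' : D →[G] Y} (H : IsExp p f f' g' h')
    (hg' : O.Adm g') : nm ι κ f hf (mk ι κ p b c) =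
      mk ι κ h' (B.nm g' hg' (B.res f' b)) (C.nm g' hg' (C.res f' c)) := nm_mk hf b c H hg'

theorem isPb_paste {P Q X Y Z W : FinGSet G} {p : P →[G] X} {q : P →[G] Y} {f : X →[G] Z}
    {g : Y →[G] Z} (h : IsPb p q f g) {p' : Q →[G] W} {q' : Q →[G] P} {k : W →[G] X}
    (h' : IsPb p' q' k p) : IsPb p' (q.comp q') (f.comp k) g := by
  refine IsPb.mk' (fun z => (congrArg f (h'.1 z)).trans (h.1 _)) ?_ ?_
  · intro x y hxy
    obtain ⟨z, h1, h2⟩ := (h.2 _ _ hxy).exists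
    obtain ⟨z', h3, h4⟩ := (h'.2 x z h1.symm).exists
    exact ⟨z', h3, (congrArg q h4).trans h2⟩
  · intro z z' h1 h2
    refine h'.ext h1 (h.ext ?_ h2)
    rw [← h'.1, ← h'.1, h1]

theorem isPb_unpaste {P Q X Y Z W : FinGSet G} {p : P →[G] X} {q : P →[G] Y} {f : X →[G] Z}
    {g : Y →[G] Z} (h : IsPb p q f g) {α : Q →[G] P} {β : Q →[G] W} {k : W →[G] X}
    (h' : IsPb α β p k) : IsPb (q.comp α) β g (f.comp k) :=
  isPb_symm (isPb_paste h (isPb_symm h'))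

theorem subsingleton_empty : Subsingleton (BoxObj ι κ (empty G)) := by
  refine subsingleton_of_forall_eq 0 fun x => ?_
  induction x using ind with | _ U p b c
  have hU : IsEmpty U := ⟨fun u => isEmptyElim (p u)⟩
  have hB := B.obj_empty
  have hC := C.obj_empty
  rw [zero_def]
  symm
  exact mk_iso (ofEmpty U) ⟨fun a => isEmptyElim a, fun u => hU.elim u⟩ (fun u => isEmptyElim u)
    (Subsingleton.elim _ _) (Subsingleton.elim _ _)

theorem box_res_id (x : BoxObj ι κ X) : res ι κ (MulActionHom.id G) x = x := by
  induction x using ind with | _ U p b c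
  rw [res_apply (isPb_id_left p), B.res_id, C.res_id]

theorem box_tr_id (x : BoxObj ι κ X) : tr ι κ (MulActionHom.id G) x = x := by
  induction x using ind with | _ U p b c
  rfl

theorem _root_.FinGSet.IsPb.exists_lift {W P X Y Z : FinGSet G} {p : P →[G] X} {q : P →[G] Y}
    {f : X →[G] Z} {g : Y →[G] Z} (h : IsPb p q f g) (a : W →[G] X) (b : W →[G] Y)
    (hab : ∀ w, f (a w) = g (b w)) :
    ∃ l : W →[G] P, (∀ w, p (l w) = a w) ∧ ∀ w, q (l w) = b w := by
  have hex : ∀ w, ∃ z, p z = a w ∧ q z = b w := fun w => (h.2 _ _ (hab w)).exists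
  choose e he1 he2 using hex
  exact ⟨⟨e, fun m z => h.ext (by rw [he1, map_smul, map_smul, he1]; rfl)
    (by rw [he2, map_smul, map_smul, he2]; rfl)⟩, he1, he2⟩

theorem box_res_tr {P X Y Z : FinGSet G} {p : P →[G] X} {q : P →[G] Y} {f : X →[G] Z}
    {g : Y →[G] Z} (h : IsPb p q f g) (x : BoxObj ι κ X) :
    res ι κ g (tr ι κ f x) = tr ι κ q (res ι κ p x) := by
  induction x using ind with | _ U k b c
  rw [tr_apply, res_apply (isPb_unpaste h (isPb_pb p k)), res_apply (isPb_pb p k), tr_apply]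

theorem tr_inl_add_tr_inr (x : BoxObj ι κ (X.sum Y)) :
    tr ι κ (inl X Y) (res ι κ (inl X Y) x) + tr ι κ (inr X Y) (res ι κ (inr X Y) x) = x := by
  induction x using ind with | _ U p b c
  rw [res_apply (isPb_pb (inl X Y) p), res_apply (isPb_pb (inr X Y) p), tr_apply, tr_apply, mk_add]
  refine mk_iso (desc (pbSnd (inl X Y) p) (pbSnd (inr X Y) p)) ⟨?_, ?_⟩ ?_ ?_ ?_
  · rintro (a | a) (b | b) h
    · exact congrArg Sum.inl (Subtype.ext (Prod.ext (Sum.inl_injective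
        (a.2.trans ((congrArg p h).trans b.2.symm))) h))
    · exact (Sum.inl_ne_inr (a.2.trans ((congrArg p h).trans b.2.symm))).elim
    · exact (Sum.inr_ne_inl (a.2.trans ((congrArg p h).trans b.2.symm))).elim
    · exact congrArg Sum.inr (Subtype.ext (Prod.ext (Sum.inr_injective
        (a.2.trans ((congrArg p h).trans b.2.symm))) h))
  · intro u
    rcases hu : (p u : X ⊕ Y) with x | y
    · exact ⟨Sum.inl ⟨(x, u), hu.symm⟩, rfl⟩
    · exact ⟨Sum.inr ⟨(y, u), hu.symm⟩, rfl⟩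
  · rintro (a | a)
    · exact a.2
    · exact a.2
  · rw [res_desc]
  · rw [res_desc]

end BoxObj

open BoxObj

/-- The fibred box product `B ⊠_A C`, with its structure of an `O`-Tambara functor. -/
noncomputable def box (ι : OTambaraHom A B) (κ : OTambaraHom A C) :
    OTambara.{u, max (u + 1) v w} O where
  obj X := BoxObj ι κ X
  res f := BoxObj.res ι κ f
  tr f := BoxObj.tr ι κ f
  nm f hf := BoxObj.nm ι κ f hf
  res_id x := box_res_id x
  res_comp g f x := by
    induction x using BoxObj.ind with | _ U p b c
    have h1 := isPb_pb g p
    have h2 := isPb_pb f (pbFst g p)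
    rw [res_apply h1, res_apply h2, res_apply (isPb_paste h1 h2), B.res_comp, C.res_comp]
  tr_id x := box_tr_id x
  tr_comp g f x := by
    induction x using BoxObj.ind with | _ U p b c
    rfl
  nm_id h x := by
    induction x using BoxObj.ind with | _ U p b c
    have h1 : O.Adm (MulActionHom.id G : U →[G] U) := adm_of_injective fun _ _ h => h
    rw [nm_apply h b c (isExp_id p) h1, B.nm_id, C.nm_id, B.res_id, C.res_id]
  nm_comp k g hk hg h x := by
    induction x using BoxObj.ind with | _ U p b c
    have H := isExp_pi p g
    have hg' := adm_pb H.isPb hg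
    have H2 := isExp_pi (piProj p g) k
    have hg2 := adm_pb H2.isPb hk
    have hp := isPb_pb (piEvSnd p g) (piEvFst (piProj p g) k)
    have ht := adm_pb hp hg'
    rw [nm_apply hg b c H hg', nm_apply hk _ _ H2 hg2,
      nm_apply h b c (H.paste_nm H2 hp) (adm_comp ht hg2), B.res_nm hp hg' ht, C.res_nm hp hg' ht,
      B.nm_comp _ _ hg2 ht, C.nm_comp _ _ hg2 ht, B.res_comp, C.res_comp]
  res_tr h x := box_res_tr h x
  res_nm {P X Y Z p q f g} h hf hq x := by
    induction x using BoxObj.ind with | _ U r b c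
    have H := isExp_pi r f
    have hg' := adm_pb H.isPb hf
    have hA := isPb_pb p r
    have hD := isPb_pb g (piProj r f)
    have hE := isPb_pb (piEvSnd r f) (pbSnd g (piProj r f))
    obtain ⟨l, hl1, hl2⟩ := h.exists_lift
      (r.comp ((piEvFst r f).comp (pbFst (piEvSnd r f) (pbSnd g (piProj r f)))))
      ((pbFst g (piProj r f)).comp (pbSnd (piEvSnd r f) (pbSnd g (piProj r f)))) fun z =>
        (H.comm z.1.1).trans ((congrArg (piProj r f) z.2).trans z.1.2.2.symm)
    have H2 := H.base_change h (isPb_symm hA) (isPb_symm hD) hE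
      (f2' := pbLift p r l ((piEvFst r f).comp (pbFst _ _)) hl1) (fun _ => rfl) hl2
    have hg2 := adm_pb H2.isPb hq
    rw [nm_apply hf b c H hg', res_apply hD, res_apply hA, nm_apply hq _ _ H2 hg2,
      B.res_nm hE hg' hg2, C.res_nm hE hg' hg2]
    simp only [← res_comp]
    rfl
  nm_tr {A' X Y D E h g f' g' h'} H hg hg' x := by
    induction x using BoxObj.ind with | _ U p b c
    have hp := isPb_pb p f'
    have H2 := isExp_pi (pbSnd p f') g'
    have hg2 := adm_pb H2.isPb hg'
    rw [tr_apply, nm_apply hg b c (H.paste_tr hp H2) hg2, res_apply (isPb_symm hp),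
      nm_apply hg' _ _ H2 hg2, tr_apply, B.res_comp, C.res_comp]
  mul_tr f x y := by
    induction x using BoxObj.ind with | _ U p b c
    induction y using BoxObj.ind with | _ V q b' c'
    have h1 := isPb_pb f p
    have h2 := isPb_pb (pbFst f p) q
    rw [tr_apply, res_apply h1, mk_mul h2 (r := q.comp (pbSnd _ _)) fun z => z.2.symm, tr_apply,
      mk_mul (isPb_symm (isPb_paste h1 (isPb_symm h2)))
        (r := f.comp (q.comp (pbSnd _ _))), B.res_comp, C.res_comp]
    intro z
    exact (congrArg f z.2).symm.trans z.1.1.2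
  obj_sum X Y := by
    constructor
    · intro x y h
      rw [← tr_inl_add_tr_inr x, ← tr_inl_add_tr_inr y]
      have e1 : BoxObj.res ι κ (inl X Y) x = BoxObj.res ι κ (inl X Y) y := congrArg Prod.fst h
      have e2 : BoxObj.res ι κ (inr X Y) x = BoxObj.res ι κ (inr X Y) y := congrArg Prod.snd h
      rw [e1, e2]
    · rintro ⟨x, y⟩
      have hs := subsingleton_empty (ι := ι) (κ := κ)
      refine ⟨BoxObj.tr ι κ (inl X Y) x + BoxObj.tr ι κ (inr X Y) y, Prod.ext ?_ ?_⟩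
      · change BoxObj.res ι κ (inl X Y) _ = x
        rw [map_add, box_res_tr (isPb_inl_inl X Y), box_res_tr (isPb_inr_inl X Y), box_res_id,
          Subsingleton.elim (BoxObj.res ι κ (ofEmpty Y) y) 0, map_zero, add_zero, box_tr_id]
      · change BoxObj.res ι κ (inr X Y) _ = y
        rw [map_add, box_res_tr (isPb_inr_inr X Y), box_res_tr (isPb_inl_inr X Y), box_res_id,
          Subsingleton.elim (BoxObj.res ι κ (ofEmpty X) x) 0, map_zero, zero_add, box_tr_id]
  obj_empty := subsingleton_empty

end OTambara

/-! ### Ideals, modules, Kähler differentials and derivations -/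

namespace OTambara

open IndexingSystem BoxObj

variable {G : Type u} [Group G] [Finite G] {O : IndexingSystem G}

/-- An ideal of an `O`-Tambara functor. -/
structure TambaraIdeal (S : OTambara.{u, v} O) where
  carrier : ∀ X : FinGSet G, Ideal (S.obj X)
  res_mem : ∀ {X Y : FinGSet G} (f : X →[G] Y) (a), a ∈ carrier Y → S.res f a ∈ carrier X
  tr_mem : ∀ {X Y : FinGSet G} (f : X →[G] Y) (a), a ∈ carrier X → S.tr f a ∈ carrier Y
  nm_mem : ∀ {X Y : FinGSet G} (f : X →[G] Y) (hf : O.Adm f) (a), a ∈ carrier X →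
    S.nm f hf a - S.nm f hf 0 ∈ carrier Y

/-- The kernel of a map of `O`-Tambara functors. -/
def ker {S : OTambara.{u, v} O} {T : OTambara.{u, w} O} (φ : OTambaraHom S T) :
    TambaraIdeal S where
  carrier X := RingHom.ker (φ.app X)
  res_mem f a ha := by
    rw [RingHom.mem_ker] at *
    rw [φ.app_res, ha, map_zero]
  tr_mem f a ha := by
    rw [RingHom.mem_ker] at *
    rw [φ.app_tr, ha, map_zero]
  nm_mem f hf a ha := by
    rw [RingHom.mem_ker] at *
    rw [map_sub, φ.app_nm, φ.app_nm, ha, map_zero (φ.app _), sub_self]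

/-- `J` contains every norm `N_f(i)` of an element `i` of `I` along a 2-surjective admissible
map `f`. -/
def TambaraIdeal.ContainsNorms {S : OTambara.{u, v} O} (I J : TambaraIdeal S) : Prop :=
  ∀ {X Y : FinGSet G} (f : X →[G] Y) (hf : O.Adm f), TwoSurj f →
    ∀ i ∈ I.carrier X, S.nm f hf i ∈ J.carrier Y

/-- The ideal `I^{>1}`: the smallest ideal containing every norm `N_f(i)` of an element `i` of `I`
along a 2-surjective admissible map `f`. -/
def TambaraIdeal.gtOne {S : OTambara.{u, v} O} (I : TambaraIdeal S) : TambaraIdeal S where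
  carrier X := ⨅ J : {J : TambaraIdeal S // I.ContainsNorms J}, J.1.carrier X
  res_mem f a ha := by
    simp only [Submodule.mem_iInf] at *
    exact fun J => J.1.res_mem f a (ha J)
  tr_mem f a ha := by
    simp only [Submodule.mem_iInf] at *
    exact fun J => J.1.tr_mem f a (ha J)
  nm_mem f hf a ha := by
    simp only [Submodule.mem_iInf] at *
    exact fun J => J.1.nm_mem f hf a (ha J)

theorem tr_inl_add (S : OTambara.{u, v} O) {X Y : FinGSet G} (a : S.obj (X.sum Y)) :
    S.tr (inl X Y) (S.res (inl X Y) a) + S.tr (inr X Y) (S.res (inr X Y) a) = a := by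
  rw [← pair_eq, pair_res]

theorem TambaraIdeal.mem_of_sum {S : OTambara.{u, v} O} (I : TambaraIdeal S) {X Y : FinGSet G}
    {a : S.obj (X.sum Y)} (h1 : S.res (inl X Y) a ∈ I.carrier X)
    (h2 : S.res (inr X Y) a ∈ I.carrier Y) : a ∈ I.carrier (X.sum Y) := by
  rw [← S.tr_inl_add a]
  exact add_mem (I.tr_mem _ _ h1) (I.tr_mem _ _ h2)

end OTambara

/-- A module over an `O`-Tambara functor `B`. -/
structure TModule {G : Type u} [Group G] [Finite G] {O : IndexingSystem G}
    (B : OTambara.{u, v} O) extends MackeyFunctor.{u, w} G where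
  [module : ∀ X, Module (B.obj X) (obj X)]
  res_smul : ∀ {X Y : FinGSet G} (f : X →[G] Y) (s : B.obj Y) (m : obj Y),
    res f (s • m) = B.res f s • res f m
  smul_tr : ∀ {X Y : FinGSet G} (f : X →[G] Y) (s : B.obj Y) (m : obj X),
    s • tr f m = tr f (B.res f s • m)
  tr_smul : ∀ {X Y : FinGSet G} (f : X →[G] Y) (s : B.obj X) (m : obj Y),
    B.tr f s • m = tr f (s • res f m)

attribute [instance] TModule.module

/-- The group of maps of Mackey functors. -/
def MackeyHom {G : Type u} [Group G] (M : MackeyFunctor.{u, v} G) (N : MackeyFunctor.{u, w} G) :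
    AddSubgroup (∀ X : FinGSet G, M.obj X →+ N.obj X) where
  carrier := {φ | (∀ {X Y : FinGSet G} (f : X →[G] Y) (m : M.obj Y),
      φ X (M.res f m) = N.res f (φ Y m)) ∧
    ∀ {X Y : FinGSet G} (f : X →[G] Y) (m : M.obj X), φ Y (M.tr f m) = N.tr f (φ X m)}
  zero_mem' := ⟨fun f m => (map_zero _).symm, fun f m => (map_zero _).symm⟩
  add_mem' {φ ψ} hφ hψ := by
    refine ⟨fun f m => ?_, fun f m => ?_⟩
    · simp only [Pi.add_apply, AddMonoidHom.add_apply, map_add, hφ.1, hψ.1]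
    · simp only [Pi.add_apply, AddMonoidHom.add_apply, map_add, hφ.2, hψ.2]
  neg_mem' {φ} hφ := by
    refine ⟨fun f m => ?_, fun f m => ?_⟩
    · simp only [Pi.neg_apply, AddMonoidHom.neg_apply, map_neg, hφ.1]
    · simp only [Pi.neg_apply, AddMonoidHom.neg_apply, map_neg, hφ.2]

/-- The group `Hom_B(M, N)` of maps of `B`-modules. -/
def ModHom {G : Type u} [Group G] [Finite G] {O : IndexingSystem G} {B : OTambara.{u, v} O}
    (M : TModule.{u, v, w} B) (N : TModule.{u, v, t} B) :
    AddSubgroup (∀ X : FinGSet G, M.obj X →+ N.obj X) where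
  carrier := {φ | φ ∈ MackeyHom M.toMackeyFunctor N.toMackeyFunctor ∧
    ∀ (X : FinGSet G) (s : B.obj X) (m : M.obj X), φ X (s • m) = s • φ X m}
  zero_mem' := ⟨zero_mem _, fun _ _ _ => (smul_zero _).symm⟩
  add_mem' {φ ψ} hφ hψ := by
    refine ⟨add_mem hφ.1 hψ.1, fun X s m => ?_⟩
    simp only [Pi.add_apply, AddMonoidHom.add_apply, hφ.2, hψ.2, smul_add]
  neg_mem' {φ} hφ := by
    refine ⟨neg_mem hφ.1, fun X s m => ?_⟩
    simp only [Pi.neg_apply, AddMonoidHom.neg_apply, hφ.2, smul_neg]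

/-- The group `Der_A(S, M)` of `O`-genuine `A`-derivations from an `A`-algebra `S` to an
`S`-module `M`: maps of Mackey functors `d` which vanish on the image of `A` and satisfy
`d (N_f s) = T_f (N_{π₂} R_{π₁} s • d s)` for all admissible `f : X → Y`, where `π₁` and `π₂` are
the projections of `X ×_Y X - Δ(X)`. -/
def Der {G : Type u} [Group G] [Finite G] {O : IndexingSystem G} {A : OTambara.{u, t} O}
    {S : OTambara.{u, v} O} (ι : OTambaraHom A S) (M : TModule.{u, v, w} S) :
    AddSubgroup (∀ X : FinGSet G, S.obj X →+ M.obj X) where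
  carrier := {d | d ∈ MackeyHom S.toMackey M.toMackeyFunctor ∧
    (∀ (X : FinGSet G) (a : A.obj X), d X (ι.app X a) = 0) ∧
    ∀ {X Y : FinGSet G} (f : X →[G] Y) (hf : O.Adm f) (s : S.obj X), d Y (S.nm f hf s) =
      M.tr f (S.nm (offSnd f) (IndexingSystem.adm_offSnd hf) (S.res (offFst f) s) • d X s)}
  zero_mem' := ⟨zero_mem _, fun _ _ => rfl, fun f hf s => by simp⟩
  add_mem' {d e} hd he := by
    refine ⟨add_mem hd.1 he.1, fun X a => ?_, fun f hf s => ?_⟩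
    · simp only [Pi.add_apply, AddMonoidHom.add_apply, hd.2.1, he.2.1, add_zero]
    · simp only [Pi.add_apply, AddMonoidHom.add_apply, hd.2.2, he.2.2, smul_add, map_add]
  neg_mem' {d} hd := by
    refine ⟨neg_mem hd.1, fun X a => ?_, fun f hf s => ?_⟩
    · simp only [Pi.neg_apply, AddMonoidHom.neg_apply, hd.2.1, neg_zero]
    · simp only [Pi.neg_apply, AddMonoidHom.neg_apply, hd.2.2, smul_neg, map_neg]

namespace OTambara

open IndexingSystem BoxObj

variable {G : Type u} [Group G] [Finite G] {O : IndexingSystem G}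

variable {A : OTambara.{u, t} O} {B : OTambara.{u, v} O} {C : OTambara.{u, w} O}

/-- The ring homomorphism `b ↦ b ⊗ 1`. -/
noncomputable def BoxObj.leftHom (ι : OTambaraHom A B) (κ : OTambaraHom A C) (X : FinGSet G) :
    B.obj X →+* BoxObj ι κ X :=
  RingHom.mk'
    { toFun := fun b => BoxObj.mk ι κ (MulActionHom.id G) b 1
      map_one' := rfl
      map_mul' := fun b b' => by
        rw [mk_mul (isPb_id_left (MulActionHom.id G)) (r := MulActionHom.id G) fun _ => rfl]
        simp only [B.res_id, map_one, mul_one] }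
    fun b b' => by
      change BoxObj.mk ι κ _ (b + b') 1 = BoxObj.mk ι κ _ b 1 + BoxObj.mk ι κ _ b' 1
      rw [mk_add]
      symm
      refine mk_left (desc (MulActionHom.id G) (MulActionHom.id G)) (fun _ => rfl) ?_ ?_
      · rw [tr_pair]
        change b + b' = B.tr (MulActionHom.id G) b + B.tr (MulActionHom.id G) b'
        rw [B.tr_id, B.tr_id]
      · rw [res_desc, C.res_id]

/-- The ring homomorphism `c ↦ 1 ⊗ c`. -/
noncomputable def BoxObj.rightHom (ι : OTambaraHom A B) (κ : OTambaraHom A C) (X : FinGSet G) :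
    C.obj X →+* BoxObj ι κ X :=
  RingHom.mk'
    { toFun := fun c => BoxObj.mk ι κ (MulActionHom.id G) 1 c
      map_one' := rfl
      map_mul' := fun c c' => by
        rw [mk_mul (isPb_id_left (MulActionHom.id G)) (r := MulActionHom.id G) fun _ => rfl]
        simp only [C.res_id, B.res_id, mul_one] }
    fun c c' => by
      change BoxObj.mk ι κ _ 1 (c + c') = BoxObj.mk ι κ _ 1 c + BoxObj.mk ι κ _ 1 c'
      rw [mk_add]
      symm
      refine mk_right (desc (MulActionHom.id G) (MulActionHom.id G)) (fun _ => rfl) ?_ ?_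
      · rw [res_desc, B.res_id]
      · rw [tr_pair]
        change c + c' = C.tr (MulActionHom.id G) c + C.tr (MulActionHom.id G) c'
        rw [C.tr_id, C.tr_id]

/-- The inclusion `b ↦ b ⊗ 1` of the first factor. -/
noncomputable def inclLeft (ι : OTambaraHom A B) (κ : OTambaraHom A C) :
    OTambaraHom B (box ι κ) where
  app X := BoxObj.leftHom ι κ X
  app_res f b := by
    symm
    refine (res_apply (isPb_symm (isPb_id_left f))).trans ?_
    change BoxObj.mk ι κ (MulActionHom.id G) (B.res f b) (C.res f 1) = BoxObj.mk ι κ _ _ 1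
    rw [map_one]
  app_tr f b := by
    symm
    exact mk_left f (fun _ => rfl) rfl (map_one _).symm
  app_nm f hf b := by
    symm
    refine (nm_apply hf b 1 (isExp_tr_id f) hf).trans ?_
    change BoxObj.mk ι κ _ _ _ = BoxObj.mk ι κ (MulActionHom.id G) _ 1
    rw [B.res_id, map_one, map_one]

/-- The inclusion `c ↦ 1 ⊗ c` of the second factor. -/
noncomputable def inclRight (ι : OTambaraHom A B) (κ : OTambaraHom A C) :
    OTambaraHom C (box ι κ) where
  app X := BoxObj.rightHom ι κ X
  app_res f c := by
    symm
    refine (res_apply (isPb_symm (isPb_id_left f))).trans ?_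
    change BoxObj.mk ι κ (MulActionHom.id G) (B.res f 1) (C.res f c) = BoxObj.mk ι κ _ 1 _
    rw [map_one]
  app_tr f c := by
    symm
    exact mk_right f (fun _ => rfl) (map_one _).symm rfl
  app_nm f hf c := by
    symm
    refine (nm_apply hf 1 c (isExp_tr_id f) hf).trans ?_
    change BoxObj.mk ι κ _ _ _ = BoxObj.mk ι κ (MulActionHom.id G) 1 _
    rw [C.res_id, map_one, map_one]

variable (ι : OTambaraHom A B)

/-- The map `T_p(b ⊗ b') ↦ T_p(b b')` on underlying sets. -/
def muFun (X : FinGSet G) : BoxObj ι ι X → B.obj X :=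
  Quot.lift (fun x => B.tr x.p (x.fst * x.snd))
    (rel_cases
      (fun r q b c => by
        change B.tr (q.comp r) (b * B.res r c) = B.tr q (B.tr r b * c)
        rw [B.tr_comp, B.tr_mul])
      (fun r q b c => by
        change B.tr (q.comp r) (B.res r b * c) = B.tr q (b * B.tr r c)
        rw [B.tr_comp, B.mul_tr])
      fun q a b c => by
        change B.tr q (ι.app _ a * b * c) = B.tr q (b * (ι.app _ a * c))
        congr 1
        ring)

/-- The multiplication `μ : B ⊠_A B → B`, `T_p(b ⊗ b') ↦ T_p(b b')`. -/
noncomputable def mu : OTambaraHom (box ι ι) B where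
  app X := RingHom.mk'
    { toFun := muFun ι X
      map_one' := by
        change B.tr (MulActionHom.id G) (1 * 1) = 1
        rw [B.tr_id, one_mul]
      map_mul' := fun x y => by
        induction x using BoxObj.ind with | _ U p b c
        induction y using BoxObj.ind with | _ V q b' c'
        have h := isPb_pb p q
        change muFun ι X (BoxObj.mk ι ι p b c * BoxObj.mk ι ι q b' c') =
          B.tr p (b * c) * B.tr q (b' * c')
        rw [mk_mul h (r := p.comp (pbFst p q)) fun _ => rfl, B.tr_mul, B.res_tr (isPb_symm h), B.mul_tr,
          ← B.tr_comp]
        change B.tr _ _ = _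
        congr 1
        simp only [map_mul]
        ring }
    fun x y => by
      induction x using BoxObj.ind with | _ U p b c
      induction y using BoxObj.ind with | _ V q b' c'
      change B.tr (desc p q) (B.pair b b' * B.pair c c') = B.tr p (b * c) + B.tr q (b' * c')
      rw [← pair_mul, tr_pair]
      rfl
  app_res f x := by
    induction x using BoxObj.ind with | _ U p b c
    have h := isPb_pb f p
    change muFun ι _ (BoxObj.res ι ι f (BoxObj.mk ι ι p b c)) = B.res f (B.tr p (b * c))
    rw [res_apply h, B.res_tr (isPb_symm h), map_mul]
    rfl
  app_tr f x := by
    induction x using BoxObj.ind with | _ U p b c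
    change B.tr (f.comp p) (b * c) = B.tr f (B.tr p (b * c))
    rw [B.tr_comp]
  app_nm f hf x := by
    induction x using BoxObj.ind with | _ U p b c
    have H := isExp_pi p f
    have hg := adm_pb H.isPb hf
    change muFun ι _ (BoxObj.nm ι ι f hf (BoxObj.mk ι ι p b c)) = B.nm f hf (B.tr p (b * c))
    rw [nm_apply hf b c H hg, B.nm_tr H hf hg, map_mul, map_mul]
    rfl

/-- The kernel `I` of `μ`. -/
noncomputable def diffIdeal : TambaraIdeal (box ι ι) := ker (mu ι)

/-- The group `Ω(X) = I(X) / I^{>1}(X)`. -/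
noncomputable abbrev OmegaObj (X : FinGSet G) : Type (max (u + 1) v) :=
  (diffIdeal ι).carrier X ⧸
    ((diffIdeal ι).gtOne.carrier X).submoduleOf ((diffIdeal ι).carrier X)

/-- The class in `Ω` of an element of `I`. -/
noncomputable def OmegaObj.mk {X : FinGSet G} (i : (box ι ι).obj X) (hi : i ∈ (diffIdeal ι).carrier X) :
    OmegaObj ι X :=
  Submodule.Quotient.mk ⟨i, hi⟩

variable {ι} in
theorem OmegaObj.ind {X : FinGSet G} {P : OmegaObj ι X → Prop}
    (h : ∀ i hi, P (OmegaObj.mk ι i hi)) (x) : P x := by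
  obtain ⟨⟨i, hi⟩, rfl⟩ := Submodule.Quotient.mk_surjective _ x
  exact h i hi

variable {ι} in
theorem OmegaObj.mk_eq {X : FinGSet G} {i j : (box ι ι).obj X} {hi hj} :
    OmegaObj.mk ι i hi = OmegaObj.mk ι j hj ↔ i - j ∈ (diffIdeal ι).gtOne.carrier X :=
  Submodule.Quotient.eq _

/-- An additive map preserving `I` and `I^{>1}` induces a map of quotients. -/
noncomputable def OmegaObj.map {X Y : FinGSet G} (φ : (box ι ι).obj X →+ (box ι ι).obj Y)
    (h1 : ∀ i ∈ (diffIdeal ι).carrier X, φ i ∈ (diffIdeal ι).carrier Y)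
    (h2 : ∀ i ∈ (diffIdeal ι).gtOne.carrier X, φ i ∈ (diffIdeal ι).gtOne.carrier Y) :
    OmegaObj ι X →+ OmegaObj ι Y :=
  QuotientAddGroup.map
    (((diffIdeal ι).gtOne.carrier X).submoduleOf ((diffIdeal ι).carrier X)).toAddSubgroup
    (((diffIdeal ι).gtOne.carrier Y).submoduleOf ((diffIdeal ι).carrier Y)).toAddSubgroup
    { toFun := fun i => ⟨φ i.1, h1 i.1 i.2⟩
      map_zero' := Subtype.ext (map_zero φ)
      map_add' := fun i j => Subtype.ext (map_add φ i.1 j.1) }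
    fun i hi => h2 i.1 hi

/-- `B` acts on `Ω` through `b ↦ b ⊗ 1`. -/
noncomputable instance OmegaObj.module (X : FinGSet G) : Module (B.obj X) (OmegaObj ι X) :=
  Module.compHom _ ((inclLeft ι ι).app X)

theorem OmegaObj.smul_mk {X : FinGSet G} (b : B.obj X) (i : (box ι ι).obj X) (hi) :
    b • OmegaObj.mk ι i hi = OmegaObj.mk ι ((inclLeft ι ι).app X b * i)
      (Ideal.mul_mem_left _ _ hi) := rfl

/-- The module of Kähler differentials `Ω = I / I^{>1}`. -/
noncomputable def Omega : TModule.{u, v, max (u + 1) v} B where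
  obj X := OmegaObj ι X
  res f := OmegaObj.map ι ((box ι ι).res f).toAddMonoidHom ((diffIdeal ι).res_mem f)
    ((diffIdeal ι).gtOne.res_mem f)
  tr f := OmegaObj.map ι ((box ι ι).tr f) ((diffIdeal ι).tr_mem f) ((diffIdeal ι).gtOne.tr_mem f)
  res_id x := by
    induction x using OmegaObj.ind with | _ i hi
    exact congrArg Submodule.Quotient.mk (Subtype.ext ((box ι ι).res_id i))
  res_comp g f x := by
    induction x using OmegaObj.ind with | _ i hi
    exact congrArg Submodule.Quotient.mk (Subtype.ext ((box ι ι).res_comp g f i))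
  tr_id x := by
    induction x using OmegaObj.ind with | _ i hi
    exact congrArg Submodule.Quotient.mk (Subtype.ext ((box ι ι).tr_id i))
  tr_comp g f x := by
    induction x using OmegaObj.ind with | _ i hi
    exact congrArg Submodule.Quotient.mk (Subtype.ext ((box ι ι).tr_comp g f i))
  res_tr h x := by
    induction x using OmegaObj.ind with | _ i hi
    exact congrArg Submodule.Quotient.mk (Subtype.ext ((box ι ι).res_tr h i))
  obj_sum X Y := by
    constructor
    · intro x y h
      induction x using OmegaObj.ind with | _ i hi
      induction y using OmegaObj.ind with | _ j hj
      have h1 := OmegaObj.mk_eq.1 (congrArg Prod.fst h)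
      have h2 := OmegaObj.mk_eq.1 (congrArg Prod.snd h)
      refine OmegaObj.mk_eq.2 (TambaraIdeal.mem_of_sum _ ?_ ?_)
      · rw [map_sub]; exact h1
      · rw [map_sub]; exact h2
    · rintro ⟨x, y⟩
      induction x using OmegaObj.ind with | _ i hi
      induction y using OmegaObj.ind with | _ j hj
      refine ⟨OmegaObj.mk ι ((box ι ι).pair i j) (TambaraIdeal.mem_of_sum _ ?_ ?_),
        Prod.ext ?_ ?_⟩
      · rwa [res_inl_pair]
      · rwa [res_inr_pair]
      · exact congrArg Submodule.Quotient.mk (Subtype.ext ((box ι ι).res_inl_pair i j))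
      · exact congrArg Submodule.Quotient.mk (Subtype.ext ((box ι ι).res_inr_pair i j))
  obj_empty := by
    have := (box ι ι).obj_empty
    refine ⟨fun x y => ?_⟩
    induction x using OmegaObj.ind with | _ i hi
    induction y using OmegaObj.ind with | _ j hj
    exact congrArg Submodule.Quotient.mk (Subtype.ext (Subsingleton.elim i j))
  res_smul f s x := by
    induction x using OmegaObj.ind with | _ i hi
    refine congrArg Submodule.Quotient.mk (Subtype.ext ?_)
    change (box ι ι).res f ((inclLeft ι ι).app _ s * i) =
      (inclLeft ι ι).app _ (B.res f s) * (box ι ι).res f i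
    rw [map_mul, (inclLeft ι ι).app_res]
  smul_tr f s x := by
    induction x using OmegaObj.ind with | _ i hi
    refine congrArg Submodule.Quotient.mk (Subtype.ext ?_)
    change (inclLeft ι ι).app _ s * (box ι ι).tr f i =
      (box ι ι).tr f ((inclLeft ι ι).app _ (B.res f s) * i)
    rw [(box ι ι).mul_tr, (inclLeft ι ι).app_res]
  tr_smul f s x := by
    induction x using OmegaObj.ind with | _ i hi
    refine congrArg Submodule.Quotient.mk (Subtype.ext ?_)
    change (inclLeft ι ι).app _ (B.tr f s) * i =
      (box ι ι).tr f ((inclLeft ι ι).app _ s * (box ι ι).res f i)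
    rw [(inclLeft ι ι).app_tr, (box ι ι).tr_mul]

theorem diff_mem {X : FinGSet G} (b : B.obj X) :
    (inclRight ι ι).app X b - (inclLeft ι ι).app X b ∈ (diffIdeal ι).carrier X := by
  change (mu ι).app X _ = 0
  rw [map_sub]
  change B.tr (MulActionHom.id G) (1 * b) - B.tr (MulActionHom.id G) (b * 1) = 0
  rw [mul_one, one_mul, sub_self]

/-- The map `δ : B → Ω`, `b ↦ 1 ⊗ b - b ⊗ 1`. -/
noncomputable def delta (X : FinGSet G) (b : B.obj X) : (Omega ι).obj X :=
  OmegaObj.mk ι ((inclRight ι ι).app X b - (inclLeft ι ι).app X b) (diff_mem ι b)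

end OTambara

/-! The argument follows the classical proof that `I / I²` represents derivations, with products
replaced by norms. Three facts carry it.

(1) `δ` is a genuine derivation. The norm of a sum is a sum over subsets of the fibres: by Tambara
reciprocity for the fold map, `N_f(a + b)` is the transfer, over pairs `(y, C)` with `C ⊆ f⁻¹(y)`,
of the norm of `a` over the points outside `C` times the norm of `b` over the points of `C`
(`nm_add`). The part `C = ∅` is `N_f(a)`. The part `C = {x}` is `T_f(N_{π₂} R_{π₁}(a) · b)`. The
part where `C` has at least two points is a transfer of multiples of norms of `b` along a
2-surjective map, hence lies in `I^{>1}` when `b ∈ I` (`nm_add_sub_mem`). With `a = s ⊗ 1` and `b =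
1 ⊗ s - s ⊗ 1` this is the norm formula for `δ`.

(2) `h ↦ h ∘ δ` is injective. Every element of the box product has the form `T_p(b ⊗ c)`. If it lies
in `I`, then `T_p(bc) = 0`, so it equals `T_p((b ⊗ 1)(1 ⊗ c - c ⊗ 1))`. Thus every element of `Ω` is
some `T_p(b · δ(c))` (`exists_omega_eq`), on which `h` is determined by `h ∘ δ`.

(3) `h ↦ h ∘ δ` is surjective. The norm formula along the fold map gives the Leibniz rule, which
makes `D : T_p(b ⊗ c) ↦ T_p(b · d(c))` well defined on the box product. This `D` is a derivation
along `μ`: it satisfies `D(xy) = μ(x) D(y) + μ(y) D(x)` (`boxMap_mul`) and `D(N_f x) = T_f(N_{π₂}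
R_{π₁}(μ x) · D(x))` (`boxMap_nm`). The second formula compares sections of `p` through a given
point with sections over the remaining points of the fibre (`isExp_away`). The common zeros of `μ`
and `D` therefore form a Tambara ideal. It contains `N_f(i)` for `i ∈ I` and `f` 2-surjective,
because `π₂` is then surjective and the norm of `0` along a surjection is `0`. So `D` kills `I^{>1}`
and descends to `Ω`, where it satisfies `D ∘ δ = d`. -/

/-! ### Diagonals, empty transfers and 2-surjective maps -/

namespace FinGSet

variable {G : Type u} [Group G]

/-- The diagonal of the fibre square. -/
def pbDiag {X Y : FinGSet G} (f : X →[G] Y) : X →[G] pb f f :=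
  pbLift f f (MulActionHom.id G) (MulActionHom.id G) fun _ => rfl

/-- The inclusion of the complement of the diagonal. -/
def offIncl {X Y : FinGSet G} (f : X →[G] Y) : offDiag f →[G] pb f f :=
  ⟨fun z => z.1, fun _ _ => rfl⟩

/-- Lets a norm along the second projection of `X ×_Y X` factor into an identity norm on the
diagonal and the norm along `π₂` on its complement. -/
theorem desc_diag_bijective {X Y : FinGSet G} (f : X →[G] Y) :
    Function.Bijective (desc (pbDiag f) (offIncl f)) := by
  constructor
  · rintro (x | x) (y | y) h
    · exact congrArg Sum.inl (congrArg (pbFst f f) h)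
    · exact (y.2 ((congrArg (pbFst f f) h).symm.trans (congrArg (pbSnd f f) h))).elim
    · exact (x.2 ((congrArg (pbFst f f) h).trans (congrArg (pbSnd f f) h).symm)).elim
    · exact congrArg Sum.inr (Subtype.ext h)
  · rintro ⟨⟨x, y⟩, h⟩
    by_cases hxy : x = y
    · subst hxy
      exact ⟨Sum.inl x, rfl⟩
    · exact ⟨Sum.inr ⟨⟨(x, y), h⟩, hxy⟩, rfl⟩

/-- The exponential diagram of an empty transfer along a surjective map. -/
theorem isExp_ofEmpty {X Y : FinGSet G} {f : X →[G] Y} (hf : Function.Surjective f) :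
    IsExp (ofEmpty X) f (MulActionHom.id G) (MulActionHom.id G) (ofEmpty Y) := by
  refine IsExp.mk' (fun e => isEmptyElim e) (fun _ d => isEmptyElim d) (fun e => isEmptyElim e)
    ?_ fun d => isEmptyElim d
  -- A section over a nonempty fibre would have a value in the empty set, so there is none and `∏_f
  -- ∅` is empty.
  intro y s
  obtain ⟨x, hx⟩ := hf y
  exact isEmptyElim (s ⟨x, hx⟩)

theorem TwoSurj.surjective {X Y : FinGSet G} {f : X →[G] Y} (hf : TwoSurj f) :
    Function.Surjective f := by
  intro y
  obtain ⟨x, hx⟩ := Set.nonempty_of_ncard_ne_zero (s := f ⁻¹' {y}) (by have := hf y; omega)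
  exact ⟨x, hx⟩

/-- Besides `x` its fibre contains another point `x'`, and `(x', x)` lies over `x`. This makes the
coefficient `N_{π₂}(0)` in the norm formula vanish. -/
theorem TwoSurj.offSnd_surjective {X Y : FinGSet G} {f : X →[G] Y} (hf : TwoSurj f) :
    Function.Surjective (offSnd f) := by
  intro x
  obtain ⟨x', hx', hne⟩ := Set.exists_ne_of_one_lt_ncard (s := f ⁻¹' {f x}) (hf (f x)) x
  exact ⟨⟨⟨(x', x), hx'⟩, hne⟩, rfl⟩

end FinGSet

/-! ### Additivity of transfers in Mackey functors -/

namespace MackeyFunctor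

variable {G : Type u} [Group G] [Finite G] (M : MackeyFunctor.{u, v} G)

theorem res_res {X Y Z : FinGSet G} {f : X →[G] Y} {g : Y →[G] Z} {k : X →[G] Z}
    (h : ∀ x, g (f x) = k x) (a : M.obj Z) : M.res f (M.res g a) = M.res k a := by
  rw [← M.res_comp, show g.comp f = k from MulActionHom.ext h]

theorem tr_ofEmpty (X : FinGSet G) (a : M.obj (FinGSet.empty G)) :
    M.tr (ofEmpty X) a = 0 := by
  have := M.obj_empty
  rw [Subsingleton.elim a 0, map_zero]

/-- Both sides have the same restrictions to the two summands: the mixed terms are transfers from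
the empty set, which is the pullback of the two inclusions. -/
theorem tr_inl_add {X Y : FinGSet G} (a : M.obj (X.sum Y)) :
    M.tr (inl X Y) (M.res (inl X Y) a) + M.tr (inr X Y) (M.res (inr X Y) a) = a := by
  apply (M.obj_sum X Y).1
  refine Prod.ext ?_ ?_
  · change M.res (inl X Y) _ = M.res (inl X Y) a
    rw [map_add, M.res_tr (OTambara.isPb_inl_inl X Y), M.res_tr (OTambara.isPb_inr_inl X Y),
      tr_ofEmpty, M.tr_id, M.res_id, add_zero]
  · change M.res (inr X Y) _ = M.res (inr X Y) a
    rw [map_add, M.res_tr (OTambara.isPb_inr_inr X Y), M.res_tr (OTambara.isPb_inl_inr X Y),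
      tr_ofEmpty, M.tr_id, M.res_id, zero_add]

theorem tr_sum {X Y Z : FinGSet G} (f : X.sum Y →[G] Z) (a : M.obj (X.sum Y)) :
    M.tr f a = M.tr (f.comp (inl X Y)) (M.res (inl X Y) a) +
      M.tr (f.comp (inr X Y)) (M.res (inr X Y) a) := by
  rw [M.tr_comp, M.tr_comp, ← map_add, tr_inl_add]

/-- For bijective `e`, the square with two sides `e` and two identities is a pullback; this is its
double coset formula. -/
theorem tr_res {X Y : FinGSet G} (e : X →[G] Y) (he : Function.Bijective e) (a : M.obj Y) :
    M.tr e (M.res e a) = a := by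
  have h : IsPb e e (MulActionHom.id G) (MulActionHom.id G) :=
    ⟨fun _ => rfl, fun x y hxy => by
      obtain ⟨z, hz⟩ := he.2 x
      exact ⟨z, ⟨hz, hz.trans hxy⟩, fun z' hz' => he.1 (hz'.1.trans hz.symm)⟩⟩
  have := M.res_tr h a
  rw [M.res_id, M.tr_id] at this
  exact this.symm

/-- Transfers out of a set decomposed into two parts. -/
theorem tr_decomp {U V X Z : FinGSet G} {i : U →[G] X} {j : V →[G] X}
    (h : Function.Bijective (desc i j)) (f : X →[G] Z) (a : M.obj X) :
    M.tr f a = M.tr (f.comp i) (M.res i a) + M.tr (f.comp j) (M.res j a) := by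
  conv_lhs => rw [← M.tr_res _ h a]
  rw [← M.tr_comp, tr_sum, M.res_res (k := i) fun _ => rfl, M.res_res (k := j) fun _ => rfl]
  rfl

end MackeyFunctor

/-! ### Norms out of disjoint unions and norms of zero -/

namespace OTambara

open IndexingSystem

variable {G : Type u} [Group G] [Finite G] {O : IndexingSystem G} (S : OTambara.{u, v} O)

theorem adm_id (X : FinGSet G) : O.Adm (MulActionHom.id G : X →[G] X) :=
  adm_of_injective fun _ _ h => h

theorem adm_inl (X Y : FinGSet G) : O.Adm (inl X Y) := adm_of_injective Sum.inl_injective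

theorem adm_inr (X Y : FinGSet G) : O.Adm (inr X Y) := adm_of_injective Sum.inr_injective

theorem adm_ofEmpty (X : FinGSet G) : O.Adm (ofEmpty X) := fun x => isEmptyElim x

/-- Over the empty set all elements agree; calling them `1` lets multiplicativity evaluate norms
along `ofEmpty`, which are empty products. -/
theorem obj_empty_eq_one (a : S.obj (FinGSet.empty G)) : a = 1 := by
  have := S.obj_empty
  exact Subsingleton.elim _ _

/-- Over the second summand the fibres of `inl` are empty, and an empty norm is `1`. -/
theorem nm_inl {X Y : FinGSet G} (a : S.obj X) : S.nm (inl X Y) (adm_inl X Y) a = S.pair a 1 := by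
  apply S.sum_ext
  · rw [res_inl_pair, S.res_nm (isPb_inl_inl X Y) _ (adm_id _), S.nm_id, S.res_id]
  · rw [res_inr_pair, S.res_nm (isPb_inl_inr X Y) _ (adm_ofEmpty _), S.obj_empty_eq_one (S.res _ a),
      map_one]

theorem nm_inr {X Y : FinGSet G} (b : S.obj Y) : S.nm (inr X Y) (adm_inr X Y) b = S.pair 1 b := by
  apply S.sum_ext
  · rw [res_inl_pair, S.res_nm (isPb_inr_inl X Y) _ (adm_ofEmpty _), S.obj_empty_eq_one (S.res _ b),
      map_one]
  · rw [res_inr_pair, S.res_nm (isPb_inr_inr X Y) _ (adm_id _), S.nm_id, S.res_id]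

/-- The norm along a map out of a disjoint union is a product of norms. -/
theorem nm_pair {X Y Z : FinGSet G} (f : X.sum Y →[G] Z) (hf : O.Adm f) (a : S.obj X)
    (b : S.obj Y) : S.nm f hf (S.pair a b) =
      S.nm (f.comp (inl X Y)) (adm_comp (adm_inl X Y) hf) a *
        S.nm (f.comp (inr X Y)) (adm_comp (adm_inr X Y) hf) b := by
  rw [S.nm_comp f (inl X Y) hf (adm_inl X Y), S.nm_comp f (inr X Y) hf (adm_inr X Y), ← map_mul,
    nm_inl, nm_inr, ← pair_mul, mul_one, one_mul]

/-- Norms out of a set decomposed into two parts. -/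
theorem nm_decomp {U V X Z : FinGSet G} {i : U →[G] X} {j : V →[G] X}
    (h : Function.Bijective (desc i j)) (f : X →[G] Z) (hf : O.Adm f) {fi : U →[G] Z}
    {fj : V →[G] Z} (hfi : O.Adm fi) (hfj : O.Adm fj) (hi : ∀ x, f (i x) = fi x)
    (hj : ∀ x, f (j x) = fj x) (a : S.obj X) :
    S.nm f hf a = S.nm fi hfi (S.res i a) * S.nm fj hfj (S.res j a) := by
  obtain rfl : f.comp i = fi := MulActionHom.ext hi
  obtain rfl : f.comp j = fj := MulActionHom.ext hj
  have hd : O.Adm (f.comp (desc i j)) := adm_comp (adm_of_injective h.1) hf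
  have := S.nm_res_of_iso hf hd (desc i j) (MulActionHom.id G) h Function.bijective_id
    (fun _ => rfl) a
  rw [S.res_id, res_desc, nm_pair] at this
  exact this.symm

/-- The norm of `0` along a surjective map vanishes. -/
theorem nm_zero {X Y : FinGSet G} {f : X →[G] Y} (hf : O.Adm f) (hs : Function.Surjective f) :
    S.nm f hf 0 = 0 := by
  -- `0` is a transfer from the empty set, so reciprocity makes its norm a transfer from `∏_f ∅`,
  -- which is empty.
  have := S.nm_tr (isExp_ofEmpty hs) hf (adm_id _) 0
  rwa [tr_ofEmpty, tr_ofEmpty] at this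

/-- Restricting a norm along the same map splits off the diagonal. -/
theorem res_nm_self {X Y : FinGSet G} (f : X →[G] Y) (hf : O.Adm f) (a : S.obj X) :
    S.res f (S.nm f hf a) = a * S.nm (offSnd f) (adm_offSnd hf) (S.res (offFst f) a) := by
  rw [S.res_nm (isPb_pb f f) hf (adm_pb (isPb_pb f f) hf),
    S.nm_decomp (desc_diag_bijective f) _ _ (adm_id X) (adm_offSnd hf) (fun _ => rfl)
      fun _ => rfl, S.nm_id, S.res_res (k := MulActionHom.id G) fun _ => rfl, S.res_id,
    S.res_res (k := offFst f) fun _ => rfl]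

end OTambara

/-! ### Subsets of fibres and the exponential diagram of the fold map -/

namespace FinGSet

variable {G : Type u} [Group G]

open scoped Pointwise in
/-- Pairs `(y, C)` of a point `y` of `Y` and a subset `C` of the fibre `f⁻¹(y)`. -/
def fibSub {X Y : FinGSet G} (f : X →[G] Y) : FinGSet G :=
  sub (prod Y ⟨Set X⟩) (fun z : Y × Set X => ∀ x ∈ z.2, f x = z.1) fun m z hz => by
    intro x (hx : x ∈ m • z.2)
    rw [Set.mem_smul_set_iff_inv_smul_mem] at hx
    have := hz _ hx
    rw [map_smul, inv_smul_eq_iff] at this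
    exact this

variable {X Y : FinGSet G} (f : X →[G] Y)

open scoped Pointwise in
/-- Triples `(x, y, C)` with `f x = y` and `x ∉ C ⊆ f⁻¹(y)`. -/
def outPts : FinGSet G :=
  sub (prod X (fibSub f)) (fun z => f z.1 = z.2.1.1 ∧ z.1 ∉ z.2.1.2) fun m z hz => by
    refine ⟨(map_smul f m z.1).trans (congrArg (m • ·) hz.1), fun h => hz.2 ?_⟩
    change m • z.1 ∈ m • z.2.1.2 at h
    rwa [Set.smul_mem_smul_set_iff] at h

open scoped Pointwise in
/-- Triples `(x, y, C)` with `x ∈ C ⊆ f⁻¹(y)`. -/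
def inPts : FinGSet G :=
  sub (prod X (fibSub f)) (fun z => z.1 ∈ z.2.1.2)
    fun m z (hz : z.1 ∈ z.2.1.2) => (Set.smul_mem_smul_set hz : m • z.1 ∈ m • z.2.1.2)

/-- The projection `(y, C) ↦ y`. -/
def fibSubProj : fibSub f →[G] Y := ⟨fun z => z.1.1, fun _ _ => rfl⟩

/-- The projection `(x, y, C) ↦ x` for `x ∉ C`. -/
def outPt : outPts f →[G] X := ⟨fun z => z.1.1, fun _ _ => rfl⟩

/-- The projection `(x, y, C) ↦ (y, C)` for `x ∉ C`. -/
def outSet : outPts f →[G] fibSub f := ⟨fun z => z.1.2, fun _ _ => rfl⟩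

/-- The projection `(x, y, C) ↦ x` for `x ∈ C`. -/
def inPt : inPts f →[G] X := ⟨fun z => z.1.1, fun _ _ => rfl⟩

/-- The projection `(x, y, C) ↦ (y, C)` for `x ∈ C`. -/
def inSet : inPts f →[G] fibSub f := ⟨fun z => z.1.2, fun _ _ => rfl⟩

/-- The fold map. -/
def fold (X : FinGSet G) : X.sum X →[G] X := desc (MulActionHom.id G) (MulActionHom.id G)

/-- The exponential diagram of the fold map of `X` along `f`. -/
theorem isExp_fold : IsExp (fold X) f (OTambara.sumMap (outPt f) (inPt f))
    (desc (outSet f) (inSet f)) (fibSubProj f) := by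
  -- A section of the fold map over `f⁻¹(y)` chooses one of the two copies of each point. The set
  -- `C` records the points where the second copy is chosen; `outPts` and `inPts` are the parts of
  -- the evaluation with values in the first and the second copy.
  refine IsExp.mk' ?_ ?_ ?_ ?_ ?_
  · rintro (e | e)
    · exact e.2.1
    · exact e.1.2.2 _ e.2
  · intro x d hd
    by_cases hx : x ∈ d.1.2
    · exact ⟨Sum.inr ⟨(x, d), hx⟩, rfl, rfl⟩
    · exact ⟨Sum.inl ⟨(x, d), hd, hx⟩, rfl, rfl⟩
  · rintro (⟨⟨x, d⟩, h1, h2⟩ | ⟨⟨x, d⟩, h⟩) (⟨⟨x', d'⟩, h1', h2'⟩ | ⟨⟨x', d'⟩, h'⟩)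
      (hx : x = x') (hd : d = d') <;> subst hx hd
    · rfl
    · exact (h2 h').elim
    · exact (h2' h).elim
    · rfl
  · intro y s hs
    have key : ∀ x, s x = Sum.inl x.1 ∨ s x = Sum.inr x.1 := by
      intro x
      have hsx := hs x
      rcases h : (s x : X ⊕ X) with z | z
      · rw [h] at hsx
        exact Or.inl (congrArg Sum.inl hsx)
      · rw [h] at hsx
        exact Or.inr (congrArg Sum.inr hsx)
    refine ⟨⟨(y, {x | ∃ h : f x = y, s ⟨x, h⟩ = Sum.inr x}), fun x hx => hx.1⟩, rfl, ?_⟩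
    rintro (⟨⟨z, d⟩, h1, h2⟩ | ⟨⟨z, d⟩, h⟩) (rfl : d = _) ⟨x, hxy⟩ (hx : z = x) <;> subst hx
    · rcases key ⟨z, hxy⟩ with h | h
      · exact h.symm
      · exact (h2 ⟨hxy, h⟩).elim
    · obtain ⟨h, h'⟩ := h
      exact h'.symm
  · rintro ⟨⟨y, C⟩, h⟩ ⟨⟨y', C'⟩, h'⟩ (hy : y = y') hs
    subst hy
    -- A point in only one of `C`, `C'` would be evaluated in different copies of `X` by the two
    -- sections.
    have hC : C = C' := by
      ext x
      constructor
      · intro hx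
        by_contra hx'
        exact Sum.inr_ne_inl (hs (Sum.inr ⟨(x, ⟨(y, C), h⟩), hx⟩)
          (Sum.inl ⟨(x, ⟨(y, C'), h'⟩), h x hx, hx'⟩) rfl rfl rfl)
      · intro hx
        by_contra hx'
        exact Sum.inl_ne_inr (hs (Sum.inl ⟨(x, ⟨(y, C), h⟩), h' x hx, hx'⟩)
          (Sum.inr ⟨(x, ⟨(y, C'), h'⟩), hx⟩) rfl rfl rfl)
    subst hC
    rfl

open scoped Pointwise in
/-- The inclusion `y ↦ (y, ∅)`. -/
def emptySub : Y →[G] fibSub f :=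
  ⟨fun y => ⟨(y, ∅), fun _ hx => hx.elim⟩,
    fun m y => Subtype.ext (Prod.ext rfl (Set.smul_set_empty (a := m)).symm)⟩

open scoped Pointwise in
/-- The inclusion `x ↦ (f x, {x})`. -/
def singleSub : X →[G] fibSub f :=
  ⟨fun x => ⟨(f x, {x}), fun _ hx => congrArg f hx⟩,
    fun m x => Subtype.ext (Prod.ext (map_smul f m x) (Set.smul_set_singleton (a := m)).symm)⟩

open scoped Pointwise in
/-- The pairs `(y, C)` such that `C` has at least two elements. -/
def bigSub : FinGSet G :=
  sub (fibSub f) (fun z => 2 ≤ z.1.2.ncard) fun m z hz => by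
    change 2 ≤ (m • z.1.2).ncard
    rwa [← Set.image_smul, Set.ncard_image_of_injective _ (MulAction.injective m)]

/-- The inclusion of the pairs `(y, C)` such that `C` has at least two elements. -/
def bigIncl : bigSub f →[G] fibSub f := ⟨fun z => z.1, fun _ _ => rfl⟩

/-- A subset of a finite fibre has no, one, or at least two elements. These three cases index the
constant, linear and higher terms in the expansion of `N_f(a + b)`. -/
theorem desc_fibSub_bijective :
    Function.Bijective (desc (emptySub f) (desc (singleSub f) (bigIncl f))) := by
  have h0 : ∀ y, (emptySub f y).1.2.ncard = 0 := fun y => Set.ncard_empty X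
  have h1 : ∀ x, (singleSub f x).1.2.ncard = 1 := fun x => Set.ncard_singleton x
  have h2 : ∀ z, 2 ≤ (bigIncl f z).1.2.ncard := fun z => z.2
  constructor
  · rintro (a | a | a) (b | b | b) h
    · exact congrArg Sum.inl (congrArg (fibSubProj f) h)
    · have h' : (emptySub f a).1.2 = (singleSub f b).1.2 := congrArg (fun z : fibSub f => z.1.2) h
      have := h0 a
      rw [h', h1] at this
      omega
    · have h' : (emptySub f a).1.2 = (bigIncl f b).1.2 := congrArg (fun z : fibSub f => z.1.2) h
      have := h2 b
      rw [← h', h0] at this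
      omega
    · have h' : (singleSub f a).1.2 = (emptySub f b).1.2 := congrArg (fun z : fibSub f => z.1.2) h
      have := h1 a
      rw [h', h0] at this
      omega
    · have h' : ({a} : Set X) = {b} := congrArg (fun z : fibSub f => z.1.2) h
      exact congrArg (fun z => Sum.inr (Sum.inl z)) (Set.singleton_injective h')
    · have h' : (singleSub f a).1.2 = (bigIncl f b).1.2 := congrArg (fun z : fibSub f => z.1.2) h
      have := h2 b
      rw [← h', h1] at this
      omega
    · have h' : (bigIncl f a).1.2 = (emptySub f b).1.2 := congrArg (fun z : fibSub f => z.1.2) h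
      have := h2 a
      rw [h', h0] at this
      omega
    · have h' : (bigIncl f a).1.2 = (singleSub f b).1.2 := congrArg (fun z : fibSub f => z.1.2) h
      have := h2 a
      rw [h', h1] at this
      omega
    · exact congrArg (fun z => Sum.inr (Sum.inr z)) (Subtype.ext h)
  · rintro ⟨⟨y, C⟩, h⟩
    rcases Nat.lt_or_ge C.ncard 2 with hC | hC
    · rcases Nat.lt_or_ge C.ncard 1 with hC' | hC'
      · obtain rfl := (Set.ncard_eq_zero (Set.toFinite C)).1 (by omega)
        exact ⟨Sum.inl y, rfl⟩
      · obtain ⟨x, rfl⟩ := Set.ncard_eq_one.1 (show C.ncard = 1 by omega)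
        obtain rfl : f x = y := h x rfl
        exact ⟨Sum.inr (Sum.inl x), rfl⟩
    · exact ⟨Sum.inr (Sum.inr ⟨⟨(y, C), h⟩, hC⟩), rfl⟩

/-- Over `C = ∅` the points outside `C` are the whole fibre of `f`, so the first factor of the term
indexed by `∅` is `N_f(a)`. -/
theorem exists_isPb_outSet_emptySub :
    ∃ a : X →[G] outPts f, (∀ x, outPt f (a x) = x) ∧ IsPb a f (outSet f) (emptySub f) := by
  refine ⟨⟨fun x => ⟨(x, emptySub f (f x)), rfl, fun h => h.elim⟩, fun m x => Subtype.ext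
    (Prod.ext rfl (by
      change emptySub f (f (m • x)) = m • emptySub f (f x)
      rw [map_smul, map_smul]))⟩, fun _ => rfl, IsPb.mk' (fun _ => rfl) ?_ ?_⟩
  · rintro ⟨⟨x, d⟩, h1, h2⟩ y (rfl : d = _)
    exact ⟨x, Subtype.ext (Prod.ext rfl (congrArg (emptySub f) h1)), h1⟩
  · exact fun x x' h _ => congrArg (outPt f) h

/-- The set `C = ∅` has no points, so the second factor of the term indexed by `∅` is an empty norm.
-/
theorem isPb_inSet_emptySub :
    IsPb (ofEmpty (inPts f)) (ofEmpty Y) (inSet f) (emptySub f) := by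
  refine IsPb.mk' (fun z => isEmptyElim z) ?_ fun z => isEmptyElim z
  rintro ⟨⟨x, d⟩, h⟩ y (rfl : d = _)
  exact h.elim

/-- Over `C = {x}` the points outside `C` are the `x' ≠ x` in the fibre of `x`, that is, the pairs
`(x', x)` off the diagonal. This is the origin of the coefficient `N_{π₂} R_{π₁}` in the definition
of a genuine derivation. -/
theorem exists_isPb_outSet_singleSub : ∃ a : offDiag f →[G] outPts f,
    (∀ x, outPt f (a x) = offFst f x) ∧ IsPb a (offSnd f) (outSet f) (singleSub f) := by
  refine ⟨⟨fun z => ⟨(z.1.1.1, singleSub f z.1.1.2), z.1.2, fun h => z.2 h⟩, fun m z => Subtype.ext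
    (Prod.ext rfl (map_smul (singleSub f) m _))⟩, fun _ => rfl, IsPb.mk' (fun _ => rfl) ?_ ?_⟩
  · rintro ⟨⟨x, d⟩, h1, h2⟩ y (rfl : d = _)
    exact ⟨⟨⟨(x, y), h1⟩, h2⟩, rfl, rfl⟩
  · exact fun x x' h h' => Subtype.ext (Subtype.ext (Prod.ext (congrArg (outPt f) h) h'))

/-- The only point of `C = {x}` is `x`, so the second factor of the linear term is `b` itself. -/
theorem exists_isPb_inSet_singleSub : ∃ a : X →[G] inPts f,
    (∀ x, inPt f (a x) = x) ∧ IsPb a (MulActionHom.id G) (inSet f) (singleSub f) := by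
  refine ⟨⟨fun x => ⟨(x, singleSub f x), rfl⟩, fun m x => Subtype.ext
    (Prod.ext rfl (map_smul (singleSub f) m x))⟩, fun _ => rfl, IsPb.mk' (fun _ => rfl) ?_ ?_⟩
  · rintro ⟨⟨x, d⟩, h⟩ y (rfl : d = _)
    obtain rfl : x = y := h
    exact ⟨x, rfl, rfl⟩
  · exact fun x x' _ h => h

/-- The fibre over `(y, C)` consists of the points of `C`, and there are at least two of them. -/
theorem twoSurj_inSet_bigIncl : TwoSurj (pbSnd (inSet f) (bigIncl f)) := by
  intro z
  have h : z.1.1.2 ⊆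
      (inPt f).comp (pbFst (inSet f) (bigIncl f)) '' (pbSnd (inSet f) (bigIncl f) ⁻¹' {z}) :=
    fun x hx => ⟨⟨(⟨(x, z.1), hx⟩, z), rfl⟩, rfl, rfl⟩
  exact z.2.trans ((Set.ncard_le_ncard h (Set.toFinite _)).trans (Set.ncard_image_le
    (Set.toFinite _)))

end FinGSet

/-! ### The norm of a sum modulo terms of higher order -/

namespace OTambara

open IndexingSystem

variable {G : Type u} [Group G] [Finite G] {O : IndexingSystem G} {S : OTambara.{u, v} O}

/-- In the exponential diagram of the fold map, the map to `fibSub f` is a base change of `f`;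
`outSet f` is its restriction to a summand. -/
theorem adm_outSet {X Y : FinGSet G} {f : X →[G] Y} (hf : O.Adm f) : O.Adm (outSet f) :=
  adm_comp (adm_inl _ (inPts f)) (adm_pb (isExp_fold f).isPb hf)

theorem adm_inSet {X Y : FinGSet G} {f : X →[G] Y} (hf : O.Adm f) : O.Adm (inSet f) :=
  adm_comp (adm_inr (outPts f) _) (adm_pb (isExp_fold f).isPb hf)

/-- The norm of a sum, as the sum over the subsets of the fibres. -/
theorem nm_add {X Y : FinGSet G} (f : X →[G] Y) (hf : O.Adm f) (a b : S.obj X) :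
    S.nm f hf (a + b) = S.tr (fibSubProj f)
      (S.nm (outSet f) (adm_outSet hf) (S.res (outPt f) a) *
        S.nm (inSet f) (adm_inSet hf) (S.res (inPt f) b)) := by
  -- Writing the sum as a transfer along the fold map makes its norm accessible to Tambara
  -- reciprocity.
  have h : a + b = S.tr (fold X) (S.pair a b) := by
    rw [tr_pair]
    change _ = S.tr (MulActionHom.id G) a + S.tr (MulActionHom.id G) b
    rw [S.tr_id, S.tr_id]
  rw [h, S.nm_tr (isExp_fold f) hf (adm_pb (isExp_fold f).isPb hf), res_sumMap, nm_pair]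
  rfl

theorem tr_decomp {U V X Z : FinGSet G} {i : U →[G] X} {j : V →[G] X}
    (h : Function.Bijective (desc i j)) (f : X →[G] Z) (a : S.obj X) :
    S.tr f a = S.tr (f.comp i) (S.res i a) + S.tr (f.comp j) (S.res j a) :=
  S.toMackey.tr_decomp h f a

/-- The norm of a sum up to terms of order at least two in the second summand. -/
theorem nm_add_sub_mem {I J : TambaraIdeal S} (hJ : I.ContainsNorms J) {X Y : FinGSet G}
    (f : X →[G] Y) (hf : O.Adm f) (a : S.obj X) {b : S.obj X} (hb : b ∈ I.carrier X) :
    S.nm f hf (a + b) - S.nm f hf a -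
      S.tr f (S.nm (offSnd f) (adm_offSnd hf) (S.res (offFst f) a) * b) ∈ J.carrier Y := by
  obtain ⟨k0, hk0, h0⟩ := exists_isPb_outSet_emptySub f
  obtain ⟨k1, hk1, h1⟩ := exists_isPb_outSet_singleSub f
  obtain ⟨l1, hl1, h1'⟩ := exists_isPb_inSet_singleSub f
  have h2 := isPb_pb (inSet f) (bigIncl f)
  have hk := adm_pb h2 (adm_inSet hf)
  -- The composite `y ↦ (y, ∅) ↦ y` is the identity by definition.
  have e0 : ∀ z, S.tr ((fibSubProj f).comp (emptySub f)) z = z := S.tr_id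
  -- The sum over `(y, C)` is split by the size of `C`, and each factor is evaluated by the pullback
  -- square for its case. The term for `C = ∅` cancels `N_f(a)`.
  rw [nm_add, tr_decomp (desc_fibSub_bijective f), e0, map_mul, S.res_nm h0 _ hf,
    S.res_res (k := MulActionHom.id G) hk0, S.res_id, S.res_nm (isPb_inSet_emptySub f) _
    (adm_ofEmpty Y), S.obj_empty_eq_one (S.res _ (S.res _ b)), map_one, mul_one, res_desc, tr_pair,
    map_mul (S.res (singleSub f)), S.res_nm h1 _ (adm_offSnd hf), S.res_res hk1,
    S.res_nm h1' _ (adm_id X), S.nm_id,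
    S.res_res (k := MulActionHom.id G) hl1, S.res_id, map_mul (S.res (bigIncl f)),
    S.res_nm h2 _ hk, add_sub_cancel_left]
  -- The composite `x ↦ (f x, {x}) ↦ f x` is `f` by definition, so the singletons give exactly the
  -- subtracted linear term.
  change S.tr f _ + _ - S.tr f _ ∈ _
  rw [add_sub_cancel_left]
  -- What remains is a transfer of a multiple of the norm, along a 2-surjective map, of a
  -- restriction of `b ∈ I`.
  exact J.tr_mem _ _ (Ideal.mul_mem_left _ _ (hJ _ hk (twoSurj_inSet_bigIncl f) _
    (I.res_mem _ _ (I.res_mem _ _ hb))))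

/-! ### The ideal `I^{>1}` and the universal derivation `δ` -/

theorem TambaraIdeal.gtOne_containsNorms (I : TambaraIdeal S) : I.ContainsNorms I.gtOne := by
  intro X Y f hf h i hi
  simp only [gtOne, Submodule.mem_iInf]
  exact fun J => J.2 f hf h i hi

theorem TambaraIdeal.gtOne_le {I J : TambaraIdeal S} (hJ : I.ContainsNorms J) {X : FinGSet G}
    {a : S.obj X} (ha : a ∈ I.gtOne.carrier X) : a ∈ J.carrier X := by
  simp only [gtOne, Submodule.mem_iInf] at ha
  exact ha ⟨J, hJ⟩

variable {A : OTambara.{u, t} O} {B : OTambara.{u, v} O} (ι : OTambaraHom A B)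

theorem OmegaObj.mk_congr {X : FinGSet G} {i j : (box ι ι).obj X} (h : i = j) (hi hj) :
    OmegaObj.mk ι i hi = OmegaObj.mk ι j hj := by
  subst h
  rfl

theorem delta_add {X : FinGSet G} (b c : B.obj X) :
    delta ι X (b + c) = delta ι X b + delta ι X c := by
  refine OmegaObj.mk_congr ι ?_ _ (add_mem (diff_mem ι b) (diff_mem ι c))
  rw [map_add, map_add]
  abel

theorem delta_res {X Y : FinGSet G} (f : X →[G] Y) (b : B.obj Y) :
    delta ι X (B.res f b) = (Omega ι).res f (delta ι Y b) := by
  refine OmegaObj.mk_congr ι ?_ _ ((diffIdeal ι).res_mem f _ (diff_mem ι b))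
  rw [(inclRight ι ι).app_res, (inclLeft ι ι).app_res, map_sub]

theorem delta_tr {X Y : FinGSet G} (f : X →[G] Y) (b : B.obj X) :
    delta ι Y (B.tr f b) = (Omega ι).tr f (delta ι X b) := by
  refine OmegaObj.mk_congr ι ?_ _ ((diffIdeal ι).tr_mem f _ (diff_mem ι b))
  rw [(inclRight ι ι).app_tr, (inclLeft ι ι).app_tr, map_sub]

/-- Balancing over `A` identifies `a ⊗ 1` with `1 ⊗ a`. -/
theorem delta_base {X : FinGSet G} (a : A.obj X) : delta ι X (ι.app X a) = 0 := by
  refine OmegaObj.mk_congr ι ?_ _ (zero_mem _)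
  rw [sub_eq_zero]
  change BoxObj.mk ι ι _ 1 (ι.app X a) = BoxObj.mk ι ι _ (ι.app X a) 1
  have := BoxObj.mk_bal (ι := ι) (κ := ι) (MulActionHom.id G) a 1 1
  rw [mul_one] at this
  exact this.symm

/-- Expand the norm of `1 ⊗ s = s ⊗ 1 + (1 ⊗ s - s ⊗ 1)`. The second summand lies in `I`, so only
the constant and linear terms survive modulo `I^{>1}`. The linear coefficient is a norm of a
restriction of `s ⊗ 1`, hence acts as an element of `B`. -/
theorem delta_nm {X Y : FinGSet G} (f : X →[G] Y) (hf : O.Adm f) (s : B.obj X) :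
    delta ι Y (B.nm f hf s) = (Omega ι).tr f
      (B.nm (offSnd f) (adm_offSnd hf) (B.res (offFst f) s) • delta ι X s) := by
  have h := nm_add_sub_mem (diffIdeal ι).gtOne_containsNorms f hf ((inclLeft ι ι).app X s)
    (diff_mem ι s)
  rw [add_sub_cancel, ← (inclRight ι ι).app_nm, ← (inclLeft ι ι).app_nm, ← (inclLeft ι ι).app_res,
    ← (inclLeft ι ι).app_nm] at h
  exact OmegaObj.mk_eq.2 h

/-- Every element of the kernel of the multiplication is a transfer of a multiple of some
`1 ⊗ c - c ⊗ 1`. -/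
theorem exists_omega_eq {X : FinGSet G} (x : (Omega ι).obj X) :
    ∃ (U : FinGSet G) (p : U →[G] X) (b c : B.obj U),
      x = (Omega ι).tr p (b • delta ι U c) := by
  induction x using OmegaObj.ind with | _ i hi
  induction i using BoxObj.ind with | _ U p b c
  have hr : (inclLeft ι ι).app U b * (inclRight ι ι).app U c =
      BoxObj.mk ι ι (MulActionHom.id G) b c := by
    refine (BoxObj.mk_mul (BoxObj.isPb_id_left (MulActionHom.id G)) (r := MulActionHom.id G)
      fun _ => rfl).trans ?_
    rw [B.res_id, B.res_id, B.res_id, mul_one, one_mul]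
  -- This is what membership of `T_p(b ⊗ c)` in `I` means. It allows `T_p(bc ⊗ 1) = T_p(bc) ⊗ 1 = 0`
  -- to be subtracted, which turns `b ⊗ c` into `(b ⊗ 1)(1 ⊗ c - c ⊗ 1)` under the transfer.
  have hm : B.tr p (b * c) = 0 := hi
  have ht : (box ι ι).tr p ((inclLeft ι ι).app U b * (inclRight ι ι).app U c) =
      BoxObj.mk ι ι p b c := by rw [hr]; rfl
  refine ⟨U, p, b, c, OmegaObj.mk_congr ι ?_ hi
    ((diffIdeal ι).tr_mem p _ (Ideal.mul_mem_left _ _ (diff_mem ι c)))⟩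
  refine ht.symm.trans (Eq.symm ?_)
  change (box ι ι).tr p ((inclLeft ι ι).app U b *
    ((inclRight ι ι).app U c - (inclLeft ι ι).app U c)) = _
  rw [mul_sub, ← map_mul (f := (inclLeft ι ι).app U), map_sub, ← (inclLeft ι ι).app_tr, hm,
    map_zero, sub_zero]

end OTambara

/-! ### Sections through a given point -/

namespace FinGSet

variable {G : Type u} [Group G]

/-- The map `X ⊔ X → offDiag` enumerating the pairs of different points in the fibres of the
fold map. -/
def foldOff (X : FinGSet G) : X.sum X →[G] offDiag (fold X) where
  toFun := fun z => ⟨⟨(Sum.swap z, z), by rcases z with z | z <;> rfl⟩, by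
    rcases z with z | z
    · exact Sum.inr_ne_inl
    · exact Sum.inl_ne_inr⟩
  map_smul' m z := by rcases z with z | z <;> rfl

/-- A point of `E` is a section `s` of `p` over a fibre of `f` together with a point `x` of that
fibre, and `f'` evaluates `s` at `x`. For fixed `u` over `x`, the sections through `u` correspond to
the sections over the fibre with `x` removed. Hence `f' : E → U` is itself the `∏` of an exponential
diagram. Its evaluation space is `offDiag g'`, the sections with two different marked points `x'`
and `x`, and `k` evaluates at both. -/
theorem isExp_away {U X Y D E : FinGSet G} {p : U →[G] X} {f : X →[G] Y} {f' : E →[G] U}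
    {g' : E →[G] D} {h' : D →[G] Y} (H : IsExp p f f' g' h')
    {k : offDiag g' →[G] pb p ((offFst f).comp (pbFst (offSnd f) p))}
    (hk1 : ∀ z, (k z).1.1 = f' z.1.1.1) (hk2 : ∀ z, (k z).1.2.1.2 = f' z.1.1.2) :
    IsExp (pbSnd p ((offFst f).comp (pbFst (offSnd f) p))) (pbSnd (offSnd f) p) k (offSnd g')
      f' := by
  have hk3 : ∀ z, (k z).1.2.1.1.1.1.1 = p (f' z.1.1.1) := fun z =>
    (k z).2.symm.trans (congrArg p (hk1 z))
  -- A point here is `((x', x), u)` with `x = p u`, so `x'` and `u` determine it.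
  have ext : ∀ a b : pb (offSnd f) p, a.1.1.1.1.1 = b.1.1.1.1.1 → a.1.2 = b.1.2 → a = b := by
    intro a b h1 h2
    refine Subtype.ext (Prod.ext (Subtype.ext (Subtype.ext (Prod.ext h1 ?_))) h2)
    exact a.2.trans ((congrArg p h2).trans b.2.symm)
  refine IsExp.mk' hk2 ?_ ?_ ?_ ?_
  · intro v e (hv : v.1.2 = f' e)
    have hv' : f v.1.1.1.1.1 = h' (g' e) := by
      rw [← H.comm, ← hv]
      exact v.1.1.1.2.trans (congrArg f v.2)
    obtain ⟨e', he', hg⟩ := H.fib _ _ hv'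
    refine ⟨⟨⟨(e', e), hg⟩, ?_⟩, ?_, rfl⟩
    · rintro (rfl : e' = e)
      exact v.1.1.2 (he'.symm.trans ((congrArg p hv).symm.trans v.2.symm))
    · refine ext _ _ ?_ ?_
      · exact (hk3 _).trans he'
      · exact (hk2 _).trans hv.symm
  · rintro z z' h1 (h2 : z.1.1.2 = z'.1.1.2)
    refine Subtype.ext (Subtype.ext (Prod.ext (H.ext_e ?_ ?_) h2))
    · rw [← hk3, ← hk3]
      exact congrArg (fun a : pb (offSnd f) p => a.1.1.1.1.1) h1
    · rw [z.1.2, z'.1.2, h2]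
  · intro u s hs
    classical
    have hv : ∀ (x : {x // f x = f (p u)}) (hx : x.1 ≠ p u),
        pbSnd (offSnd f) p (⟨(⟨⟨(x.1, p u), x.2⟩, hx⟩, u), rfl⟩ : pb (offSnd f) p) = u :=
      fun _ _ => rfl
    -- The given section away from `p u` is completed by the value `u` at `p u`. The required point
    -- of `E` is the resulting section marked at `p u`.
    obtain ⟨d, hd, hds⟩ := H.exists_sec (f (p u))
      (fun x => if hx : x.1 = p u then u else (s ⟨_, hv x hx⟩).1.1) (by
        intro x
        dsimp only
        split_ifs with hx
        · exact hx.symm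
        · exact (s ⟨_, hv x hx⟩).2.trans
            (congrArg (fun a : pb (offSnd f) p => a.1.1.1.1.1) (hs ⟨_, hv x hx⟩)))
    obtain ⟨e, he, hed⟩ := H.fib (p u) d hd.symm
    have hfe : f' e = u := (hds e hed ⟨p u, rfl⟩ he).trans (dif_pos rfl)
    refine ⟨e, hfe, ?_⟩
    rintro ⟨⟨⟨a, e'⟩, ha⟩, hne⟩ (rfl : e' = e) v hz
    have hx : p (f' a) = v.1.1.1.1.1.1 :=
      (hk3 ⟨⟨(a, e'), ha⟩, hne⟩).symm.trans (congrArg (fun a : pb (offSnd f) p => a.1.1.1.1.1) hz)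
    have hpa : p (f' a) ≠ p u := fun h => hne (H.ext_e (h.trans he.symm) ha)
    have hfa : f (p (f' a)) = f (p u) := (H.comm a).trans ((congrArg h' (ha.trans hed)).trans hd)
    have h1 := (hds a (ha.trans hed) ⟨_, hfa⟩ rfl).trans (dif_neg hpa)
    have hvv : (⟨_, hv ⟨_, hfa⟩ hpa⟩ : {v // pbSnd (offSnd f) p v = u}) = v :=
      Subtype.ext (ext _ _ hx v.2.symm)
    rw [hvv] at h1
    exact Subtype.ext (Prod.ext ((hk1 _).trans h1) (hz.trans (hs v).symm))
  · intro e e' h1 hs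
    -- The two underlying sections agree at the marked point because `f' e = f' e'`, and at every
    -- other point by `hs`.
    have hg : g' e = g' e' := by
      refine H.ext (by rw [← H.comm, ← H.comm, h1]) fun a a' ha ha' haa => ?_
      by_cases hae : a = e
      · subst hae
        obtain rfl : a' = e' := H.ext_e (haa.symm.trans (congrArg p h1)) ha'
        exact h1
      · have hae' : a' ≠ e' := by
          rintro rfl
          exact hae (H.ext_e (haa.trans (congrArg p h1.symm)) ha)
        have := hs ⟨⟨(a, e), ha⟩, hae⟩ ⟨⟨(a', e'), ha'⟩, hae'⟩ rfl rfl
          (ext _ _ ((hk3 _).trans (haa.trans (hk3 ⟨⟨(a', e'), ha'⟩,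
            hae'⟩).symm)) ((hk2 _).trans (h1.trans (hk2 ⟨⟨(a', e'), ha'⟩, hae'⟩).symm)))
        rw [← show _ = f' a from hk1 ⟨⟨(a, e), ha⟩, hae⟩, this]
        exact hk1 _
    exact H.ext_e (congrArg p h1) hg

/-- The pairs of different points in a fibre of the second map of an exponential diagram evaluate to
pairs of points of the total space over different points of the base. -/
def expOff {U X Y D E : FinGSet G} {p : U →[G] X} {f : X →[G] Y} {f' : E →[G] U}
    {g' : E →[G] D} {h' : D →[G] Y} (H : IsExp p f f' g' h') :
    offDiag g' →[G] pb p ((offFst f).comp (pbFst (offSnd f) p)) :=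
  pbLift _ _ (f'.comp (offFst g'))
    (pbLift _ _
      (⟨fun z => ⟨⟨(p (f' z.1.1.1), p (f' z.1.1.2)), (H.comm _).trans
          ((congrArg h' z.1.2).trans (H.comm _).symm)⟩, fun h => z.2 (H.ext_e h z.1.2)⟩,
        fun m z => Subtype.ext (Subtype.ext (Prod.ext (map_smul (p.comp f') m _)
          (map_smul (p.comp f') m _)))⟩ : offDiag g' →[G] offDiag f)
      (f'.comp (offSnd g')) fun _ => rfl) fun _ => rfl

end FinGSet

/-! ### Fold maps, and norms of transfers off the diagonal -/

namespace MackeyFunctor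

variable {G : Type u} [Group G] [Finite G] (M : MackeyFunctor.{u, v} G)

theorem tr_fold {X : FinGSet G} (a : M.obj (X.sum X)) :
    M.tr (fold X) a = M.res (inl X X) a + M.res (inr X X) a := by
  rw [tr_sum]
  exact congrArg₂ (· + ·) (M.tr_id _) (M.tr_id _)

end MackeyFunctor

namespace OTambara

open IndexingSystem

variable {G : Type u} [Group G] [Finite G] {O : IndexingSystem G}

/-- The fold map preserves stabilizers, so the orbits to be tested are single points. Multiplication
is therefore a norm for every indexing system. -/
theorem adm_fold (X : FinGSet G) : O.Adm (fold X) := by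
  intro x
  refine O.trivial_mem fun h t => ?_
  have hx : MulAction.stabilizer G x = MulAction.stabilizer G (fold X x) := by
    refine le_antisymm (stab_le _ x) fun g hg => ?_
    rw [MulAction.mem_stabilizer_iff] at hg ⊢
    rcases x with x | x
    · exact congrArg Sum.inl hg
    · exact congrArg Sum.inr hg
  have : Subsingleton (MulAction.stabilizer G (fold X x) ⧸
      (MulAction.stabilizer G x).subgroupOf (MulAction.stabilizer G (fold X x))) := by
    rw [hx, Subgroup.subgroupOf_self]
    exact QuotientGroup.subsingleton_quotient_top
  exact Subsingleton.elim _ _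

variable (S : OTambara.{u, v} O)

theorem nm_fold {X : FinGSet G} (a b : S.obj X) :
    S.nm (fold X) (adm_fold X) (S.pair a b) = a * b := by
  rw [nm_pair]
  exact congrArg₂ (· * ·) (S.nm_id (adm_id X) a) (S.nm_id (adm_id X) b)

/-- Fibres of the fold map have exactly two points, so the complement of the diagonal is a copy of
`X ⊔ X` on which `π₂` is the identity and `π₁` swaps the summands. -/
theorem nm_offSnd_fold {X : FinGSet G} (a b : S.obj X) :
    S.nm (offSnd (fold X)) (adm_offSnd (adm_fold X)) (S.res (offFst (fold X)) (S.pair a b)) =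
      S.pair b a := by
  have h : IsPb (foldOff X) (MulActionHom.id G) (offSnd (fold X)) (MulActionHom.id G) := by
    refine IsPb.mk' (fun _ => rfl) ?_ fun _ _ _ h => h
    rintro ⟨⟨⟨x, y⟩, h⟩, hne⟩ z (rfl : y = z)
    refine ⟨y, ?_, rfl⟩
    refine Subtype.ext (Subtype.ext (Prod.ext ?_ rfl))
    change Sum.swap y = x
    rcases x with x | x <;> rcases y with y | y
    · exact (hne (congrArg Sum.inl h)).elim
    · exact congrArg Sum.inl (Eq.symm h)
    · exact congrArg Sum.inr (Eq.symm h)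
    · exact (hne (congrArg Sum.inr h)).elim
  rw [← S.res_id (S.nm _ _ _), S.res_nm h _ (adm_id _), S.nm_id,
    S.res_res (k := desc (inr X X) (inl X X)), res_desc,
    res_inl_pair, res_inr_pair]
  rintro (z | z) <;> rfl

/-- Expanding the norm of a transfer over the points different from a given one. -/
theorem res_nm_offSnd_tr {U X Y D E : FinGSet G} {p : U →[G] X} {f : X →[G] Y} {f' : E →[G] U}
    {g' : E →[G] D} {h' : D →[G] Y} (H : IsExp p f f' g' h') (hf : O.Adm f) (hg' : O.Adm g')
    (a : S.obj U) :
    S.res p (S.nm (offSnd f) (adm_offSnd hf) (S.res (offFst f) (S.tr p a))) =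
      S.tr f' (S.nm (offSnd g') (adm_offSnd hg') (S.res (offFst g') (S.res f' a))) := by
  have h1 := isPb_pb (offSnd f) p
  have h2 := isPb_pb p ((offFst f).comp (pbFst (offSnd f) p))
  have hp := adm_pb h1 (adm_offSnd hf)
  -- Base change along `p` fixes a point `u` over the omitted point of the fibre; after that,
  -- `isExp_away` lets the norm and the transfer be exchanged.
  rw [S.res_nm h1 _ hp, S.res_res (k := (offFst f).comp (pbFst (offSnd f) p)) (fun _ => rfl),
    S.res_tr h2, S.nm_tr (isExp_away H (k := expOff H) (fun _ => rfl) fun _ => rfl) hp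
      (adm_offSnd hg')]
  congr 2
  refine S.res_sq ?_ a
  exact fun _ => rfl

end OTambara

/-! ### The Leibniz rule for genuine derivations -/

namespace Der

open IndexingSystem OTambara BoxObj

variable {G : Type u} [Group G] [Finite G] {O : IndexingSystem G} {A : OTambara.{u, t} O}
  {B : OTambara.{u, v} O} {ι : OTambaraHom A B} {W : TModule.{u, v, w} B} (d : Der ι W)

theorem map_res {X Y : FinGSet G} (f : X →[G] Y) (b : B.obj Y) :
    d.1 X (B.res f b) = W.res f (d.1 Y b) := d.2.1.1 f b

theorem map_tr {X Y : FinGSet G} (f : X →[G] Y) (b : B.obj X) :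
    d.1 Y (B.tr f b) = W.tr f (d.1 X b) := d.2.1.2 f b

theorem map_base {X : FinGSet G} (a : A.obj X) : d.1 X (ι.app X a) = 0 := d.2.2.1 X a

theorem map_nm {X Y : FinGSet G} (f : X →[G] Y) (hf : O.Adm f) (b : B.obj X) :
    d.1 Y (B.nm f hf b) =
      W.tr f (B.nm (offSnd f) (adm_offSnd hf) (B.res (offFst f) b) • d.1 X b) := d.2.2.2 f hf b

/-- A genuine derivation satisfies the Leibniz rule. -/
theorem map_mul {X : FinGSet G} (a b : B.obj X) :
    d.1 X (a * b) = a • d.1 X b + b • d.1 X a := by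
  -- `ab` is the norm of `(a, b)` along the fold map, and the norm formula reads `d(ab) = T((b, a) ·
  -- (d a, d b))` for the transfer `T` along the fold map.
  have h := map_nm d (fold X) (adm_fold X) (B.pair a b)
  rw [nm_fold, nm_offSnd_fold, W.tr_fold, W.res_smul, W.res_smul, ← map_res, ← map_res,
    res_inl_pair,
    res_inr_pair, res_inl_pair, res_inr_pair] at h
  rw [h, add_comm]

end Der

/-! ### Extension of a derivation to the box product and descent to `Ω` -/

namespace Der

open IndexingSystem OTambara BoxObj

variable {G : Type u} [Group G] [Finite G] {O : IndexingSystem G} {A : OTambara.{u, t} O}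
  {B : OTambara.{u, v} O} {ι : OTambaraHom A B} {W : TModule.{u, v, w} B} (d : Der ι W)

/-- The map `T_p(b ⊗ c) ↦ T_p(b d(c))` on underlying sets. -/
def boxFun (X : FinGSet G) : BoxObj ι ι X → W.obj X :=
  Quot.lift (fun x => W.tr x.p (x.fst • d.1 x.U x.snd))
    (rel_cases
      (fun r q b c => by
        change W.tr (q.comp r) (b • d.1 _ (B.res r c)) = W.tr q (B.tr r b • d.1 _ c)
        rw [W.tr_comp, map_res, W.tr_smul])
      (fun r q b c => by
        change W.tr (q.comp r) (B.res r b • d.1 _ c) = W.tr q (b • d.1 _ (B.tr r c))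
        rw [W.tr_comp, map_tr, W.smul_tr])
      -- Compatibility with balancing is `A`-linearity of `d`: since `d` kills the image of `A`, the
      -- Leibniz rule gives `d(ac) = a · d(c)`.
      fun q a b c => by
        change W.tr q ((ι.app _ a * b) • d.1 _ c) = W.tr q (b • d.1 _ (ι.app _ a * c))
        rw [map_mul, map_base, smul_zero, add_zero, smul_smul, mul_comm])

theorem boxFun_mk {X U : FinGSet G} (p : U →[G] X) (b c : B.obj U) :
    boxFun d X (BoxObj.mk ι ι p b c) = W.tr p (b • d.1 U c) := rfl

/-- The derivation of `B ⊠_A B` over its left factor with values in `W` extending `d`: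
`T_p(b ⊗ c) ↦ T_p(b d(c))`. -/
noncomputable def boxMap (X : FinGSet G) : (box ι ι).obj X →+ W.obj X :=
  AddMonoidHom.mk' (boxFun d X) fun x y => by
    induction x using BoxObj.ind with | _ U p b c
    induction y using BoxObj.ind with | _ V q b' c'
    change boxFun d X (BoxObj.mk ι ι p b c + BoxObj.mk ι ι q b' c') = _
    rw [mk_add, boxFun_mk, boxFun_mk, boxFun_mk, W.tr_sum, W.res_smul, W.res_smul, ← map_res,
      ← map_res]
    simp only [res_inl_pair, res_inr_pair]
    rfl

theorem boxMap_mk {X U : FinGSet G} (p : U →[G] X) (b c : B.obj U) :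
    boxMap d X (BoxObj.mk ι ι p b c) = W.tr p (b • d.1 U c) := rfl

theorem mu_mk {X U : FinGSet G} (p : U →[G] X) (b c : B.obj U) :
    (mu ι).app X (BoxObj.mk ι ι p b c) = B.tr p (b * c) := rfl

theorem boxMap_res {X Y : FinGSet G} (f : X →[G] Y) (x : (box ι ι).obj Y) :
    boxMap d X ((box ι ι).res f x) = W.res f (boxMap d Y x) := by
  induction x using BoxObj.ind with | _ U p b c
  have h := isPb_pb f p
  refine (congrArg (boxMap d X) (res_apply h)).trans ?_
  rw [boxMap_mk, boxMap_mk, W.res_tr (isPb_symm h), W.res_smul, map_res]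

theorem boxMap_tr {X Y : FinGSet G} (f : X →[G] Y) (x : (box ι ι).obj X) :
    boxMap d Y ((box ι ι).tr f x) = W.tr f (boxMap d X x) := by
  induction x using BoxObj.ind with | _ U p b c
  exact W.tr_comp f p _

/-- The value on `b ⊗ 1` is `b · d(1)`, and `1` comes from `A`. -/
theorem boxMap_left {X : FinGSet G} (b : B.obj X) : boxMap d X ((inclLeft ι ι).app X b) = 0 := by
  change W.tr (MulActionHom.id G) (b • d.1 X 1) = 0
  rw [← map_one (ι.app X), map_base, smul_zero, map_zero]

theorem boxMap_right {X : FinGSet G} (b : B.obj X) :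
    boxMap d X ((inclRight ι ι).app X b) = d.1 X b := by
  change W.tr (MulActionHom.id G) ((1 : B.obj X) • d.1 X b) = _
  rw [W.tr_id, one_smul]

theorem mu_left {X : FinGSet G} (b : B.obj X) : (mu ι).app X ((inclLeft ι ι).app X b) = b := by
  change B.tr (MulActionHom.id G) (b * 1) = b
  rw [B.tr_id, mul_one]

/-- The Leibniz rule on the box product. -/
theorem boxMap_mul {X : FinGSet G} (x y : (box ι ι).obj X) :
    boxMap d X (x * y) = (mu ι).app X x • boxMap d X y + (mu ι).app X y • boxMap d X x := by
  induction x using BoxObj.ind with | _ U p b c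
  induction y using BoxObj.ind with | _ V q b' c'
  have h := isPb_pb p q
  refine (congrArg (boxMap d X) (mk_mul h (r := p.comp (pbFst p q)) fun _ => rfl)).trans ?_
  -- All terms become transfers from `U ×_X V` along the common composite to `X`, where the identity
  -- reduces to the Leibniz rule for the product of the two right-hand factors.
  rw [mu_mk, mu_mk, boxMap_mk, boxMap_mk, boxMap_mk, W.tr_smul, W.tr_smul, W.res_tr (isPb_symm h),
    W.res_tr h, W.smul_tr, W.smul_tr, ← W.tr_comp, ← W.tr_comp,
    ← show p.comp (pbFst p q) = q.comp (pbSnd p q) from MulActionHom.ext fun z => z.2, ← map_add]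
  congr 1
  rw [W.res_smul, W.res_smul, map_mul, map_res, map_res, _root_.map_mul, _root_.map_mul, smul_add,
    smul_smul,
    smul_smul, smul_smul, smul_smul]
  congr 2 <;> ring

/-- The norm formula on the box product. -/
theorem boxMap_nm {X Y : FinGSet G} (f : X →[G] Y) (hf : O.Adm f) (x : (box ι ι).obj X) :
    boxMap d Y ((box ι ι).nm f hf x) = W.tr f (B.nm (offSnd f) (adm_offSnd hf)
      (B.res (offFst f) ((mu ι).app X x)) • boxMap d X x) := by
  induction x using BoxObj.ind with | _ U p b c
  have H := isExp_pi p f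
  have hg := adm_pb H.isPb hf
  refine (congrArg (boxMap d Y) (nm_apply hf b c H hg)).trans ?_
  -- Let `f', g', h'` be the maps of the exponential diagram and let `π₁, π₂` belong to `offDiag
  -- g'`. On the left, `res_nm_self` splits the restricted norm of `b` as `R_{f'} b · N_{π₂} R_{π₁}
  -- R_{f'} b`. On the right, `res_nm_offSnd_tr` turns the coefficient into a transfer along `f'`.
  -- Both sides become the transfer along `f ∘ p ∘ f' = h' ∘ g'` of `N_{π₂} R_{π₁} R_{f'}(bc) ·
  -- R_{f'} b · d(R_{f'} c)`.
  rw [mu_mk, boxMap_mk, boxMap_mk, W.smul_tr, res_nm_offSnd_tr B H hf hg, W.tr_smul, map_nm,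
    W.smul_tr,
    res_nm_self, ← W.tr_comp, ← W.tr_comp, ← W.tr_comp,
    ← show (f.comp p).comp (piEvFst p f) = (piProj p f).comp (piEvSnd p f) from
      MulActionHom.ext fun z => H.comm z]
  congr 1
  rw [W.res_smul, map_res, _root_.map_mul, _root_.map_mul, _root_.map_mul, smul_smul, smul_smul]
  congr 1
  ring

/-- The elements of `I` at which the extension of `d` to the box product vanishes. -/
noncomputable def boxKer : TambaraIdeal (box ι ι) where
  carrier X :=
    -- The zeros of `boxMap d` alone need not be closed under multiplication: the Leibniz rule for
    -- `yx` leaves the term `μ(x) · boxMap d y`, which the condition `μ(x) = 0` removes.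
    { carrier := {x | (mu ι).app X x = 0 ∧ boxMap d X x = 0}
      zero_mem' := ⟨map_zero _, map_zero _⟩
      add_mem' := fun {x y} hx hy => ⟨by rw [map_add, hx.1, hy.1, add_zero],
        by rw [map_add, hx.2, hy.2, add_zero]⟩
      smul_mem' := fun y x hx => ⟨by rw [smul_eq_mul, _root_.map_mul, hx.1, mul_zero],
        by rw [smul_eq_mul, boxMap_mul, hx.1, hx.2, smul_zero, zero_smul, add_zero]⟩ }
  res_mem f a ha := ⟨(diffIdeal ι).res_mem f a ha.1, by rw [boxMap_res, ha.2, map_zero]⟩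
  tr_mem f a ha := ⟨(diffIdeal ι).tr_mem f a ha.1, by rw [boxMap_tr, ha.2, map_zero]⟩
  nm_mem f hf a ha := ⟨(diffIdeal ι).nm_mem f hf a ha.1, by
    rw [map_sub, boxMap_nm, boxMap_nm, ha.2, map_zero (boxMap d _), smul_zero, smul_zero, sub_self]⟩

/-- For `i ∈ I` the norm formula has coefficient `N_{π₂}(0)`, and 2-surjectivity makes `π₂`
surjective, so it vanishes. Likewise `μ(N_f i) = N_f(0) = 0`. By minimality of `I^{>1}`, the
extension of `d` then descends to `Ω`. -/
theorem boxKer_containsNorms : (diffIdeal ι).ContainsNorms (boxKer d) := by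
  intro X Y f hf h i hi
  have hi' : (mu ι).app X i = 0 := hi
  refine ⟨?_, ?_⟩
  · rw [(mu ι).app_nm, hi', nm_zero _ _ h.surjective]
  · rw [boxMap_nm, hi', map_zero, nm_zero _ _ h.offSnd_surjective, zero_smul, map_zero]

/-- The map `Ω → W` induced by a derivation `B → W`. -/
noncomputable def lift (X : FinGSet G) : (Omega ι).obj X →+ W.obj X :=
  QuotientAddGroup.lift
    (((diffIdeal ι).gtOne.carrier X).submoduleOf ((diffIdeal ι).carrier X)).toAddSubgroup
    ((boxMap d X).comp ((diffIdeal ι).carrier X).toAddSubgroup.subtype)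
    fun i hi => (TambaraIdeal.gtOne_le (boxKer_containsNorms d) hi).2

/-- Linearity over `B` is the Leibniz rule for `(b ⊗ 1) · i`: the extension of `d` kills `b ⊗ 1`,
and `μ(b ⊗ 1) = b`. -/
theorem lift_mem : lift d ∈ ModHom (Omega ι) W := by
  refine ⟨⟨fun f x => ?_, fun f x => ?_⟩, fun X s x => ?_⟩
  · induction x using OmegaObj.ind with | _ i hi
    exact boxMap_res d f i
  · induction x using OmegaObj.ind with | _ i hi
    exact boxMap_tr d f i
  · induction x using OmegaObj.ind with | _ i hi
    refine (boxMap_mul d ((inclLeft ι ι).app X s) i).trans ?_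
    rw [boxMap_left, smul_zero, add_zero, mu_left]
    rfl

theorem lift_delta {X : FinGSet G} (b : B.obj X) : lift d X (delta ι X b) = d.1 X b := by
  change boxMap d X ((inclRight ι ι).app X b - (inclLeft ι ι).app X b) = _
  rw [map_sub, boxMap_left, boxMap_right, sub_zero]

end Der

/-! ### The isomorphism -/

namespace OTambara

open IndexingSystem

variable {G : Type u} [Group G] [Finite G] {O : IndexingSystem G} {A : OTambara.{u, t} O}
  {B : OTambara.{u, v} O} (ι : OTambaraHom A B) {W : TModule.{u, v, w} B}

/-- The map `δ : B → Ω` as a homomorphism of groups. -/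
noncomputable def deltaHom (X : FinGSet G) : B.obj X →+ (Omega ι).obj X :=
  AddMonoidHom.mk' (delta ι X) fun b c => delta_add ι b c

/-- Composition with `δ` sends module homomorphisms to genuine derivations. -/
theorem comp_delta_mem (h : ModHom (Omega ι) W) :
    (fun X => (h.1 X).comp (deltaHom ι X)) ∈ Der ι W := by
  refine ⟨⟨fun f b => ?_, fun f b => ?_⟩, fun X a => ?_, fun f hf s => ?_⟩
  · change h.1 _ (delta ι _ (B.res f b)) = W.res f (h.1 _ (delta ι _ b))
    exact (congrArg (h.1 _) (delta_res ι f b)).trans (h.2.1.1 f _)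
  · change h.1 _ (delta ι _ (B.tr f b)) = W.tr f (h.1 _ (delta ι _ b))
    exact (congrArg (h.1 _) (delta_tr ι f b)).trans (h.2.1.2 f _)
  · change h.1 _ (delta ι _ (ι.app X a)) = 0
    rw [delta_base, map_zero]
  · change h.1 _ (delta ι _ (B.nm f hf s)) = W.tr f (_ • h.1 _ (delta ι _ s))
    rw [delta_nm, ← h.2.2]
    exact h.2.1.2 f _

/-- The homomorphism `h ↦ h ∘ δ`. -/
noncomputable def compDelta : ModHom (Omega ι) W →+ Der ι W :=
  AddMonoidHom.mk' (fun h => ⟨fun X => (h.1 X).comp (deltaHom ι X), comp_delta_mem ι h⟩)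
    fun _ _ => rfl

/-- Every element of `Ω` is a single `T_p(b · δ(c))`, and a module map sends it to `T_p(b · h(δ
c))`. -/
theorem compDelta_injective : Function.Injective (compDelta ι (W := W)) := by
  intro h h' e
  refine Subtype.ext (funext fun X => AddMonoidHom.ext fun x => ?_)
  obtain ⟨U, p, b, c, rfl⟩ := exists_omega_eq ι x
  have e' : h.1 U (delta ι U c) = h'.1 U (delta ι U c) :=
    congrArg (fun d : Der ι W => d.1 U c) e
  have key : ∀ k : ModHom (Omega ι) W,
      k.1 X ((Omega ι).tr p (b • delta ι U c)) = W.tr p (b • k.1 U (delta ι U c)) := fun k =>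
    (k.2.1.2 p _).trans (congrArg (W.tr p) (k.2.2 U b _))
  rw [key, key, e']

theorem compDelta_surjective : Function.Surjective (compDelta ι (W := W)) := fun d =>
  ⟨⟨Der.lift d, Der.lift_mem d⟩,
    Subtype.ext (funext fun _ => AddMonoidHom.ext fun b => Der.lift_delta d b)⟩

end OTambara

theorem mainTheorem3 {G : Type u} [Group G] [Finite G] (O : IndexingSystem G)
    (A : OTambara.{u, t} O) (B : OTambara.{u, v} O) (ι : OTambaraHom A B)
    (W : TModule.{u, v, w} B) :
    ∃ e : ModHom (OTambara.Omega ι) W ≃+ Der ι W,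
      ∀ (h : ModHom (OTambara.Omega ι) W) (X : FinGSet G) (b : B.obj X),
        (e h).1 X b = h.1 X (OTambara.delta ι X b) :=
  ⟨AddEquiv.ofBijective (OTambara.compDelta ι)
    ⟨OTambara.compDelta_injective ι, OTambara.compDelta_surjective ι⟩, fun _ _ _ => rfl⟩
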